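/- Let $n\ge 2$ and let $H=H(2,n)$ be the Hamming graph with vertex set $V=\{0,\dots,n-1\}^2$, two distinct vertices being joined by an edge if they lie in a common row $L_i=\{0,\dots,n-1\}\times\{i\}$ or a common column $D_i=\{i\}\times\{0,\dots,n-1\}$; let $E$ be its edge set. For $A\subset V$ put $\iota(A)=\max\{\max_i|L_i\cap A|,\max_i|D_i\cap A|\}$. Let the bridges $\mathcal M$ be a Poisson point process on $E\times[0,\infty)$ with intensity $|E|^{-1}\#\otimes\mathrm{Leb}$; a point $(\{v,w\},z)$ is a bridge between the bars of $v$ and $w$ at height $z$. For $t>0$, $\sigma_t(v)$ is the vertex reached at height $t$ by starting at $(v,0)$, moving upwards, and crossing every bridge that is met. Let $\mathrm{orb}^k_t(v)=\{\sigma_t^{\ell}(v):0\le \ell\le k\}$. The cyclic random walk on $V\times[0,t]$, started at $(v,z)$, moves upwards at unit speed on bars, periodically in height (from height $t$ it continues at height $0$), and crosses every bridge of height at most $t$ that it meets. Let $\mathcal Z_s$ be the set of vertices whose bar it has visited up to time $s$, $T_k=T^t_k(v,z)=\inf\{s\ge0:|\mathcal Z_s|\ge k\}$ (with $\inf\emptyset=\infty$)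 and $Z_k=\mathcal Z_{T_k}$. If no starting point is indicated, it is $((0,0),0)$. (1) For all $n\ge2$, $t>0$, $v\in V$, $z\in[0,t]$ and $k,M\in\mathbb N$ with $k\le n/2$, for the walk started at $(v,z)$, $$\mathbb P(|Z_k\cap L_0|\ge M)\le\Big(1-\tfrac{t^2}{4n^2(n-1)^2}e^{-4t/n^2}\big(\mathbb P(T_k<\infty)-\tfrac{10k}{n}e^{2t/n^2}\big)\Big)^{\lfloor M/2\rfloor}.$$ (2) For all $n\ge 2$, $t>0$ and $k,M\in\mathbb N$ such that $K=\lceil 2e^{2t/n^2}k\rceil$ satisfies $K\le n/2$, $$\mathbb P\Big(\max_{v\in V}\iota(\mathrm{orb}^k_t(v))\ge M\Big)\le n^4\Big(1-\tfrac{t^2}{4n^2(n-1)^2}e^{-4t/n^2}\big(\mathbb P(T_K<\infty)-\tfrac{10K}{n}e^{2t/n^2}\big)\Big)^{\lfloor M/2\rfloor}+n^2e^{-e^{-2t/n^2}k}.$$ (3) Let $c>0$ and let $t=t(n)\in[c^{-1}n^2,cn^2]$, $0\le\Delta=\Delta(n)\le n/\log n$ and $k=k(n)\in\mathbb N$ with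 $k\le n/\log n$ be sequences such that $$\liminf_{n\to\infty}\ \inf_{s\in[t-\Delta,t]}\mathbb P(T^s_k<\infty)>0 .$$ Then there are constants $\kappa,C>0$ such that for all $n\ge2$ $$\mathbb P\Big(\sup_{s\in[t-\Delta,t]}\ \max_{v\in V}\ \iota(\mathrm{orb}^k_s(v))\ge\log^2 n\Big)\le Ce^{-\kappa\log^2 n}.$$ -/

import Mathlib

open MeasureTheory ProbabilityTheory Filter
open scoped ENNReal NNReal

namespace Interchange

/-- Vertices `{0,…,n-1}²` of the two-dimensional Hamming graph. -/
abbrev Vertex (n : ℕ) : Type := Fin n × Fin n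

/-- The Hamming graph `H(2,n)`: distinct vertices in a common row or column are adjacent. -/
def hamming (n : ℕ) : SimpleGraph (Vertex n) where
  Adj v w := v ≠ w ∧ (v.1 = w.1 ∨ v.2 = w.2)
  symm := ⟨fun _ _ h => ⟨h.1.symm, h.2.imp Eq.symm Eq.symm⟩⟩
  loopless := ⟨fun _ h => h.1 rfl⟩

/-- Edges of `H(2,n)`. -/
abbrev Edge (n : ℕ) : Type := {e : Sym2 (Vertex n) // e ∈ (hamming n).edgeSet}

instance instMeasurableSpaceEdge (n : ℕ) : MeasurableSpace (Edge n) := ⊤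

/-- The row `L_i`. -/
def row {n : ℕ} (i : Fin n) : Set (Vertex n) := {v | v.2 = i}

/-- The column `D_i`. -/
def column {n : ℕ} (i : Fin n) : Set (Vertex n) := {v | v.1 = i}

/-- `ι(A)`, the largest number of vertices that `A` has in a row or a column. -/
noncomputable def iota {n : ℕ} (A : Set (Vertex n)) : ℕ :=
  max (Finset.univ.sup fun i => (row i ∩ A).ncard)
    (Finset.univ.sup fun i => (column i ∩ A).ncard)

/-- The vertex `(0,0)`. -/
def origin (n : ℕ) (hn : 2 ≤ n) : Vertex n := (⟨0, by omega⟩, ⟨0, by omega⟩)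

/-- `N` is a (simple) Poisson point process on `S` with intensity measure `Λ`: the counts of
sets of finite intensity are Poisson distributed, and the counts of finitely many disjoint sets
are independent. -/
structure IsPoissonPointProcess {Ω S : Type*} [MeasurableSpace Ω] [MeasurableSpace S]
    (P : Measure Ω) (Λ : Measure S) (N : Ω → Set S) : Prop where
  measurable_count : ∀ B : Set S, MeasurableSet B → Measurable fun ω => (N ω ∩ B).encard
  law_count : ∀ B : Set S, MeasurableSet B → Λ B ≠ ⊤ →
    P.map (fun ω => (N ω ∩ B).encard)
      = (poissonMeasure (Λ B).toNNReal).map (fun j : ℕ => (j : ℕ∞))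
  indep_count : ∀ (m : ℕ) (B : Fin m → Set S), (∀ i, MeasurableSet (B i)) →
    Pairwise (fun i j => Disjoint (B i) (B j)) →
    iIndepFun (fun i ω => (N ω ∩ B i).encard) P

/-- The intensity `|E|⁻¹ # ⊗ Leb` on `E × [0,∞)`. -/
noncomputable def bridgeIntensity (n : ℕ) : Measure (Edge n × ℝ) :=
  (((Nat.card (Edge n) : ℝ≥0∞)⁻¹) • (Measure.count : Measure (Edge n))).prod
    (volume.restrict (Set.Ici (0 : ℝ)))

/-- The bridges `B_t` of the configuration `M` up to time `t`. -/
def bridges {n : ℕ} (M : Set (Edge n × ℝ)) (t : ℝ) : Set (Edge n × ℝ) :=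
  {b ∈ M | 0 ≤ b.2 ∧ b.2 ≤ t}

/-- There is a bridge of `B_t` between the bars of `v` and `w` at height `y`. -/
def IsBridge {n : ℕ} (M : Set (Edge n × ℝ)) (t : ℝ) (v w : Vertex n) (y : ℝ) : Prop :=
  ∃ b ∈ bridges M t, b.1.1 = s(v, w) ∧ b.2 = y

/-! ### The interchange process -/

/-- From height `p.2` on the bar of `p.1`, the first bridge strictly above, before height `t`,
leads to the point `q`. -/
def IsNextUp {n : ℕ} (M : Set (Edge n × ℝ)) (t : ℝ) (p q : Vertex n × ℝ) : Prop :=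
  IsBridge M t p.1 q.1 q.2 ∧ p.2 < q.2 ∧ ∀ w y, IsBridge M t p.1 w y → p.2 < y → q.2 ≤ y

open Classical in
/-- Follow the bar upwards and cross the next bridge, if there is one before height `t`. -/
noncomputable def upStep {n : ℕ} (M : Set (Edge n × ℝ)) (t : ℝ) (p : Vertex n × ℝ) :
    Vertex n × ℝ :=
  if h : ∃ q, IsNextUp M t p q then h.choose else p

/-- The interchange process `σ_t`: start at `(v,0)` and follow bars and bridges up to height `t`.
At most `|B_t|` bridges are crossed, so iterating `|B_t|` times reaches the end. -/
noncomputable def sigma {n : ℕ} (M : Set (Edge n × ℝ)) (t : ℝ) (v : Vertex n) : Vertex n :=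
  ((upStep M t)^[(bridges M t).ncard] (v, 0)).1

/-- `orb_t^k(v) = {σ_t^ℓ(v) : ℓ = 0,…,k}`. -/
def orb {n : ℕ} (M : Set (Edge n × ℝ)) (t : ℝ) (k : ℕ) (v : Vertex n) : Set (Vertex n) :=
  {w | ∃ l ≤ k, (sigma M t)^[l] v = w}

/-! ### The cyclic random walk -/

/-- The time needed to move at unit speed upwards, periodically with period `t`, from height `z`
until height `y` is next reached. -/
noncomputable def ahead (t z y : ℝ) : ℝ := if z < y then y - z else y - z + t

/-- The first bridge that the cyclic random walk meets when it leaves `p` leads to `q`. -/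
def IsNextCyclic {n : ℕ} (M : Set (Edge n × ℝ)) (t : ℝ) (p q : Vertex n × ℝ) : Prop :=
  IsBridge M t p.1 q.1 q.2 ∧
    ∀ w y, IsBridge M t p.1 w y → ahead t p.2 q.2 ≤ ahead t p.2 y

open Classical in
/-- The point of arrival of the cyclic random walk after its next jump. -/
noncomputable def crwStep {n : ℕ} (M : Set (Edge n × ℝ)) (t : ℝ) (p : Vertex n × ℝ) :
    Vertex n × ℝ :=
  if h : ∃ q, IsNextCyclic M t p q then h.choose else p

open Classical in
/-- The time to the next jump; `∞` if the bar has no bridge. -/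
noncomputable def crwWait {n : ℕ} (M : Set (Edge n × ℝ)) (t : ℝ) (p : Vertex n × ℝ) : ℝ≥0∞ :=
  if ∃ q, IsNextCyclic M t p q then ENNReal.ofReal (ahead t p.2 (crwStep M t p).2) else ⊤

/-- The location just after the `j`-th jump of the walk started at `p`. -/
noncomputable def crwChain {n : ℕ} (M : Set (Edge n × ℝ)) (t : ℝ) (p : Vertex n × ℝ) (j : ℕ) :
    Vertex n × ℝ :=
  (crwStep M t)^[j] p

/-- The time of the `j`-th jump. -/
noncomputable def crwClock {n : ℕ} (M : Set (Edge n × ℝ)) (t : ℝ) (p : Vertex n × ℝ) (j : ℕ) :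
    ℝ≥0∞ :=
  ∑ i ∈ Finset.range j, crwWait M t (crwChain M t p i)

/-- The number of jumps up to and including time `s`. -/
noncomputable def crwJumps {n : ℕ} (M : Set (Edge n × ℝ)) (t : ℝ) (p : Vertex n × ℝ) (s : ℝ≥0) :
    ℕ :=
  sSup {j : ℕ | crwClock M t p j ≤ s}

/-- The cyclic random walk `𝒳_s` started at `p`, a right-continuous path on bars; heights are
taken modulo `t` in `[0,t)`. -/
noncomputable def crw {n : ℕ} (M : Set (Edge n × ℝ)) (t : ℝ) (p : Vertex n × ℝ) (s : ℝ≥0) :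
    Vertex n × ℝ :=
  let j := crwJumps M t p s
  ((crwChain M t p j).1,
    t * Int.fract (((crwChain M t p j).2 + ((s : ℝ) - (crwClock M t p j).toReal)) / t))

/-- The trace `𝒵_s`: the vertices whose bar has been visited up to time `s ∈ [0,∞]`. -/
def trace {n : ℕ} (M : Set (Edge n × ℝ)) (t : ℝ) (p : Vertex n × ℝ) (s : ℝ≥0∞) :
    Set (Vertex n) :=
  {v | ∃ s' : ℝ≥0, (s' : ℝ≥0∞) ≤ s ∧ ∃ z : ℝ, crw M t p s' = (v, z)}

/-- `T_k = inf {s ≥ 0 : |𝒵_s| ≥ k}`, with `inf ∅ = ∞`. -/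
noncomputable def hitTime {n : ℕ} (M : Set (Edge n × ℝ)) (t : ℝ) (p : Vertex n × ℝ) (k : ℕ) :
    ℝ≥0∞ :=
  ⨅ (s : ℝ≥0) (_ : k ≤ (trace M t p s).ncard), (s : ℝ≥0∞)

/-- `Z_k = 𝒵_{T_k}`. -/
noncomputable def Z {n : ℕ} (M : Set (Edge n × ℝ)) (t : ℝ) (p : Vertex n × ℝ) (k : ℕ) :
    Set (Vertex n) :=
  trace M t p (hitTime M t p k)

end Interchange

/-!
The estimates are proved for a discretised model on a finite probability space and carried over to
the Poisson process in the limit of small cells.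

**Discretisation.** The heights `(0, t]` are divided into `m` cells, and a site, that is a pair of
an edge and a cell, is open if the edge has a bridge in the cell. The sites are independently open
with probability `siteProb` (`real_discretise_eq`). Unless two bridges share a cell, or one lies in
the cell of the starting point, a walk on the cells visits the same vertices as the cyclic random
walk, and `m` of its ticks realise `sigma` (`exists_represents_crwChain`, `walk_sigma`). The
exceptional configurations have probability of order `1 / m` (`real_le_bernP_add`).

**Visits to a row.** The sites inspected by the walk form a stopping set, off which the
configuration may be replaced by an independent copy (`bernE_resample`). Suppose that the walk has
just entered a new vertex `v` of a row, having seen fewer than `k ≤ n / 2` vertices. Then at least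
`n / 2` rows and `n / 2` columns are new to it. With probability `escapeProb` its next two bridges
lead to a new row and then to a new column, the bars of `v` and of the vertex in between carrying no
other bridges. From there it follows a walk in a fresh environment, unless this walk meets the past
or the original row before it has seen `k` vertices, which by the symmetries of the graph has
probability at most `freshError`. So the probability of a further entry into the row is bounded away
from one (`bernP_escape_ge`). Iterated over the entries, this gives a geometric tail
(`bernP_lineEvent_row_le`), and for `m → ∞` the bound for the trace of the cyclic random walk
(`real_le_ncard_Z_inter_row`).

**Cycles.** A segment of length `k` of a cycle is visited in `k` periods. Every time the walk sees a
new vertex, the bar of this vertex is otherwise empty with probability `exp (-2 t / n ^ 2)`, and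
then a full period is spent on it. Hence by Hoeffding's inequality more than `K` vertices are seen
with probability at most `exp (-exp (-2 t / n ^ 2) k)` (`bernP_fast_le`); otherwise the bound for
rows and columns applies to the first `K` vertices (`real_exists_le_iota_orb`).

**Windows of heights.** For heights of order `n ^ 2` the segment of length `k` is cut into boundedly
many pieces, for which `K ≤ k`, so that the assumption on `k` bounds the base of the geometric tail
away from one (`exists_bound_log_sq_le_iota_orb`). The window is covered by a grid with
`exp (κ / 2 * log n ^ 2)` cells. If a cell contains at most one bridge, then `sigma` agrees at each
of its heights with `sigma` at one of its two ends, and a union bound over the grid suffices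
(`real_exists_mem_window_le`, `exists_window_bound`).
-/

namespace Interchange

/-! ### Bernoulli configurations and resampling -/

section BernoulliField

variable {B : Type*}

open Classical in
/-- The configuration that equals `ω` on `S` and `ω'` off `S`. -/
noncomputable def splice (S : Set B) (ω ω' : B → Bool) : B → Bool :=
  fun b => if b ∈ S then ω b else ω' b

lemma splice_of_mem {S : Set B} {ω ω' : B → Bool} {b : B} (h : b ∈ S) :
    splice S ω ω' b = ω b := by simp [splice, h]

lemma splice_of_notMem {S : Set B} {ω ω' : B → Bool} {b : B} (h : b ∉ S) :
    splice S ω ω' b = ω' b := by simp [splice, h]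

section Weight

variable [Fintype B]

/-- The weight of a configuration `ω ∈ {0,1}^B` when the sites are independently open with
probability `p`. -/
noncomputable def bernWeight (p : ℝ) (ω : B → Bool) : ℝ := ∏ b, if ω b then p else 1 - p

lemma bernWeight_nonneg {p : ℝ} (h0 : 0 ≤ p) (h1 : p ≤ 1) (ω : B → Bool) :
    0 ≤ bernWeight p ω := by
  refine Finset.prod_nonneg fun b _ => ?_
  split_ifs <;> linarith

/-- Exchanging two configurations off a set `S` preserves the product of their weights. -/
lemma bernWeight_splice_mul (p : ℝ) (S : Set B) (ω ω' : B → Bool) :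
    bernWeight p (splice S ω ω') * bernWeight p (splice S ω' ω)
      = bernWeight p ω * bernWeight p ω' := by
  unfold bernWeight
  rw [← Finset.prod_mul_distrib, ← Finset.prod_mul_distrib]
  refine Finset.prod_congr rfl fun b _ => ?_
  by_cases h : b ∈ S
  · simp only [splice_of_mem h]
  · simp only [splice_of_notMem h]
    ring

end Weight

variable [Fintype B] [DecidableEq B]

/-- Expectation with respect to the product Bernoulli measure on `{0,1}^B`. -/
noncomputable def bernE (p : ℝ) (f : (B → Bool) → ℝ) : ℝ := ∑ ω, bernWeight p ω * f ω

/-- Probability with respect to the product Bernoulli measure on `{0,1}^B`. -/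
noncomputable def bernP (p : ℝ) (A : Set (B → Bool)) : ℝ := bernE p (A.indicator 1)

lemma sum_bernWeight (p : ℝ) : ∑ ω : B → Bool, bernWeight p ω = 1 := by
  unfold bernWeight
  have := Finset.prod_univ_sum (fun _ : B => (Finset.univ : Finset Bool))
    (fun _ c => if c then p else 1 - p)
  rw [Fintype.piFinset_univ] at this
  rw [← this]
  simp

lemma bernE_mono {p : ℝ} (h0 : 0 ≤ p) (h1 : p ≤ 1) {f g : (B → Bool) → ℝ}
    (h : ∀ ω, f ω ≤ g ω) : bernE p f ≤ bernE p g :=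
  Finset.sum_le_sum fun ω _ => mul_le_mul_of_nonneg_left (h ω) (bernWeight_nonneg h0 h1 ω)

lemma bernE_const (p c : ℝ) : bernE (B := B) p (fun _ => c) = c := by
  rw [bernE, ← Finset.sum_mul, sum_bernWeight, one_mul]

lemma bernE_add (p : ℝ) (f g : (B → Bool) → ℝ) :
    bernE p (fun ω => f ω + g ω) = bernE p f + bernE p g := by
  simp [bernE, mul_add, Finset.sum_add_distrib]

lemma bernE_sub (p : ℝ) (f g : (B → Bool) → ℝ) :
    bernE p (fun ω => f ω - g ω) = bernE p f - bernE p g := by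
  simp [bernE, mul_sub, Finset.sum_sub_distrib]

lemma bernE_mul_const (p c : ℝ) (f : (B → Bool) → ℝ) :
    bernE p (fun ω => f ω * c) = bernE p f * c := by
  simp [bernE, ← mul_assoc, Finset.sum_mul]

lemma bernE_sum {ι : Type*} (p : ℝ) (s : Finset ι) (f : ι → (B → Bool) → ℝ) :
    bernE p (fun ω => ∑ i ∈ s, f i ω) = ∑ i ∈ s, bernE p (f i) := by
  simp only [bernE, Finset.mul_sum]
  exact Finset.sum_comm

lemma bernP_nonneg {p : ℝ} (h0 : 0 ≤ p) (h1 : p ≤ 1) (A : Set (B → Bool)) : 0 ≤ bernP p A :=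
  Finset.sum_nonneg fun ω _ => mul_nonneg (bernWeight_nonneg h0 h1 ω)
    (Set.indicator_nonneg (by simp) ω)

lemma bernP_mono {p : ℝ} (h0 : 0 ≤ p) (h1 : p ≤ 1) {A A' : Set (B → Bool)} (h : A ⊆ A') :
    bernP p A ≤ bernP p A' :=
  bernE_mono h0 h1 fun ω => Set.indicator_le_indicator_of_subset h (by simp) ω

lemma bernP_univ (p : ℝ) : bernP p (Set.univ : Set (B → Bool)) = 1 := by
  simpa [bernP, Pi.one_def] using bernE_const (B := B) p 1

lemma bernP_le_one {p : ℝ} (h0 : 0 ≤ p) (h1 : p ≤ 1) (A : Set (B → Bool)) : bernP p A ≤ 1 := by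
  rw [← bernP_univ (B := B) p]
  exact bernP_mono h0 h1 (Set.subset_univ A)

lemma bernP_union_le {p : ℝ} (h0 : 0 ≤ p) (h1 : p ≤ 1) (A A' : Set (B → Bool)) :
    bernP p (A ∪ A') ≤ bernP p A + bernP p A' := by
  unfold bernP
  rw [← bernE_add]
  refine bernE_mono h0 h1 fun ω => ?_
  by_cases h : ω ∈ A <;> by_cases h' : ω ∈ A' <;> simp [h, h']

lemma bernP_biUnion_le {ι : Type*} {p : ℝ} (h0 : 0 ≤ p) (h1 : p ≤ 1) (s : Finset ι)
    (A : ι → Set (B → Bool)) : bernP p (⋃ i ∈ s, A i) ≤ ∑ i ∈ s, bernP p (A i) := by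
  classical
  induction s using Finset.induction_on with
  | empty => simp [bernP, bernE]
  | insert a s ha ih =>
    rw [Finset.set_biUnion_insert, Finset.sum_insert ha]
    exact (bernP_union_le h0 h1 _ _).trans (by gcongr)

lemma bernP_compl (p : ℝ) (A : Set (B → Bool)) :
    bernP p Aᶜ = 1 - bernP p A := by
  have h := bernE_const (B := B) p 1
  unfold bernP
  rw [← h, ← bernE_sub]
  congr 1
  ext ω
  by_cases hω : ω ∈ A <;> simp [hω]

/-- The Markov property at a stopping set. If the event `A` and the random set `S` of sites are
determined by the restriction of the configuration to `S`, then on `A` the configuration off `S`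
may be replaced by an independent copy. -/
lemma bernE_resample {p : ℝ} (h0 : 0 ≤ p) (h1 : p ≤ 1) (A : Set (B → Bool))
    (S : (B → Bool) → Set B)
    (hS : ∀ ω ∈ A, ∀ ω', (∀ b ∈ S ω, ω' b = ω b) → ω' ∈ A ∧ S ω' = S ω)
    (f g : (B → Bool) → ℝ)
    (h : ∀ ω ∈ A, bernE p (fun ω' => g (splice (S ω) ω ω')) ≤ f ω) :
    bernE p (A.indicator g) ≤ bernE p (A.indicator f) := by
  classical
  set Φ : (B → Bool) × (B → Bool) → (B → Bool) × (B → Bool) := fun q =>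
    if q.1 ∈ A then (splice (S q.1) q.1 q.2, splice (S q.1) q.2 q.1) else q with hΦ
  have hst : ∀ ω ∈ A, ∀ ω', splice (S ω) ω ω' ∈ A ∧ S (splice (S ω) ω ω') = S ω := fun ω hω ω' =>
    hS ω hω _ fun b hb => splice_of_mem hb
  have hinv : Function.Involutive Φ := by
    rintro ⟨ω, ω'⟩
    by_cases hω : ω ∈ A
    · have h1 : Φ (ω, ω') = (splice (S ω) ω ω', splice (S ω) ω' ω) := by simp [hΦ, hω]
      rw [h1]
      simp only [hΦ, (hst ω hω ω').1, if_true, (hst ω hω ω').2]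
      ext b <;> by_cases hb : b ∈ S ω <;> simp [splice, hb]
    · simp [hΦ, hω]
  have hw : ∀ q, bernWeight p (Φ q).1 * bernWeight p (Φ q).2
      = bernWeight p q.1 * bernWeight p q.2 := by
    rintro ⟨ω, ω'⟩
    by_cases hω : ω ∈ A
    · simp only [hΦ, hω, if_true]
      exact bernWeight_splice_mul p (S ω) ω ω'
    · simp [hΦ, hω]
  have key : bernE p (A.indicator g)
      = ∑ q : (B → Bool) × (B → Bool),
          bernWeight p q.1 * bernWeight p q.2 * A.indicator g (Φ q).1 := by
    have : bernE p (A.indicator g) = ∑ q : (B → Bool) × (B → Bool),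
        bernWeight p q.1 * bernWeight p q.2 * A.indicator g q.1 := by
      rw [Fintype.sum_prod_type, bernE]
      refine Finset.sum_congr rfl fun ω _ => ?_
      have : ∀ ω' : B → Bool, bernWeight p ω * bernWeight p ω' * A.indicator g ω
          = bernWeight p ω * A.indicator g ω * bernWeight p ω' := fun ω' => by ring
      simp only [this]
      rw [← Finset.mul_sum, sum_bernWeight, mul_one]
    rw [this, ← Equiv.sum_comp (Function.Involutive.toPerm Φ hinv)]
    refine Finset.sum_congr rfl fun q _ => ?_
    simp only [Function.Involutive.coe_toPerm]
    rw [hw]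
  rw [key, Fintype.sum_prod_type, bernE]
  refine Finset.sum_le_sum fun ω _ => ?_
  by_cases hω : ω ∈ A
  · have e1 : ∀ ω', A.indicator g (Φ (ω, ω')).1 = g (splice (S ω) ω ω') := fun ω' => by
      simp only [hΦ, hω, if_true]
      exact Set.indicator_of_mem (hst ω hω ω').1 g
    simp only [e1, Set.indicator_of_mem hω, mul_assoc]
    rw [← Finset.mul_sum]
    exact mul_le_mul_of_nonneg_left (h ω hω) (bernWeight_nonneg h0 h1 ω)
  · have e1 : ∀ ω', A.indicator g (Φ (ω, ω')).1 = 0 := fun ω' => by simp [hΦ, hω]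
    simp [e1, hω]

/-- The probability of a cylinder. -/
lemma bernP_cylinder (p : ℝ) (U : Finset B) (η : B → Bool) :
    bernP p {ω | ∀ b ∈ U, ω b = η b} = ∏ b ∈ U, if η b then p else 1 - p := by
  classical
  set F : B → Finset Bool := fun b => if b ∈ U then {η b} else Finset.univ with hF
  have h1 := Finset.prod_univ_sum F (fun _ c => if c then p else 1 - p)
  have h2 : bernP p {ω | ∀ b ∈ U, ω b = η b}
      = ∑ ω ∈ Fintype.piFinset F, bernWeight p ω := by
    rw [bernP, bernE, ← Finset.sum_subset (Finset.subset_univ (Fintype.piFinset F))]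
    · refine Finset.sum_congr rfl fun ω hω => ?_
      rw [Set.indicator_of_mem, Pi.one_apply, mul_one]
      intro b hb
      have := Fintype.mem_piFinset.1 hω b
      simpa [hF, hb] using this
    · intro ω _ hω
      rw [Set.indicator_of_notMem, mul_zero]
      intro h
      refine hω (Fintype.mem_piFinset.2 fun b => ?_)
      by_cases hb : b ∈ U
      · simp [hF, hb, h b hb]
      · simp [hF, hb]
  rw [h2]
  unfold bernWeight
  rw [← h1, ← Finset.prod_subset (Finset.subset_univ U)]
  · refine Finset.prod_congr rfl fun b hb => ?_
    simp [hF, hb]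
  · intro b _ hb
    simp [hF, hb]

/-- Permuting the sites preserves the product Bernoulli measure. -/
lemma bernE_comp_equiv (p : ℝ) (e : B ≃ B) (f : (B → Bool) → ℝ) :
    bernE p (fun ω => f (ω ∘ e)) = bernE p f := by
  unfold bernE
  rw [← Equiv.sum_comp (Equiv.arrowCongr e.symm (Equiv.refl Bool))
    (fun ω => bernWeight p ω * f ω)]
  refine Finset.sum_congr rfl fun ω _ => ?_
  have h1 : (Equiv.arrowCongr e.symm (Equiv.refl Bool)) ω = ω ∘ e := by
    ext b; simp [Equiv.arrowCongr]
  rw [h1]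
  congr 1
  unfold bernWeight
  exact (Equiv.prod_comp e (fun b => if ω b then p else 1 - p)).symm

lemma bernP_preimage_equiv (p : ℝ) (e : B ≃ B) (A : Set (B → Bool)) :
    bernP p {ω | ω ∘ e ∈ A} = bernP p A := by
  rw [bernP, bernP, ← bernE_comp_equiv p e (A.indicator 1)]
  rfl

lemma bernP_site (p : ℝ) (b : B) : bernP p {ω | ω b = true} = p := by
  simpa using bernP_cylinder p {b} (fun _ => true)

/-- On a cylinder with finite base `U`, the configuration off `U` may be resampled. -/
lemma bernE_cylinder_ge {p : ℝ} (h0 : 0 ≤ p) (h1 : p ≤ 1) (U : Finset B) (η : B → Bool)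
    (g : (B → Bool) → ℝ) (u : ℝ)
    (h : ∀ ω, (∀ b ∈ U, ω b = η b) → u ≤ bernE p (fun ω' => g (splice U ω ω'))) :
    bernP p {ω | ∀ b ∈ U, ω b = η b} * u
      ≤ bernE p (Set.indicator {ω | ∀ b ∈ U, ω b = η b} g) := by
  have := bernE_resample h0 h1 {ω | ∀ b ∈ U, ω b = η b} (fun _ => (U : Set B))
    (fun ω hω ω' h' => ⟨fun b hb => (h' b hb).trans (hω b hb), rfl⟩)
    (fun _ => -u) (fun ω => -g ω) (fun ω hω => by
      have := h ω hω
      have e : bernE p (fun ω' => -g (splice U ω ω')) = -bernE p (fun ω' => g (splice U ω ω')) := by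
        simp [bernE]
      rw [e]; linarith)
  have e1 : bernE p (Set.indicator {ω | ∀ b ∈ U, ω b = η b} (fun ω => -g ω))
      = -bernE p (Set.indicator {ω | ∀ b ∈ U, ω b = η b} g) := by
    simp only [bernE, ← Finset.sum_neg_distrib]
    refine Finset.sum_congr rfl fun ω _ => ?_
    by_cases hω : ω ∈ {ω | ∀ b ∈ U, ω b = η b}
    · rw [Set.indicator_of_mem hω, Set.indicator_of_mem hω]; ring
    · rw [Set.indicator_of_notMem hω, Set.indicator_of_notMem hω]; ring
  have e2 : bernE p (Set.indicator {ω | ∀ b ∈ U, ω b = η b} (fun _ => -u))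
      = -(bernP p {ω | ∀ b ∈ U, ω b = η b} * u) := by
    rw [bernP, ← bernE_mul_const]
    simp only [bernE, ← Finset.sum_neg_distrib]
    refine Finset.sum_congr rfl fun ω _ => ?_
    by_cases hω : ω ∈ {ω | ∀ b ∈ U, ω b = η b}
    · rw [Set.indicator_of_mem hω, Set.indicator_of_mem hω]; simp
    · rw [Set.indicator_of_notMem hω, Set.indicator_of_notMem hω]; simp
  rw [e1, e2] at this
  linarith

end BernoulliField

/-! ### The walk in a discretised environment -/

section Walk

variable {n m : ℕ}

noncomputable instance instFintypeEdge (n : ℕ) : Fintype (Edge n) := Fintype.ofFinite _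

/-- In the configuration `ω` of the discretised model there is a bridge between the bars of `a`
and `b` in the cell `j`. -/
def Op (ω : Edge n × ZMod m → Bool) (j : ZMod m) (a b : Vertex n) : Prop :=
  ∃ e : Edge n, e.1 = s(a, b) ∧ ω (e, j) = true

/-- One tick of the discretised walk in the cell `j`: it stays at `a` if the bar of `a` has no
bridge in this cell, and it crosses a bridge to `b` if this bridge is the only one in the cell on
the bars of `a` and of `b`. In all other cases the walk has no successor. -/
def StepRel (ω : Edge n × ZMod m → Bool) (j : ZMod m) (a b : Vertex n) : Prop :=
  (a = b ∧ ∀ c, ¬ Op ω j a c) ∨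
    (Op ω j a b ∧ (∀ c, Op ω j a c → c = b) ∧ ∀ c, Op ω j b c → c = a)

open Classical in
/-- The successor of `a` in the cell `j`; `none` if the walk dies there. -/
noncomputable def nextVertex (ω : Edge n × ZMod m → Bool) (j : ZMod m) (a : Vertex n) :
    Option (Vertex n) :=
  if h : ∃ b, StepRel ω j a b then some h.choose else none

/-- The discretised walk started at `v`, whose first tick takes place in the cell `i`. -/
noncomputable def walk (ω : Edge n × ZMod m → Bool) (i : ZMod m) (v : Vertex n) :
    ℕ → Option (Vertex n)
  | 0 => some v
  | s + 1 => (walk ω i v s).bind (nextVertex ω (i + s))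

open Classical in
/-- The vertices visited by the discretised walk strictly before time `s`. -/
noncomputable def visited (ω : Edge n × ZMod m → Bool) (i : ZMod m) (v : Vertex n) (s : ℕ) :
    Finset (Vertex n) :=
  Finset.univ.filter fun a => ∃ r < s, walk ω i v r = some a

/-- The sites of the configuration that the walk has inspected before time `s`. -/
def revealed (ω : Edge n × ZMod m → Bool) (i : ZMod m) (v : Vertex n) (s : ℕ) :
    Set (Edge n × ZMod m) :=
  {b | ∃ r < s, b.2 = i + r ∧
    ∃ a, (walk ω i v r = some a ∨ walk ω i v (r + 1) = some a) ∧ a ∈ b.1.1}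

variable {ω ω' ξ : Edge n × ZMod m → Bool} {i j : ZMod m} {v a b c : Vertex n} {r s : ℕ}

lemma Op.symm (h : Op ω j a b) : Op ω j b a := by
  obtain ⟨e, he, h⟩ := h
  exact ⟨e, by rw [he, Sym2.eq_swap], h⟩

lemma Op.adj (h : Op ω j a b) : (hamming n).Adj a b := by
  obtain ⟨e, he, -⟩ := h
  have := e.2
  rwa [he, SimpleGraph.mem_edgeSet] at this

lemma Op.ne (h : Op ω j a b) : a ≠ b := h.adj.ne

lemma StepRel.unique (h : StepRel ω j a b) (h' : StepRel ω j a c) : b = c := by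
  rcases h with ⟨rfl, h⟩ | ⟨h1, h2, h3⟩
  · rcases h' with ⟨rfl, h'⟩ | ⟨h1', -⟩
    · rfl
    · exact absurd h1' (h _)
  · rcases h' with ⟨rfl, h'⟩ | ⟨h1', -⟩
    · exact absurd h1 (h' _)
    · exact (h2 _ h1').symm

lemma nextVertex_eq_some : nextVertex ω j a = some b ↔ StepRel ω j a b := by
  unfold nextVertex
  split_ifs with h
  · rw [Option.some_inj]
    exact ⟨fun e => e ▸ h.choose_spec, fun e => h.choose_spec.unique e⟩
  · simp only [false_iff]
    exact fun h' => h ⟨b, h'⟩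

lemma walk_succ_eq_some :
    walk ω i v (s + 1) = some b ↔ ∃ a, walk ω i v s = some a ∧ StepRel ω (i + s) a b := by
  simp [walk, Option.bind_eq_some_iff, nextVertex_eq_some]

lemma walk_succ_of_step (h : walk ω i v s = some a) (h' : StepRel ω (i + s) a b) :
    walk ω i v (s + 1) = some b := walk_succ_eq_some.2 ⟨a, h, h'⟩

lemma step_of_walk (h : walk ω i v s = some a) (h' : walk ω i v (s + 1) = some b) :
    StepRel ω (i + s) a b := by
  obtain ⟨a', h1, h2⟩ := walk_succ_eq_some.1 h'
  rw [h, Option.some_inj] at h1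
  rwa [h1]

lemma exists_walk_of_le (h : walk ω i v s = some a) (hr : r ≤ s) :
    ∃ b, walk ω i v r = some b := by
  induction s generalizing a with
  | zero => exact ⟨a, by rwa [Nat.le_zero.1 hr]⟩
  | succ s ih =>
    rcases Nat.le_succ_iff.1 hr with h' | rfl
    · obtain ⟨a', h1, -⟩ := walk_succ_eq_some.1 h
      exact ih h1 h'
    · exact ⟨a, h⟩

lemma walk_add (h : walk ω i v s = some a) : walk ω i v (s + r) = walk ω (i + s) a r := by
  induction r with
  | zero => exact h
  | succ r ih =>
    rw [← add_assoc, walk, walk, ih]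
    congr 2
    push_cast
    ring

lemma mem_visited : a ∈ visited ω i v s ↔ ∃ r < s, walk ω i v r = some a := by
  simp [visited]

lemma visited_mono (h : r ≤ s) : visited ω i v r ⊆ visited ω i v s := fun a ha => by
  obtain ⟨r', h1, h2⟩ := mem_visited.1 ha
  exact mem_visited.2 ⟨r', h1.trans_le h, h2⟩

lemma visited_zero : visited ω i v 0 = ∅ := by
  ext a; simp [mem_visited]

lemma visited_succ (h : walk ω i v s = some a) :
    visited ω i v (s + 1) = insert a (visited ω i v s) := by
  ext b
  simp only [mem_visited, Finset.mem_insert, Nat.lt_succ_iff_lt_or_eq]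
  constructor
  · rintro ⟨r, hr | rfl, h'⟩
    · exact Or.inr ⟨r, hr, h'⟩
    · left
      rw [h, Option.some_inj] at h'
      exact h'.symm
  · rintro (rfl | ⟨r, hr, h'⟩)
    · exact ⟨s, Or.inr rfl, h⟩
    · exact ⟨r, Or.inl hr, h'⟩

lemma visited_succ_of_none (h : walk ω i v s = none) :
    visited ω i v (s + 1) = visited ω i v s := by
  ext b
  simp only [mem_visited, Nat.lt_succ_iff_lt_or_eq]
  constructor
  · rintro ⟨r, hr | rfl, h'⟩
    · exact ⟨r, hr, h'⟩
    · simp [h] at h'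
  · rintro ⟨r, hr, h'⟩
    exact ⟨r, Or.inl hr, h'⟩

lemma op_congr_of_sites (h : ∀ e : Edge n, a ∈ e.1 → ω' (e, j) = ω (e, j)) :
    Op ω' j a c ↔ Op ω j a c := by
  constructor <;> rintro ⟨e, he, ho⟩
  · exact ⟨e, he, by rw [← h e (by simp [he])]; exact ho⟩
  · exact ⟨e, he, by rw [h e (by simp [he])]; exact ho⟩

lemma stepRel_congr (ha : ∀ c, Op ω' j a c ↔ Op ω j a c) (hb : ∀ c, Op ω' j b c ↔ Op ω j b c) :
    StepRel ω' j a b ↔ StepRel ω j a b := by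
  simp only [StepRel, ha, hb]

/-- The walk up to time `s` is determined by the sites revealed up to that time. -/
lemma walk_congr (h : ∀ b ∈ revealed ω i v s, ω' b = ω b) (hs : walk ω i v s = some a) :
    ∀ r ≤ s, walk ω' i v r = walk ω i v r := by
  intro r
  induction r with
  | zero => intro _; rfl
  | succ r ih =>
    intro hr
    obtain ⟨c, hc⟩ := exists_walk_of_le hs (Nat.le_of_succ_le hr)
    obtain ⟨d, hd⟩ := exists_walk_of_le hs hr
    have h1 := step_of_walk hc hd
    rw [hd]
    refine walk_succ_of_step ((ih (Nat.le_of_succ_le hr)).trans hc) ?_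
    rwa [stepRel_congr]
    · exact fun x => op_congr_of_sites fun e he =>
        h _ ⟨r, hr, rfl, c, Or.inl hc, he⟩
    · exact fun x => op_congr_of_sites fun e he =>
        h _ ⟨r, hr, rfl, d, Or.inr hd, he⟩

lemma visited_congr (h : ∀ r < s, walk ω' i v r = walk ω i v r) :
    visited ω' i v s = visited ω i v s := by
  ext a
  simp only [mem_visited]
  exact exists_congr fun r => and_congr_right fun hr => by rw [h r hr]

lemma revealed_congr (h : ∀ r ≤ s, walk ω' i v r = walk ω i v r) :
    revealed ω' i v s = revealed ω i v s := by
  ext b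
  simp only [revealed, Set.mem_ofPred_eq]
  refine exists_congr fun r => and_congr_right fun hr => ?_
  rw [h r hr.le, h (r + 1) hr]

/-- An open site that has been revealed by a walk still alive has been crossed by it. -/
lemma crossed_of_revealed (hs : walk ω i v s = some b) {e : Edge n}
    (hb : (e, j) ∈ revealed ω i v s) (ho : ω (e, j) = true) (he : e.1 = s(a, c)) :
    ∃ r < s, j = i + r ∧ ((walk ω i v r = some a ∧ walk ω i v (r + 1) = some c) ∨
      (walk ω i v r = some c ∧ walk ω i v (r + 1) = some a)) := by
  obtain ⟨r, hr, hj, d, hd, hde⟩ := hb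
  obtain ⟨x, hx⟩ := exists_walk_of_le hs hr.le
  obtain ⟨y, hy⟩ := exists_walk_of_le hs hr
  simp only at hj hde
  have hxy := step_of_walk hx hy
  rw [← hj] at hxy
  have key : s(a, c) = s(x, y) := by
    have hd' : d = x ∨ d = y := by
      rcases hd with h | h
      · rw [hx, Option.some_inj] at h; exact Or.inl h.symm
      · rw [hy, Option.some_inj] at h; exact Or.inr h.symm
    obtain ⟨z, hz⟩ := Sym2.mem_iff_exists.1 hde
    have hop : Op ω j d z := ⟨e, hz, ho⟩
    rw [← he, hz]
    rcases hxy with ⟨rfl, h1⟩ | ⟨h1, h2, h3⟩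
    · rcases hd' with rfl | rfl <;> exact absurd hop (h1 _)
    · rcases hd' with rfl | rfl
      · rw [h2 _ hop]
      · rw [h3 _ hop, Sym2.eq_swap]
  refine ⟨r, hr, hj, ?_⟩
  rcases Sym2.eq_iff.1 key with ⟨rfl, rfl⟩ | ⟨rfl, rfl⟩
  · exact Or.inl ⟨hx, hy⟩
  · exact Or.inr ⟨hx, hy⟩

/-- If the unrevealed sites are replaced by those of `ξ`, a vertex `a` that has not been visited
has no open sites but those of `ξ`, except where the walk has just entered it. -/
lemma op_of_op_splice (hs : walk ω i v s = some b) (ha : a ∉ visited ω i v s)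
    (hab : a = b → j + 1 ≠ i + s)
    (h : Op (splice (revealed ω i v s) ω ξ) j a c) : Op ξ j a c := by
  obtain ⟨e, he, ho⟩ := h
  refine ⟨e, he, ?_⟩
  by_cases hr : (e, j) ∈ revealed ω i v s
  · rw [splice_of_mem hr] at ho
    obtain ⟨r, hr, hj, ⟨h1, -⟩ | ⟨-, h1⟩⟩ := crossed_of_revealed hs hr ho he
    · exact absurd (mem_visited.2 ⟨r, hr, h1⟩) ha
    · rcases Nat.lt_or_eq_of_le (Nat.succ_le_of_lt hr) with h2 | h2
      · exact absurd (mem_visited.2 ⟨r + 1, h2, h1⟩) ha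
      · rw [Nat.succ_eq_add_one] at h2
        subst h2
        rw [hs, Option.some_inj] at h1
        exact absurd (by rw [hj]; push_cast; ring) (hab h1.symm)
  · rwa [splice_of_notMem hr] at ho

/-- A bridge of `ξ` between two vertices that have not been visited is kept. -/
lemma op_splice_of_op (hs : walk ω i v s = some b) (ha : a ∉ visited ω i v s)
    (hc : c ∉ visited ω i v s) (hab : a = b ∨ c = b → j + 1 ≠ i + s)
    (h : Op ξ j a c) : Op (splice (revealed ω i v s) ω ξ) j a c := by
  obtain ⟨e, he, ho⟩ := h
  refine ⟨e, he, ?_⟩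
  rw [splice_of_notMem, ho]
  rintro ⟨r, hr, hj, d, hd, hde⟩
  simp only [he, Sym2.mem_iff] at hj hde
  have hdv : d ∉ visited ω i v s := by rcases hde with rfl | rfl <;> assumption
  rcases hd with hd | hd
  · exact hdv (mem_visited.2 ⟨r, hr, hd⟩)
  · rcases Nat.lt_or_eq_of_le (Nat.succ_le_of_lt hr) with h2 | h2
    · exact hdv (mem_visited.2 ⟨r + 1, h2, hd⟩)
    · rw [Nat.succ_eq_add_one] at h2
      subst h2
      rw [hs, Option.some_inj] at hd
      subst hd
      refine hab (by tauto) ?_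
      rw [hj]; push_cast; ring

lemma walk_wait (hs : walk ω i v s = some a) {D : ℕ}
    (h : ∀ d < D, ∀ c, ¬ Op ω (i + s + d) a c) : ∀ d ≤ D, walk ω i v (s + d) = some a := by
  intro d
  induction d with
  | zero => intro _; exact hs
  | succ d ih =>
    intro hd
    refine walk_succ_of_step (ih (Nat.le_of_succ_le hd)) (Or.inl ⟨rfl, fun c => ?_⟩)
    have := h d hd c
    rwa [add_assoc, ← Nat.cast_add] at this

lemma ne_of_lt_val [NeZero m] {j : ZMod m} {d : ℕ} (h : d < j.val) : (d : ZMod m) ≠ j := by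
  rintro rfl
  rw [ZMod.val_natCast] at h
  exact absurd (Nat.mod_le d m) (not_le.2 h)

/-- The walk waits at `a` for the cell `j`, where it crosses to `b`, if `a` has no other open
sites, except possibly in the cell where it has just been entered. -/
lemma walk_hop [NeZero m] (hs : walk ω i v s = some a) (hj : j + 1 ≠ i + s)
    (ha : ∀ l c, l + 1 ≠ i + s → Op ω l a c → c = b ∧ l = j)
    (hab : Op ω j a b) (hb : ∀ c, Op ω j b c → c = a) :
    ∃ s' > s, i + s' = j + 1 ∧ walk ω i v s' = some b ∧
      ∀ r, s ≤ r → r < s' → walk ω i v r = some a := by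
  set D := (j - (i + s)).val with hD
  have hDm : D < m := ZMod.val_lt _
  have hDc : (D : ZMod m) = j - (i + s) := by simp [hD]
  have hcell : ∀ d ≤ D, i + s + d + 1 ≠ i + s := by
    intro d hd h
    rcases Nat.lt_or_eq_of_le hd with h' | rfl
    · have h2 : ((d + 1 : ℕ) : ZMod m) = 0 := by
        have : i + s + ((d + 1 : ℕ) : ZMod m) = i + s + 0 := by
          rw [add_zero]
          refine Eq.trans ?_ h
          push_cast; ring
        exact add_left_cancel this
      rw [ZMod.natCast_eq_zero_iff] at h2
      exact absurd (Nat.le_of_dvd (Nat.succ_pos d) h2) (by omega)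
    · apply hj
      rw [← h, hDc]; ring
  have hw := walk_wait hs (D := D) fun d hd c hop => by
    have h1 := (ha _ c (hcell d hd.le) hop).2
    refine ne_of_lt_val hd ?_
    rw [← h1]; ring
  have hcast : i + ((s + D : ℕ) : ZMod m) = j := by
    push_cast; rw [hDc]; ring
  refine ⟨s + D + 1, by omega, ?_, ?_, ?_⟩
  · rw [Nat.cast_succ, ← add_assoc, hcast]
  · refine walk_succ_of_step (hw D le_rfl) ?_
    rw [hcast]
    exact Or.inr ⟨hab, fun c hc => (ha j c hj hc).1, hb⟩
  · intro r h1 h2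
    have := hw (r - s) (by omega)
    rwa [Nat.add_sub_cancel' h1] at this

lemma visited_stationary (h : walk ω i v s = none) {r : ℕ} (hr : s ≤ r) :
    visited ω i v r = visited ω i v s := by
  induction r, hr using Nat.le_induction with
  | base => rfl
  | succ r hr ih =>
    rw [visited_succ_of_none, ih]
    cases h' : walk ω i v r with
    | none => rfl
    | some a =>
      obtain ⟨b, hb⟩ := exists_walk_of_le h' hr
      simp [h] at hb

/-- A walk that is back at its starting point in the initial cell has visited all the vertices
it will ever visit. -/
lemma visited_subset_of_return (hs : walk ω i v s = some v) (hi : i + s = i) (hpos : 0 < s)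
    (r : ℕ) : visited ω i v r ⊆ visited ω i v s := by
  have key : ∀ r a, walk ω i v r = some a → a ∈ visited ω i v s := by
    intro r
    induction r using Nat.strong_induction_on with
    | _ r ih =>
      intro a ha
      by_cases hrs : r < s
      · exact mem_visited.2 ⟨r, hrs, ha⟩
      · refine ih (r - s) (by omega) a ?_
        rw [← ha]
        conv_rhs => rw [← Nat.add_sub_cancel' (not_lt.1 hrs), walk_add hs, hi]
  intro a ha
  obtain ⟨r', -, h⟩ := mem_visited.1 ha
  exact key r' a h

/-- Comparison with a fresh environment `ξ`: as long as the fresh walk started at `x` avoids the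
vertices of `F` and has seen fewer than `k` vertices, it coincides with the walk in an environment
`ω'` which differs from `ξ` only on the edges at `F` and at the point of departure. -/
lemma walk_eq_fresh {x : Vertex n} {l : ZMod m} {F : Finset (Vertex n)} {k : ℕ}
    (hs : walk ω' i v s = some x) (hl : i + s = l + 1)
    (hk : ∃ R, k ≤ (visited ξ (l + 1) x R).card)
    (hF : ∀ r a, walk ξ (l + 1) x r = some a → (visited ξ (l + 1) x r).card < k → a ∉ F)
    (hx : ∀ c, ¬ Op ξ l x c)
    (h1 : ∀ j a c, a ∉ F → (a = x → j ≠ l) → Op ω' j a c → Op ξ j a c)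
    (h2 : ∀ j a c, a ∉ F → c ∉ F → Op ξ j a c → Op ω' j a c) :
    ∀ r, (visited ξ (l + 1) x r).card < k → walk ω' i v (s + r) = walk ξ (l + 1) x r := by
  obtain ⟨R, hR⟩ := hk
  intro r
  induction r with
  | zero => intro _; exact hs
  | succ r ih =>
    intro hr
    have hr' : (visited ξ (l + 1) x r).card < k :=
      (Finset.card_le_card (visited_mono (Nat.le_succ r))).trans_lt hr
    have halive : ∀ q, (visited ξ (l + 1) x q).card < k → ∃ a, walk ξ (l + 1) x q = some a := by
      intro q hq
      by_contra hne
      have hnone : walk ξ (l + 1) x q = none := by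
        cases h : walk ξ (l + 1) x q with
        | none => rfl
        | some a => exact absurd ⟨a, h⟩ hne
      rcases le_total q R with h | h
      · rw [visited_stationary hnone h] at hR; omega
      · have := Finset.card_le_card (visited_mono (ω := ξ) (i := l + 1) (v := x) h); omega
    obtain ⟨y, hy⟩ := halive r hr'
    obtain ⟨y', hy'⟩ := halive (r + 1) hr
    have hyF := hF r y hy hr'
    have hyF' := hF (r + 1) y' hy' hr
    have hst := step_of_walk hy hy'
    -- the fresh walk does not close up before it has seen `k` vertices
    have hyx : y = x → l + 1 + (r : ZMod m) ≠ l := by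
      rintro rfl hcell
      rw [hcell] at hst
      have hyy : y' = y := by
        rcases hst with ⟨rfl, -⟩ | ⟨h, -⟩
        · rfl
        · exact absurd h (hx _)
      subst hyy
      have := visited_subset_of_return hy' (by push_cast; rw [← add_assoc, hcell])
        (Nat.succ_pos r) R
      have := Finset.card_le_card this
      omega
    have hyx' : y' = x → l + 1 + (r : ZMod m) ≠ l := by
      rintro rfl hcell
      rw [hcell] at hst
      rcases hst with ⟨h, -⟩ | ⟨h, -⟩
      · exact hyx h hcell
      · exact hx _ h.symm
    rw [hy', ← add_assoc]
    refine walk_succ_of_step ((ih hr').trans hy) ?_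
    have hc : i + ((s + r : ℕ) : ZMod m) = l + 1 + r := by
      push_cast; rw [← add_assoc, hl]
    rw [hc]
    rcases hst with ⟨rfl, h⟩ | ⟨ho, h3, h4⟩
    · exact Or.inl ⟨rfl, fun c hc => h c (h1 _ _ _ hyF hyx hc)⟩
    · exact Or.inr ⟨h2 _ _ _ hyF hyF' ho, fun c hc => h3 c (h1 _ _ _ hyF hyx hc),
        fun c hc => h4 c (h1 _ _ _ hyF' hyx' hc)⟩

end Walk

/-! ### Visits to lines and the symmetries of the Hamming graph -/

section Events

variable {n m : ℕ}

/-- The walk visits at least `k` vertices. -/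
def HitEvent (i : ZMod m) (v : Vertex n) (k : ℕ) : Set (Edge n × ZMod m → Bool) :=
  {ω | ∃ s, k ≤ (visited ω i v s).card}

/-- The walk visits at least `j` vertices of `L` up to the moment when it has seen `k` vertices
in total. -/
def LineEvent (L : Finset (Vertex n)) (i : ZMod m) (v : Vertex n) (k j : ℕ) :
    Set (Edge n × ZMod m → Bool) :=
  {ω | ∃ s, j ≤ (visited ω i v (s + 1) ∩ L).card ∧ (visited ω i v s).card < k}

/-- The row `L_b` as a finite set. -/
def rowFinset (b : Fin n) : Finset (Vertex n) := Finset.univ.filter fun a => a.2 = b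

/-- The column `D_b` as a finite set. -/
def colFinset (b : Fin n) : Finset (Vertex n) := Finset.univ.filter fun a => a.1 = b

open Classical in
/-- The vertices visited up to the moment when the walk has seen `k` vertices. -/
noncomputable def earlySet (ω : Edge n × ZMod m → Bool) (i : ZMod m) (v : Vertex n) (k : ℕ) :
    Finset (Vertex n) :=
  Finset.univ.filter fun a => ∃ s, walk ω i v s = some a ∧ (visited ω i v s).card < k

lemma mem_earlySet {ω : Edge n × ZMod m → Bool} {i : ZMod m} {v a : Vertex n} {k : ℕ} :
    a ∈ earlySet ω i v k ↔ ∃ s, walk ω i v s = some a ∧ (visited ω i v s).card < k := by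
  simp [earlySet]

/-- The number of vertices seen before the first visit of `a` is less than `k` and
determines `a`. -/
lemma card_earlySet_le (ω : Edge n × ZMod m → Bool) (i : ZMod m) (v : Vertex n) (k : ℕ) :
    (earlySet ω i v k).card ≤ k := by
  classical
  have hex : ∀ a, a ∈ earlySet ω i v k → ∃ s, walk ω i v s = some a := fun a ha => by
    obtain ⟨s, h, -⟩ := mem_earlySet.1 ha
    exact ⟨s, h⟩
  set first : Vertex n → ℕ := fun a =>
    if h : ∃ s, walk ω i v s = some a then Nat.find h else 0 with hfirst
  have hf : ∀ a ∈ earlySet ω i v k, walk ω i v (first a) = some a ∧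
      ∀ r < first a, walk ω i v r ≠ some a := fun a ha => by
    simp only [hfirst, dif_pos (hex a ha)]
    exact ⟨Nat.find_spec (hex a ha), fun r hr => Nat.find_min (hex a ha) hr⟩
  have hlt : ∀ a ∈ earlySet ω i v k, ∀ b ∈ earlySet ω i v k, first a < first b →
      (visited ω i v (first a)).card < (visited ω i v (first b)).card := by
    intro a ha b hb h
    refine Finset.card_lt_card (Finset.ssubset_iff_of_subset (visited_mono h.le) |>.2
      ⟨a, mem_visited.2 ⟨_, h, (hf a ha).1⟩, fun h' => ?_⟩)
    obtain ⟨r, hr, h1⟩ := mem_visited.1 h'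
    exact (hf a ha).2 r hr h1
  have := Finset.card_le_card_of_injOn (s := earlySet ω i v k) (t := Finset.range k)
    (fun a => (visited ω i v (first a)).card) (fun a ha => by
      obtain ⟨s, h, hk⟩ := mem_earlySet.1 ha
      have : first a ≤ s := by
        by_contra hlt'
        exact (hf a ha).2 s (not_le.1 hlt') h
      simp only [Finset.coe_range, Set.mem_Iio]
      exact (Finset.card_le_card (visited_mono this)).trans_lt hk) (by
      intro a ha b hb hab
      rcases lt_trichotomy (first a) (first b) with h | h | h
      · exact absurd hab (hlt a ha b hb h).ne
      · have h1 := (hf a ha).1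
        rw [h, (hf b hb).1, Option.some_inj] at h1
        exact h1.symm
      · exact absurd hab.symm (hlt b hb a ha h).ne)
  simpa using this

section Symmetry

variable (g : hamming n ≃g hamming n) (c : ZMod m)

/-- The permutation of the sites induced by a graph automorphism and a rotation of the heights. -/
def siteEquiv : (Edge n × ZMod m) ≃ (Edge n × ZMod m) :=
  Equiv.prodCongr g.mapEdgeSet (Equiv.addRight c)

lemma op_comp_siteEquiv {ω : Edge n × ZMod m → Bool} {j : ZMod m} {a b : Vertex n} :
    Op (ω ∘ siteEquiv g c) j a b ↔ Op ω (j + c) (g a) (g b) := by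
  constructor
  · rintro ⟨e, he, ho⟩
    refine ⟨g.mapEdgeSet e, ?_, ho⟩
    change Sym2.map g e.1 = _
    rw [he, Sym2.map_mk]
  · rintro ⟨e, he, ho⟩
    refine ⟨g.mapEdgeSet.symm e, ?_, ?_⟩
    · change Sym2.map g.symm e.1 = _
      rw [he, Sym2.map_mk]
      simp
    · have : siteEquiv g c (g.mapEdgeSet.symm e, j) = (e, j + c) :=
        Prod.ext (g.mapEdgeSet.apply_symm_apply e) rfl
      rw [Function.comp_apply, this, ho]

lemma stepRel_comp_siteEquiv {ω : Edge n × ZMod m → Bool} {j : ZMod m} {a b : Vertex n} :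
    StepRel (ω ∘ siteEquiv g c) j a b ↔ StepRel ω (j + c) (g a) (g b) := by
  have hs : ∀ P : Vertex n → Prop, (∀ x, P (g x)) ↔ ∀ x, P x := fun P =>
    ⟨fun h x => by simpa using h (g.symm x), fun h x => h _⟩
  simp only [StepRel, op_comp_siteEquiv]
  rw [← hs (fun x => ¬ Op ω (j + c) (g a) x), ← hs (fun x => Op ω (j + c) (g a) x → x = g b),
    ← hs (fun x => Op ω (j + c) (g b) x → x = g a)]
  simp only [EmbeddingLike.apply_eq_iff_eq]

lemma walk_comp_siteEquiv (ω : Edge n × ZMod m → Bool) (i : ZMod m) (v : Vertex n) (s : ℕ) :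
    (walk (ω ∘ siteEquiv g c) i v s).map g = walk ω (i + c) (g v) s := by
  have key : ∀ a, walk (ω ∘ siteEquiv g c) i v s = some a ↔
      walk ω (i + c) (g v) s = some (g a) := by
    induction s with
    | zero => intro a; simp [walk]
    | succ s ih =>
      intro a
      rw [walk_succ_eq_some, walk_succ_eq_some]
      constructor
      · rintro ⟨b, hb, h⟩
        refine ⟨g b, (ih b).1 hb, ?_⟩
        rw [stepRel_comp_siteEquiv] at h
        rwa [add_right_comm]
      · rintro ⟨b, hb, h⟩
        refine ⟨g.symm b, (ih _).2 (by simpa using hb), ?_⟩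
        rw [stepRel_comp_siteEquiv, add_right_comm]
        simpa using h
  cases h : walk (ω ∘ siteEquiv g c) i v s with
  | some a => rw [Option.map_some, (key a).1 h]
  | none =>
    cases h' : walk ω (i + c) (g v) s with
    | none => rfl
    | some b =>
      have := (key (g.symm b)).2 (by simpa using h')
      simp [h] at this

lemma walk_comp_siteEquiv_eq_some {ω : Edge n × ZMod m → Bool} {i : ZMod m} {v a : Vertex n}
    {s : ℕ} : walk ω (i + c) (g v) s = some (g a) ↔
      walk (ω ∘ siteEquiv g c) i v s = some a := by
  rw [← walk_comp_siteEquiv]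
  simp [Option.map_eq_some_iff]

lemma mem_visited_comp_siteEquiv {ω : Edge n × ZMod m → Bool} {i : ZMod m} {v a : Vertex n}
    {s : ℕ} : g a ∈ visited ω (i + c) (g v) s ↔ a ∈ visited (ω ∘ siteEquiv g c) i v s := by
  simp only [mem_visited, walk_comp_siteEquiv_eq_some]

lemma card_visited_inter_comp_siteEquiv (ω : Edge n × ZMod m → Bool) (i : ZMod m) (v : Vertex n)
    (s : ℕ) {L L' : Finset (Vertex n)} (hL : ∀ a, g a ∈ L' ↔ a ∈ L) :
    (visited (ω ∘ siteEquiv g c) i v s ∩ L).card = (visited ω (i + c) (g v) s ∩ L').card := by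
  refine Finset.card_bij (fun a _ => g a) (fun a ha => ?_) (fun a _ b _ h => g.injective h)
    fun b hb => ⟨g.symm b, ?_, by simp⟩
  · rw [Finset.mem_inter] at ha ⊢
    exact ⟨(mem_visited_comp_siteEquiv g c).2 ha.1, (hL a).2 ha.2⟩
  · rw [Finset.mem_inter] at hb ⊢
    rw [← mem_visited_comp_siteEquiv, ← hL]
    simpa using hb

lemma card_visited_comp_siteEquiv (ω : Edge n × ZMod m → Bool) (i : ZMod m) (v : Vertex n)
    (s : ℕ) :
    (visited (ω ∘ siteEquiv g c) i v s).card = (visited ω (i + c) (g v) s).card := by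
  simpa using card_visited_inter_comp_siteEquiv g c ω i v s (L := Finset.univ)
    (L' := Finset.univ) (by simp)

lemma mem_earlySet_comp_siteEquiv {ω : Edge n × ZMod m → Bool} {i : ZMod m} {v a : Vertex n}
    {k : ℕ} : a ∈ earlySet (ω ∘ siteEquiv g c) i v k ↔ g a ∈ earlySet ω (i + c) (g v) k := by
  simp only [mem_earlySet, walk_comp_siteEquiv_eq_some, card_visited_comp_siteEquiv]

variable [NeZero m]

lemma bernP_hitEvent_map (p : ℝ) (i : ZMod m) (v : Vertex n) (k : ℕ) :
    bernP p (HitEvent (i + c) (g v) k) = bernP p (HitEvent i v k) := by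
  rw [← bernP_preimage_equiv p (siteEquiv g c) (HitEvent i v k)]
  congr 1
  ext ω
  change (∃ s, _) ↔ (∃ s, _)
  simp only [card_visited_comp_siteEquiv]

lemma bernP_lineEvent_map (p : ℝ) (i : ZMod m) (v : Vertex n) (k j : ℕ)
    {L L' : Finset (Vertex n)} (hL : ∀ a, g a ∈ L' ↔ a ∈ L) :
    bernP p (LineEvent L' (i + c) (g v) k j) = bernP p (LineEvent L i v k j) := by
  rw [← bernP_preimage_equiv p (siteEquiv g c) (LineEvent L i v k j)]
  congr 1
  ext ω
  change (∃ s, _) ↔ (∃ s, _)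
  simp only [card_visited_comp_siteEquiv, card_visited_inter_comp_siteEquiv g c _ _ _ _ hL]

lemma bernP_mem_earlySet_map (p : ℝ) (i : ZMod m) {v : Vertex n} (hg : g v = v) (k : ℕ)
    (a : Vertex n) :
    bernP p {ω | g a ∈ earlySet ω i v k} = bernP p {ω | a ∈ earlySet ω i v k} := by
  rw [← bernP_preimage_equiv p (siteEquiv g 0) {ω | a ∈ earlySet ω i v k}]
  congr 1
  ext ω
  change _ ↔ a ∈ earlySet (ω ∘ siteEquiv g 0) i v k
  rw [mem_earlySet_comp_siteEquiv, hg, add_zero]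
  rfl

end Symmetry

/-- A permutation of the columns and a permutation of the rows form an automorphism. -/
def prodAut (σ τ : Equiv.Perm (Fin n)) : hamming n ≃g hamming n where
  toEquiv := Equiv.prodCongr σ τ
  map_rel_iff' := by
    rintro ⟨a, b⟩ ⟨a', b'⟩
    simp [hamming, Prod.ext_iff]

/-- Exchanging rows and columns is an automorphism. -/
def swapAut : hamming n ≃g hamming n where
  toEquiv := Equiv.prodComm _ _
  map_rel_iff' := by
    rintro ⟨a, b⟩ ⟨a', b'⟩
    simp [hamming, Prod.ext_iff]
    tauto

@[simp] lemma prodAut_apply (σ τ : Equiv.Perm (Fin n)) (v : Vertex n) :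
    prodAut σ τ v = (σ v.1, τ v.2) := rfl

@[simp] lemma swapAut_apply (v : Vertex n) : swapAut v = (v.2, v.1) := rfl

section Bounds

variable [NeZero m] {p : ℝ}

lemma bernP_hitEvent_eq (p : ℝ) (i i' : ZMod m) (v v' : Vertex n) (k : ℕ) :
    bernP p (HitEvent i v k) = bernP p (HitEvent i' v' k) := by
  have := bernP_hitEvent_map (prodAut (Equiv.swap v.1 v'.1) (Equiv.swap v.2 v'.2)) (i' - i) p i v k
  simpa using this.symm

lemma sum_bernP_earlySet_le (h0 : 0 ≤ p) (h1 : p ≤ 1) (i : ZMod m) (x : Vertex n) (k : ℕ)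
    (T : Finset (Vertex n)) :
    ∑ u ∈ T, bernP p {ω | u ∈ earlySet ω i x k} ≤ k := by
  classical
  unfold bernP
  rw [← bernE_sum]
  rw [← bernE_const (B := Edge n × ZMod m) p (k : ℝ)]
  refine bernE_mono h0 h1 fun ω => ?_
  calc ∑ u ∈ T, Set.indicator {ω | u ∈ earlySet ω i x k} (1 : (Edge n × ZMod m → Bool) → ℝ) ω
      = ((T.filter fun u => u ∈ earlySet ω i x k).card : ℝ) := by
        simp only [Set.indicator_apply, Set.mem_ofPred_eq, Pi.one_apply, Finset.sum_boole]
    _ ≤ ((earlySet ω i x k).card : ℝ) := by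
        exact_mod_cast Finset.card_le_card fun u hu => (Finset.mem_filter.1 hu).2
    _ ≤ k := by exact_mod_cast card_earlySet_le ω i x k

/-- By symmetry, a vertex in general position with respect to the starting point `x` is among the
first `k` vertices with probability at most `k / (n - 1)²`. -/
lemma bernP_generic_mem_earlySet_le (hn : 2 ≤ n) (h0 : 0 ≤ p) (h1 : p ≤ 1) (i : ZMod m)
    {x u : Vertex n} (k : ℕ) (hu1 : u.1 ≠ x.1) (hu2 : u.2 ≠ x.2) :
    bernP p {ω | u ∈ earlySet ω i x k} ≤ k / ((n : ℝ) - 1) ^ 2 := by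
  classical
  set T : Finset (Vertex n) := (Finset.univ.erase x.1) ×ˢ (Finset.univ.erase x.2)
  have hT : T.card = (n - 1) * (n - 1) := by
    simp [T]
  have h := sum_bernP_earlySet_le h0 h1 i x k T
  have hc : ∀ u' ∈ T, bernP p {ω | u' ∈ earlySet ω i x k} = bernP p {ω | u ∈ earlySet ω i x k} := by
    intro u' hu'
    simp only [T, Finset.mem_product, Finset.mem_erase, Finset.mem_univ, and_true] at hu'
    have := bernP_mem_earlySet_map (prodAut (Equiv.swap u.1 u'.1) (Equiv.swap u.2 u'.2)) p i
      (v := x) (by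
        rw [prodAut_apply, Equiv.swap_apply_of_ne_of_ne hu1.symm hu'.1.symm,
          Equiv.swap_apply_of_ne_of_ne hu2.symm hu'.2.symm]) k u
    simpa using this
  rw [Finset.sum_congr rfl hc, Finset.sum_const, hT, nsmul_eq_mul] at h
  have hn' : (2 : ℝ) ≤ n := by exact_mod_cast hn
  rw [le_div_iff₀ (by nlinarith), mul_comm, sq]
  push_cast [Nat.cast_sub (show 1 ≤ n by omega)] at h
  exact h

lemma bernP_row_mem_earlySet_le (hn : 2 ≤ n) (h0 : 0 ≤ p) (h1 : p ≤ 1) (i : ZMod m)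
    {x u : Vertex n} (k : ℕ) (hu1 : u.1 ≠ x.1) (hu2 : u.2 = x.2) :
    bernP p {ω | u ∈ earlySet ω i x k} ≤ k / ((n : ℝ) - 1) := by
  classical
  set T : Finset (Vertex n) := (Finset.univ.erase x.1) ×ˢ {x.2}
  have hT : T.card = n - 1 := by
    simp [T]
  have h := sum_bernP_earlySet_le h0 h1 i x k T
  have hc : ∀ u' ∈ T, bernP p {ω | u' ∈ earlySet ω i x k} = bernP p {ω | u ∈ earlySet ω i x k} := by
    intro u' hu'
    simp only [T, Finset.mem_product, Finset.mem_erase, Finset.mem_univ, and_true,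
      Finset.mem_singleton] at hu'
    have := bernP_mem_earlySet_map (prodAut (Equiv.swap u.1 u'.1) (Equiv.refl _)) p i
      (v := x) (by
        rw [prodAut_apply, Equiv.swap_apply_of_ne_of_ne hu1.symm hu'.1.symm]; rfl) k u
    have e : (prodAut (Equiv.swap u.1 u'.1) (Equiv.refl _)) u = u' := by
      ext1 <;> simp [hu2, hu'.2]
    rw [e] at this
    exact this
  rw [Finset.sum_congr rfl hc, Finset.sum_const, hT, nsmul_eq_mul] at h
  have hn' : (2 : ℝ) ≤ n := by exact_mod_cast hn
  rw [le_div_iff₀ (by linarith), mul_comm]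
  push_cast [Nat.cast_sub (show 1 ≤ n by omega)] at h
  exact h

/-- By symmetry, a row which does not contain the starting point is met by the first `k` vertices
with probability at most `k / (n - 1)`. -/
lemma bernP_earlySet_meets_row_le (hn : 2 ≤ n) (h0 : 0 ≤ p) (h1 : p ≤ 1) (i : ZMod m)
    {x : Vertex n} (k : ℕ) {b : Fin n} (hb : b ≠ x.2) :
    bernP p {ω | ∃ a ∈ earlySet ω i x k, a.2 = b} ≤ k / ((n : ℝ) - 1) := by
  classical
  have h : ∑ b' ∈ Finset.univ.erase x.2, bernP p {ω | ∃ a ∈ earlySet ω i x k, a.2 = b'} ≤ k := by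
    unfold bernP
    rw [← bernE_sum]
    rw [← bernE_const (B := Edge n × ZMod m) p (k : ℝ)]
    refine bernE_mono h0 h1 fun ω => ?_
    calc ∑ b' ∈ Finset.univ.erase x.2,
          Set.indicator {ω | ∃ a ∈ earlySet ω i x k, a.2 = b'} (1 : (Edge n × ZMod m → Bool) → ℝ) ω
        = (((Finset.univ.erase x.2).filter fun b' =>
            ∃ a ∈ earlySet ω i x k, a.2 = b').card : ℝ) := by
          simp [Set.indicator_apply, Finset.sum_boole]
      _ ≤ (((earlySet ω i x k).image Prod.snd).card : ℝ) := by
          exact_mod_cast Finset.card_le_card fun b' hb' => by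
            simpa [and_comm] using (Finset.mem_filter.1 hb').2
      _ ≤ k := by
          exact_mod_cast Finset.card_image_le.trans (card_earlySet_le ω i x k)
  have hc : ∀ b' ∈ Finset.univ.erase x.2, bernP p {ω | ∃ a ∈ earlySet ω i x k, a.2 = b'}
      = bernP p {ω | ∃ a ∈ earlySet ω i x k, a.2 = b} := by
    intro b' hb'
    simp only [Finset.mem_erase, Finset.mem_univ, and_true] at hb'
    set g := prodAut (Equiv.refl _) (Equiv.swap b b')
    have hg : g x = x := by
      rw [prodAut_apply, Equiv.swap_apply_of_ne_of_ne hb.symm hb'.symm]; rfl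
    rw [← bernP_preimage_equiv p (siteEquiv g 0) {ω | ∃ a ∈ earlySet ω i x k, a.2 = b}]
    congr 1
    ext ω
    change _ ↔ ∃ a ∈ earlySet (ω ∘ siteEquiv g 0) i x k, a.2 = b
    simp only [mem_earlySet_comp_siteEquiv, hg, add_zero]
    constructor
    · rintro ⟨a, ha, rfl⟩
      refine ⟨g a, ?_, by simp [g]⟩
      have : g (g a) = a := by simp [g]
      rwa [this]
    · rintro ⟨a, ha, rfl⟩
      exact ⟨g a, ha, by simp [g]⟩
  rw [Finset.sum_congr rfl hc, Finset.sum_const, nsmul_eq_mul] at h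
  have hn' : (2 : ℝ) ≤ n := by exact_mod_cast hn
  rw [le_div_iff₀ (by linarith), mul_comm]
  simp only [Finset.card_erase_of_mem (Finset.mem_univ _), Finset.card_univ, Fintype.card_fin] at h
  push_cast [Nat.cast_sub (show 1 ≤ n by omega)] at h
  exact h

end Bounds

lemma hamming_adj {v w : Vertex n} :
    (hamming n).Adj v w ↔ v ≠ w ∧ (v.1 = w.1 ∨ v.2 = w.2) := Iff.rfl

open Classical in
lemma degree_hamming (v : Vertex n) : (hamming n).degree v = 2 * (n - 1) := by
  have h : (hamming n).neighborFinset v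
      = (({v.1} : Finset (Fin n)) ×ˢ (Finset.univ.erase v.2)) ∪
        ((Finset.univ.erase v.1) ×ˢ ({v.2} : Finset (Fin n))) := by
    ext w
    simp only [SimpleGraph.mem_neighborFinset, hamming_adj, Finset.mem_union, Finset.mem_product,
      Finset.mem_singleton, Finset.mem_erase, Finset.mem_univ, and_true, ne_eq, Prod.ext_iff]
    tauto
  rw [← SimpleGraph.card_neighborFinset_eq_degree, h, Finset.card_union_of_disjoint]
  · simp; omega
  · rw [Finset.disjoint_left]
    intro w hw hw'
    simp only [Finset.mem_product, Finset.mem_singleton, Finset.mem_erase] at hw hw'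
    exact hw'.1.1 hw.1

lemma card_edge (n : ℕ) : Fintype.card (Edge n) = n ^ 2 * (n - 1) := by
  classical
  have h := SimpleGraph.sum_degrees_eq_twice_card_edges (hamming n)
  simp only [degree_hamming, Finset.sum_const, Finset.card_univ, Fintype.card_prod,
    Fintype.card_fin, smul_eq_mul] at h
  have h2 : ∀ I : Fintype (hamming n).edgeSet,
      (@SimpleGraph.edgeFinset _ (hamming n) I).card = Fintype.card (Edge n) := fun I => by
    rw [← Nat.card_eq_fintype_card, ← Set.ncard_coe_finset, SimpleGraph.coe_edgeFinset]
    rfl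
  rw [h2, mul_left_comm] at h
  rw [sq]
  convert (Nat.eq_of_mul_eq_mul_left two_pos h).symm

open Classical in
lemma card_incident (v : Vertex n) :
    (Finset.univ.filter fun e : Edge n => v ∈ e.1).card = 2 * (n - 1) := by
  rw [← degree_hamming v, ← SimpleGraph.card_incidenceFinset_eq_degree]
  refine Finset.card_bij (fun e _ => e.1) (fun e he => ?_) (fun e _ e' _ h => Subtype.ext h)
    fun e he => ?_
  · exact (SimpleGraph.mem_incidenceFinset _ _ _).2 ⟨e.2, (Finset.mem_filter.1 he).2⟩
  · rw [SimpleGraph.mem_incidenceFinset] at he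
    exact ⟨⟨e, he.1⟩, Finset.mem_filter.2 ⟨Finset.mem_univ _, he.2⟩, rfl⟩

end Events

/-! ### Escape from a row -/

section Escape

variable {n m : ℕ}

lemma op_splice_left {U : Set (Edge n × ZMod m)} {ω ξ : Edge n × ZMod m → Bool} {j : ZMod m}
    {a c : Vertex n} (h : ∀ e : Edge n, e.1 = s(a, c) → (e, j) ∈ U) :
    Op (splice U ω ξ) j a c ↔ Op ω j a c := by
  constructor <;> rintro ⟨e, he, ho⟩
  · exact ⟨e, he, by rwa [splice_of_mem (h e he)] at ho⟩
  · exact ⟨e, he, by rwa [splice_of_mem (h e he)]⟩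

lemma op_splice_right {U : Set (Edge n × ZMod m)} {ω ξ : Edge n × ZMod m → Bool} {j : ZMod m}
    {a c : Vertex n} (h : ∀ e : Edge n, e.1 = s(a, c) → (e, j) ∉ U) :
    Op (splice U ω ξ) j a c ↔ Op ξ j a c := by
  constructor <;> rintro ⟨e, he, ho⟩
  · exact ⟨e, he, by rwa [splice_of_notMem (h e he)] at ho⟩
  · exact ⟨e, he, by rwa [splice_of_notMem (h e he)]⟩

/-- The sites on the bars of `v` and `w`. -/
def barSites (v w : Vertex n) : Set (Edge n × ZMod m) := {b | v ∈ b.1.1 ∨ w ∈ b.1.1}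

/-- The fresh configurations in which the walk started at `x` above the cell `l` sees `k` vertices
before it meets `F`, `w` or the row `b`, and in which the bar of `x` is empty in the cell `l`. -/
def FreshEvent (F : Finset (Vertex n)) (w : Vertex n) (b : Fin n) (x : Vertex n) (l : ZMod m)
    (k : ℕ) : Set (Edge n × ZMod m → Bool) :=
  {ξ | ξ ∈ HitEvent (l + 1) x k ∧ (∀ a ∈ earlySet ξ (l + 1) x k, a ∉ F ∧ a ≠ w ∧ a.2 ≠ b) ∧
    ∀ c, ¬ Op ξ l x c}

/-- The escape of the walk from the row `b`: after entering a new vertex `v` of the row it crosses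
to `w`, whose row is new, then to `x`, whose column is new as well, and then follows a fresh walk
which sees `k` vertices before it meets the row `b` or a vertex visited earlier. -/
lemma notMem_lineEvent_of_fresh [NeZero m] {ω ω₁ ξ : Edge n × ZMod m → Bool} {i i₁ i₂ : ZMod m}
    {v₀ v w x : Vertex n} {b : Fin n} {s k j : ℕ}
    (hs : walk ω i v₀ s = some v) (hv : v ∉ visited ω i v₀ s) (hvb : v.2 = b)
    (hj : (visited ω i v₀ (s + 1) ∩ rowFinset b).card ≤ j)
    (hw1 : w.1 = v.1) (hwF : ∀ f ∈ visited ω i v₀ (s + 1), w.2 ≠ f.2)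
    (hx2 : x.2 = w.2) (hxF : ∀ f ∈ visited ω i v₀ (s + 1), x.1 ≠ f.1)
    (hi1 : i₁ + 1 ≠ i + s) (hi2 : i₂ ≠ i₁)
    (hωv : ∀ l c, Op ω₁ l v c ↔ c = w ∧ l = i₁)
    (hωw : ∀ l c, Op ω₁ l w c ↔ (c = v ∧ l = i₁) ∨ (c = x ∧ l = i₂))
    (hξ : ξ ∈ FreshEvent (visited ω i v₀ (s + 1)) w b x i₂ k) :
    splice (revealed ω i v₀ s) ω (splice (barSites v w) ω₁ ξ)
      ∉ LineEvent (rowFinset b) i v₀ k (j + 1) := by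
  set F := visited ω i v₀ (s + 1) with hF
  set ω' := splice (revealed ω i v₀ s) ω (splice (barSites v w) ω₁ ξ) with hω'
  obtain ⟨hhit, havoid, hclosed⟩ := hξ
  have hvF : v ∈ F := by rw [hF, visited_succ hs]; exact Finset.mem_insert_self _ _
  have hFsub : visited ω i v₀ s ⊆ F := visited_mono (Nat.le_succ s)
  have hwnF : w ∉ F := fun h => hwF w h rfl
  have hxnF : x ∉ F := fun h => hxF x h rfl
  have hwv : w ≠ v := fun h => hwnF (h ▸ hvF)
  have hxv : x ≠ v := fun h => hxnF (h ▸ hvF)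
  have hwx : w ≠ x := fun h => hxF v hvF (h ▸ hw1)
  have hws : w ∉ visited ω i v₀ s := fun h => hwnF (hFsub h)
  have hxs : x ∉ visited ω i v₀ s := fun h => hxnF (hFsub h)
  -- the environment ahead of the walk
  have hv' : ∀ l c, Op (splice (barSites v w) ω₁ ξ) l v c ↔ c = w ∧ l = i₁ := fun l c => by
    rw [op_splice_left (fun e he => Or.inl (by simp [he])), hωv]
  have hw' : ∀ l c, Op (splice (barSites v w) ω₁ ξ) l w c ↔
      (c = v ∧ l = i₁) ∨ (c = x ∧ l = i₂) := fun l c => by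
    rw [op_splice_left (fun e he => Or.inr (by simp [he])), hωw]
  have hother : ∀ l a c, a ≠ v → a ≠ w → c ≠ v → c ≠ w →
      (Op (splice (barSites v w) ω₁ ξ) l a c ↔ Op ξ l a c) := fun l a c h1 h2 h3 h4 => by
    refine op_splice_right fun e he => ?_
    simp [barSites, he, h1.symm, h2.symm, h3.symm, h4.symm]
  -- the first crossing
  obtain ⟨s₁, hs₁, hi₁, hw₁, hr₁⟩ := walk_hop (ω := ω') (i := i) (v := v₀) (s := s) (a := v)
    (b := w) (j := i₁)
    ((walk_congr (fun b hb => splice_of_mem hb) hs s le_rfl).trans hs) hi1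
    (fun l c hl ho => (hv' l c).1 (op_of_op_splice hs hv (fun _ => hl) ho))
    (op_splice_of_op hs hv hws (fun _ => hi1) ((hv' _ _).2 ⟨rfl, rfl⟩))
    (fun c hc => by
      have := (hw' _ _).1 (op_of_op_splice hs hws (fun h => absurd h hwv) hc)
      rcases this with h | h
      · exact h.1
      · exact absurd h.2.symm hi2)
  -- the second crossing
  obtain ⟨s₂, hs₂, hi₂, hx₂, hr₂⟩ := walk_hop (ω := ω') (i := i) (v := v₀) (s := s₁) (a := w)
    (b := x) (j := i₂) hw₁
    (by rw [hi₁]; exact fun h => hi2 (add_right_cancel h))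
    (fun l c hl ho => by
      rcases (hw' l c).1 (op_of_op_splice hs hws (fun h => absurd h hwv) ho) with h | h
      · rw [hi₁, h.2] at hl; exact absurd rfl hl
      · exact h)
    (op_splice_of_op hs hws hxs (fun h => by rcases h with h | h <;> contradiction)
      ((hw' _ _).2 (Or.inr ⟨rfl, rfl⟩)))
    (fun c hc => by
      have ho := op_of_op_splice hs hxs (fun h => absurd h hxv) hc
      by_cases hcw : c = w
      · exact hcw
      · by_cases hcv : c = v
        · subst hcv
          exact absurd ((hv' _ _).1 ho.symm).1 hwx.symm
        · exact absurd ((hother _ _ _ hxv hwx.symm hcv hcw).1 ho) (hclosed c))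
  -- from `x` on, the walk follows the fresh walk
  have hfresh := walk_eq_fresh (ω' := ω') (ξ := ξ) (F := insert w F) (k := k) hx₂ hi₂ hhit
    (fun r a ha hk => by
      have := havoid a (mem_earlySet.2 ⟨r, ha, hk⟩)
      simp [this.1, this.2.1])
    hclosed
    (fun l a c haF hax ho => by
      simp only [Finset.mem_insert, not_or] at haF
      have hav : a ≠ v := fun h => haF.2 (h ▸ hvF)
      have h1 := op_of_op_splice hs (fun h => haF.2 (hFsub h)) (fun h => absurd h hav) ho
      by_cases hcv : c = v
      · subst hcv
        exact absurd ((hv' _ _).1 h1.symm).1 haF.1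
      · by_cases hcw : c = w
        · subst hcw
          rcases (hw' _ _).1 h1.symm with h | h
          · exact absurd h.1 hav
          · exact absurd h.2 (hax h.1)
        · exact (hother _ _ _ hav haF.1 hcv hcw).1 h1)
    (fun l a c haF hcF ho => by
      simp only [Finset.mem_insert, not_or] at haF hcF
      have hav : a ≠ v := fun h => haF.2 (h ▸ hvF)
      have hcv : c ≠ v := fun h => hcF.2 (h ▸ hvF)
      refine op_splice_of_op hs (fun h => haF.2 (hFsub h)) (fun h => hcF.2 (hFsub h))
        (fun h => by rcases h with h | h <;> contradiction) ?_
      exact (hother _ _ _ hav haF.1 hcv hcF.1).2 ho)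
  rintro ⟨s', hcard, hlt⟩
  have hq : ∀ q, s₂ + q ≤ s' → (visited ξ (i₂ + 1) x q).card < k := by
    intro q
    induction q using Nat.strong_induction_on with
    | _ q ih =>
      intro hq
      refine lt_of_le_of_lt (Finset.card_le_card fun a ha => ?_) hlt
      obtain ⟨r, hr, ha⟩ := mem_visited.1 ha
      exact mem_visited.2 ⟨s₂ + r, by omega, (hfresh r (ih r hr (by omega))).trans ha⟩
  have hsub : visited ω' i v₀ (s' + 1) ∩ rowFinset b ⊆ F ∩ rowFinset b := by
    intro a ha
    rw [Finset.mem_inter] at ha ⊢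
    refine ⟨?_, ha.2⟩
    have hab : a.2 = b := by simpa [rowFinset] using ha.2
    obtain ⟨r, hr, hwr⟩ := mem_visited.1 ha.1
    rcases lt_or_ge r s with h1 | h1
    · refine mem_visited.2 ⟨r, by omega, ?_⟩
      rw [← hwr]
      exact (walk_congr (fun b hb => splice_of_mem hb) hs r h1.le).symm
    rcases lt_or_ge r s₁ with h2 | h2
    · rw [hr₁ r h1 h2, Option.some_inj] at hwr
      exact hwr ▸ hvF
    rcases lt_or_ge r s₂ with h3 | h3
    · rw [hr₂ r h2 h3, Option.some_inj] at hwr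
      exact absurd (by rw [hvb, ← hab, ← hwr]) (hwF v hvF)
    · obtain ⟨q, rfl⟩ := Nat.exists_eq_add_of_le h3
      have hk := hq q (by omega)
      rw [hfresh q hk] at hwr
      exact absurd hab (havoid a (mem_earlySet.2 ⟨q, hwr, hk⟩)).2.2
  have := Finset.card_le_card hsub
  omega

/-- A bound for the probability that a fresh walk meets the past before it has seen `k`
vertices. The four terms account for the at most `k` visited vertices, which are in general position
to the starting point, for the vertex `w` in the row of the starting point, for the row `b`, and for
a bridge on the bar of the starting point in the cell just below it. -/
noncomputable def freshError (n k : ℕ) (p : ℝ) : ℝ :=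
  k * (k / ((n : ℝ) - 1) ^ 2) + k / ((n : ℝ) - 1) + k / ((n : ℝ) - 1) + 2 * ((n : ℝ) - 1) * p

lemma bernP_freshEvent_ge [NeZero m] (hn : 2 ≤ n) {p : ℝ} (h0 : 0 ≤ p) (h1 : p ≤ 1)
    {F : Finset (Vertex n)} {w x : Vertex n} {b : Fin n} (l : ZMod m) {k : ℕ} (hFk : F.card ≤ k)
    (hF1 : ∀ f ∈ F, f.1 ≠ x.1) (hF2 : ∀ f ∈ F, f.2 ≠ x.2) (hw1 : w.1 ≠ x.1) (hw2 : w.2 = x.2)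
    (hb : b ≠ x.2) :
    bernP p (HitEvent (l + 1) x k) - freshError n k p ≤ bernP p (FreshEvent F w b x l k) := by
  classical
  have hsub : HitEvent (l + 1) x k ⊆ FreshEvent F w b x l k ∪
      ((⋃ u ∈ F, {ξ | u ∈ earlySet ξ (l + 1) x k}) ∪ ({ξ | w ∈ earlySet ξ (l + 1) x k} ∪
      ({ξ | ∃ a ∈ earlySet ξ (l + 1) x k, a.2 = b} ∪
      ⋃ e ∈ Finset.univ.filter (fun e : Edge n => x ∈ e.1), {ξ | ξ (e, l) = true}))) := by
    intro ξ hξ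
    by_contra hne
    simp only [Set.mem_union, not_or, Set.mem_iUnion, not_exists, Set.mem_ofPred_eq, not_and,
      Finset.mem_filter, Finset.mem_univ, true_and] at hne
    obtain ⟨h1, h2, h3, h4, h5⟩ := hne
    refine h1 ⟨hξ, fun a ha => ⟨fun haF => h2 a haF ha, ?_, fun hab => h4 a ha hab⟩, ?_⟩
    · rintro rfl
      exact h3 ha
    · rintro c ⟨e, he, ho⟩
      exact h5 e (by simp [he]) ho
  have hn' : (2 : ℝ) ≤ n := by exact_mod_cast hn
  have e1 : bernP p (⋃ u ∈ F, {ξ | u ∈ earlySet ξ (l + 1) x k})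
      ≤ k * (k / ((n : ℝ) - 1) ^ 2) := by
    refine (bernP_biUnion_le h0 h1 _ _).trans ?_
    refine (Finset.sum_le_card_nsmul _ _ _ fun u hu =>
      bernP_generic_mem_earlySet_le hn h0 h1 (l + 1) k (hF1 u hu) (hF2 u hu)).trans ?_
    rw [nsmul_eq_mul]
    have : (F.card : ℝ) ≤ k := by exact_mod_cast hFk
    gcongr
  have e2 := bernP_row_mem_earlySet_le hn h0 h1 (l + 1) k hw1 hw2
  have e3 := bernP_earlySet_meets_row_le hn h0 h1 (l + 1) k hb
  have e4 : bernP p (⋃ e ∈ Finset.univ.filter (fun e : Edge n => x ∈ e.1),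
      {ξ : Edge n × ZMod m → Bool | ξ (e, l) = true}) ≤ 2 * ((n : ℝ) - 1) * p := by
    refine (bernP_biUnion_le h0 h1 _ _).trans (le_of_eq ?_)
    simp only [bernP_site, Finset.sum_const, card_incident, nsmul_eq_mul]
    push_cast [Nat.cast_sub (show 1 ≤ n by omega)]
    ring
  have := bernP_mono h0 h1 hsub
  have u1 := bernP_union_le h0 h1 (FreshEvent F w b x l k)
      ((⋃ u ∈ F, {ξ | u ∈ earlySet ξ (l + 1) x k}) ∪ ({ξ | w ∈ earlySet ξ (l + 1) x k} ∪
      ({ξ | ∃ a ∈ earlySet ξ (l + 1) x k, a.2 = b} ∪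
      ⋃ e ∈ Finset.univ.filter (fun e : Edge n => x ∈ e.1), {ξ | ξ (e, l) = true})))
  have u2 := bernP_union_le h0 h1 (⋃ u ∈ F, {ξ | u ∈ earlySet ξ (l + 1) x k})
      ({ξ | w ∈ earlySet ξ (l + 1) x k} ∪
      ({ξ | ∃ a ∈ earlySet ξ (l + 1) x k, a.2 = b} ∪
      ⋃ e ∈ Finset.univ.filter (fun e : Edge n => x ∈ e.1), {ξ | ξ (e, l) = true}))
  have u3 := bernP_union_le h0 h1 {ξ | w ∈ earlySet ξ (l + 1) x k}
      ({ξ | ∃ a ∈ earlySet ξ (l + 1) x k, a.2 = b} ∪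
      ⋃ e ∈ Finset.univ.filter (fun e : Edge n => x ∈ e.1), {ξ | ξ (e, l) = true})
  have u4 := bernP_union_le h0 h1 {ξ | ∃ a ∈ earlySet ξ (l + 1) x k, a.2 = b}
      (⋃ e ∈ Finset.univ.filter (fun e : Edge n => x ∈ e.1), {ξ | ξ (e, l) = true})
  unfold freshError
  linarith

/-- The discrete version of the factor `t² / (4 n² (n-1)²) e^{-4t/n²}`: the probability that the
walk takes one of the escape routes out of a row. -/
noncomputable def escapeProb (n m : ℕ) (p : ℝ) : ℝ :=
  ((n : ℝ) / 2) ^ 2 * ((m : ℝ) - 1) ^ 2 * p ^ 2 * (1 - p) ^ (4 * (n - 1) * m)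

open Classical in
/-- The sites on the bars of `v` and `w` as a finite set. -/
noncomputable def barFinset [NeZero m] (v w : Vertex n) : Finset (Edge n × ZMod m) :=
  ((Finset.univ.filter fun e : Edge n => v ∈ e.1) ∪
    (Finset.univ.filter fun e : Edge n => w ∈ e.1)) ×ˢ Finset.univ

lemma coe_barFinset [NeZero m] (v w : Vertex n) :
    ((barFinset v w : Finset (Edge n × ZMod m)) : Set (Edge n × ZMod m)) = barSites v w := by
  ext b
  simp [barFinset, barSites]

lemma card_barFinset_le [NeZero m] (v w : Vertex n) :
    (barFinset v w : Finset (Edge n × ZMod m)).card ≤ 4 * (n - 1) * m := by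
  rw [barFinset, Finset.card_product, Finset.card_univ, ZMod.card]
  refine Nat.mul_le_mul_right _ ((Finset.card_union_le _ _).trans ?_)
  rw [card_incident, card_incident]
  omega

open Classical in
/-- The pattern in which the only bridges on the bars of `v` and `w` join `v` to `w` in the cell
`i₁` and `w` to `x` in the cell `i₂`. -/
noncomputable def route (v w x : Vertex n) (i₁ i₂ : ZMod m) : Edge n × ZMod m → Bool :=
  fun b => decide ((b.1.1 = s(v, w) ∧ b.2 = i₁) ∨ (b.1.1 = s(w, x) ∧ b.2 = i₂))

lemma bernP_route_ge [NeZero m] {p : ℝ} (h0 : 0 ≤ p) (h1 : p ≤ 1) {v w x : Vertex n}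
    {i₁ i₂ : ZMod m} (hvw : (hamming n).Adj v w) (hwx : (hamming n).Adj w x) (hi : i₂ ≠ i₁) :
    p ^ 2 * (1 - p) ^ (4 * (n - 1) * m)
      ≤ bernP p {ω | ∀ b ∈ barFinset v w, ω b = route v w x i₁ i₂ b} := by
  classical
  rw [bernP_cylinder]
  simp only [route, decide_eq_true_eq]
  rw [Finset.prod_ite, Finset.prod_const, Finset.prod_const]
  have hc : ((barFinset v w).filter fun b : Edge n × ZMod m =>
      (b.1.1 = s(v, w) ∧ b.2 = i₁) ∨ (b.1.1 = s(w, x) ∧ b.2 = i₂)).card = 2 := by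
    have : ((barFinset v w).filter fun b : Edge n × ZMod m =>
        (b.1.1 = s(v, w) ∧ b.2 = i₁) ∨ (b.1.1 = s(w, x) ∧ b.2 = i₂))
        = {(⟨s(v, w), hvw⟩, i₁), (⟨s(w, x), hwx⟩, i₂)} := by
      ext ⟨e, l⟩
      simp only [Finset.mem_filter, Finset.mem_insert, Finset.mem_singleton, Prod.mk.injEq,
        Subtype.ext_iff]
      refine ⟨fun h => h.2, fun h => ⟨?_, h⟩⟩
      rcases h with h | h <;> simp [barFinset, h.1]
    rw [this, Finset.card_pair]
    simp [hi.symm]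
  rw [hc]
  refine mul_le_mul_of_nonneg_left ?_ (by positivity)
  exact pow_le_pow_of_le_one (by linarith) (by linarith)
    ((Finset.card_filter_le _ _).trans (card_barFinset_le v w))

section Route

variable [NeZero m] {ω : Edge n × ZMod m → Bool} {v w x : Vertex n} {i₁ i₂ : ZMod m}

lemma op_route_left (h : ∀ b ∈ barFinset v w, ω b = route v w x i₁ i₂ b)
    (hvw : (hamming n).Adj v w) (hxv : x ≠ v) (l : ZMod m) (c : Vertex n) :
    Op ω l v c ↔ c = w ∧ l = i₁ := by
  constructor
  · rintro ⟨e, he, ho⟩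
    rw [h _ (by simp [barFinset, he])] at ho
    simp only [route, he, decide_eq_true_eq] at ho
    rcases ho with ⟨h1, h2⟩ | ⟨h1, h2⟩
    · rcases Sym2.eq_iff.1 h1 with ⟨-, h3⟩ | ⟨h3, -⟩
      · exact ⟨h3, h2⟩
      · exact absurd h3 hvw.ne
    · rcases Sym2.eq_iff.1 h1 with ⟨h3, -⟩ | ⟨h3, -⟩
      · exact absurd h3 hvw.ne
      · exact absurd h3.symm hxv
  · rintro ⟨rfl, rfl⟩
    refine ⟨⟨s(v, c), hvw⟩, rfl, ?_⟩
    rw [h _ (by simp [barFinset])]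
    simp [route]

lemma op_route_right (h : ∀ b ∈ barFinset v w, ω b = route v w x i₁ i₂ b)
    (hvw : (hamming n).Adj v w) (hwx : (hamming n).Adj w x) (l : ZMod m) (c : Vertex n) :
    Op ω l w c ↔ (c = v ∧ l = i₁) ∨ (c = x ∧ l = i₂) := by
  constructor
  · rintro ⟨e, he, ho⟩
    rw [h _ (by simp [barFinset, he])] at ho
    simp only [route, he, decide_eq_true_eq] at ho
    rcases ho with ⟨h1, h2⟩ | ⟨h1, h2⟩
    · rcases Sym2.eq_iff.1 h1 with ⟨h3, -⟩ | ⟨-, h3⟩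
      · exact absurd h3.symm hvw.ne
      · exact Or.inl ⟨h3, h2⟩
    · rcases Sym2.eq_iff.1 h1 with ⟨-, h3⟩ | ⟨h3, -⟩
      · exact Or.inr ⟨h3, h2⟩
      · exact absurd h3 hwx.ne
  · rintro (⟨rfl, rfl⟩ | ⟨rfl, rfl⟩)
    · refine ⟨⟨s(w, c), hvw.symm⟩, rfl, ?_⟩
      rw [h _ (by simp [barFinset])]
      simp [route, Sym2.eq_swap]
    · refine ⟨⟨s(w, c), hwx⟩, rfl, ?_⟩
      rw [h _ (by simp [barFinset])]
      simp [route]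

end Route

/-- Once the walk has entered a new vertex of the row `b`, it never enters another one before it
has seen `k` vertices with probability at least `escapeProb` times the probability that a fresh
walk sees `k` vertices and does not meet the past. -/
lemma bernP_escape_ge [NeZero m] (hn : 2 ≤ n) {p : ℝ} (h0 : 0 ≤ p) (h1 : p ≤ 1)
    {ω : Edge n × ZMod m → Bool} {i i₀ : ZMod m} {v₀ v u₀ : Vertex n} {b : Fin n} {s k j : ℕ}
    (hs : walk ω i v₀ s = some v) (hv : v ∉ visited ω i v₀ s) (hvb : v.2 = b)
    (hj : (visited ω i v₀ (s + 1) ∩ rowFinset b).card ≤ j)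
    (hk : (visited ω i v₀ s).card < k) (hkn : (k : ℝ) ≤ n / 2) :
    escapeProb n m p * max 0 (bernP p (HitEvent i₀ u₀ k) - freshError n k p)
      ≤ bernP p {ω₁ | splice (revealed ω i v₀ s) ω ω₁
          ∉ LineEvent (rowFinset b) i v₀ k (j + 1)} := by
  classical
  set F := visited ω i v₀ (s + 1) with hF
  set c := max 0 (bernP p (HitEvent i₀ u₀ k) - freshError n k p) with hc
  set G := {ω₁ | splice (revealed ω i v₀ s) ω ω₁ ∉ LineEvent (rowFinset b) i v₀ k (j + 1)}
    with hG
  have hc0 : 0 ≤ c := le_max_left _ _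
  have hn' : (2 : ℝ) ≤ n := by exact_mod_cast hn
  have hm : 1 ≤ m := Nat.one_le_iff_ne_zero.2 (NeZero.ne m)
  have hvF : v ∈ F := by rw [hF, visited_succ hs]; exact Finset.mem_insert_self _ _
  have hFk : F.card ≤ k := by
    rw [hF, visited_succ hs]
    exact (Finset.card_insert_le _ _).trans hk
  -- the rows and columns that are free of visited vertices
  set R := Finset.univ \ F.image Prod.snd with hR
  set C := Finset.univ \ F.image Prod.fst with hC
  have hcard : ∀ f : Vertex n → Fin n, (n : ℝ) / 2 ≤ ((Finset.univ \ F.image f).card : ℝ) := by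
    intro f
    have h2 : (F.image f).card ≤ k := Finset.card_image_le.trans hFk
    have h3 : (n : ℝ) ≤ (Finset.univ \ F.image f).card + (F.image f).card := by
      have := Finset.card_sdiff_add_card (Finset.univ : Finset (Fin n)) (F.image f)
      have h4 := Finset.card_le_card
        (Finset.subset_union_left (s₁ := (Finset.univ : Finset (Fin n))) (s₂ := F.image f))
      rw [Finset.card_univ, Fintype.card_fin] at h4
      exact_mod_cast h4.trans this.symm.le
    have h5 : ((F.image f).card : ℝ) ≤ k := by exact_mod_cast h2
    linarith
  -- an index consists of a new row, a new column, the cell of the bridge to the new row, which is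
  -- not the cell in which `v` is entered, and the number of cells from this bridge to the next one
  set I : Finset ((Fin n × Fin n) × (ZMod m × ZMod m)) :=
    (R ×ˢ C) ×ˢ ((Finset.univ.erase (i + s - 1)) ×ˢ (Finset.univ.erase 0)) with hI
  have hIcard : ((n : ℝ) / 2) ^ 2 * ((m : ℝ) - 1) ^ 2 ≤ (I.card : ℝ) := by
    rw [hI, Finset.card_product, Finset.card_product, Finset.card_product,
      Finset.card_erase_of_mem (Finset.mem_univ _), Finset.card_erase_of_mem (Finset.mem_univ _),
      Finset.card_univ, ZMod.card]
    push_cast [Nat.cast_sub hm]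
    have hm' : (1 : ℝ) ≤ m := by exact_mod_cast hm
    rw [sq, sq]
    have a1 := hcard Prod.snd
    have a2 := hcard Prod.fst
    have : (n : ℝ) / 2 * (n / 2) ≤ R.card * C.card := by gcongr
    exact mul_le_mul_of_nonneg_right this (mul_self_nonneg _)
  let W : (Fin n × Fin n) × (ZMod m × ZMod m) → Vertex n := fun q => (v.1, q.1.1)
  let X : (Fin n × Fin n) × (ZMod m × ZMod m) → Vertex n := fun q => (q.1.2, q.1.1)
  let cyl : (Fin n × Fin n) × (ZMod m × ZMod m) → Set (Edge n × ZMod m → Bool) := fun q =>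
    {ω₁ | ∀ b ∈ barFinset v (W q), ω₁ b = route v (W q) (X q) q.2.1 (q.2.1 + q.2.2) b}
  have hIspec : ∀ q ∈ I, (∀ f ∈ F, q.1.1 ≠ f.2) ∧ (∀ f ∈ F, q.1.2 ≠ f.1) ∧
      q.2.1 + 1 ≠ i + s ∧ q.2.1 + q.2.2 ≠ q.2.1 := by
    rintro ⟨⟨r, q⟩, i₁, d⟩ hq
    simp only [hI, hR, hC, Finset.mem_product, Finset.mem_sdiff, Finset.mem_univ, true_and,
      Finset.mem_image, not_exists, not_and, Finset.mem_erase, and_true] at hq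
    refine ⟨fun f hf h => hq.1.1 f hf h.symm, fun f hf h => hq.1.2 f hf h.symm,
      fun h => hq.2.1 (eq_sub_of_add_eq h), fun h => hq.2.2 ?_⟩
    simpa using h
  have hadj1 : ∀ q ∈ I, (hamming n).Adj v (W q) := fun q hq =>
    ⟨fun h => (hIspec q hq).1 v hvF (congrArg Prod.snd h).symm, Or.inl rfl⟩
  have hadj2 : ∀ q ∈ I, (hamming n).Adj (W q) (X q) := fun q hq =>
    ⟨fun h => (hIspec q hq).2.1 v hvF (congrArg Prod.fst h).symm, Or.inr rfl⟩
  have hXv : ∀ q ∈ I, X q ≠ v := fun q hq h => (hIspec q hq).2.1 v hvF (congrArg Prod.fst h)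
  have hterm : ∀ q ∈ I, p ^ 2 * (1 - p) ^ (4 * (n - 1) * m) * c
      ≤ bernE p ((cyl q).indicator (G.indicator 1)) := by
    intro q hq
    obtain ⟨hq1, hq2, hq3, hq4⟩ := hIspec q hq
    refine (mul_le_mul_of_nonneg_right
      (bernP_route_ge h0 h1 (hadj1 q hq) (hadj2 q hq) hq4) hc0).trans ?_
    refine bernE_cylinder_ge h0 h1 _ _ _ _ fun ω₁ hω₁ => ?_
    have hfr : c ≤ bernP p (FreshEvent F (W q) b (X q) (q.2.1 + q.2.2) k) := by
      refine max_le (bernP_nonneg h0 h1 _) ?_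
      rw [bernP_hitEvent_eq p i₀ (q.2.1 + q.2.2 + 1) u₀ (X q)]
      exact bernP_freshEvent_ge hn h0 h1 _ hFk (fun f hf h => hq2 f hf h.symm)
        (fun f hf h => hq1 f hf h.symm) (fun h => hq2 v hvF h.symm) rfl
        (fun h => hq1 v hvF (by rw [hvb, h]))
    refine hfr.trans (bernE_mono h0 h1 fun ξ => ?_)
    by_cases hξ : ξ ∈ FreshEvent F (W q) b (X q) (q.2.1 + q.2.2) k
    · rw [Set.indicator_of_mem hξ, Set.indicator_of_mem]
      · rfl
      · rw [coe_barFinset]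
        exact notMem_lineEvent_of_fresh (x := X q) (w := W q) hs hv hvb hj rfl hq1 rfl hq2 hq3 hq4
          (op_route_left hω₁ (hadj1 q hq) (hXv q hq))
          (op_route_right hω₁ (hadj1 q hq) (hadj2 q hq)) hξ
    · rw [Set.indicator_of_notMem hξ]
      exact Set.indicator_nonneg (by simp) _
  -- the patterns of different routes exclude each other, so that their probabilities add up
  have huniq : ∀ ω₁, ∀ q ∈ I, ∀ q' ∈ I, ω₁ ∈ cyl q → ω₁ ∈ cyl q' → q' = q := by
    intro ω₁ q hq q' hq' h h'
    have a1 := (op_route_left h' (hadj1 q' hq') (hXv q' hq') _ _).1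
      ((op_route_left h (hadj1 q hq) (hXv q hq) (q.2.1) (W q)).2 ⟨rfl, rfl⟩)
    have a2 := (op_route_right h (hadj1 q hq) (hadj2 q hq) _ (X q)).2 (Or.inr ⟨rfl, rfl⟩)
    rw [a1.1] at a2
    rcases (op_route_right h' (hadj1 q' hq') (hadj2 q' hq') _ _).1 a2 with a3 | a3
    · exact absurd a3.1 (hXv q hq)
    · have b1 := congrArg Prod.snd a1.1
      have b2 := congrArg Prod.fst a3.1
      have b3 := a3.2
      rw [a1.2] at b3
      exact Prod.ext (Prod.ext b1.symm b2.symm) (Prod.ext a1.2.symm (add_left_cancel b3).symm)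
  have hsum : ∑ q ∈ I, bernE p ((cyl q).indicator (G.indicator 1)) ≤ bernP p G := by
    rw [← bernE_sum]
    refine bernE_mono h0 h1 fun ω₁ => ?_
    by_cases hex : ∃ q ∈ I, ω₁ ∈ cyl q
    · obtain ⟨q, hq, hω₁⟩ := hex
      rw [Finset.sum_eq_single_of_mem q hq fun q' hq' hne =>
        Set.indicator_of_notMem (fun h => hne (huniq ω₁ q hq q' hq' hω₁ h)) _]
      rw [Set.indicator_of_mem hω₁]
    · rw [Finset.sum_eq_zero fun q hq =>
        Set.indicator_of_notMem (fun h => hex ⟨q, hq, h⟩) _]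
      exact Set.indicator_nonneg (by simp) _
  refine le_trans ?_ hsum
  refine le_trans ?_ (Finset.card_nsmul_le_sum _ _ _ hterm)
  rw [nsmul_eq_mul, escapeProb]
  have hp : 0 ≤ p ^ 2 * (1 - p) ^ (4 * (n - 1) * m) * c := by
    have : 0 ≤ 1 - p := by linarith
    positivity
  calc _ = ((n : ℝ) / 2) ^ 2 * ((m : ℝ) - 1) ^ 2 * (p ^ 2 * (1 - p) ^ (4 * (n - 1) * m) * c) := by
        ring
    _ ≤ _ := mul_le_mul_of_nonneg_right hIcard hp

end Escape

/-! ### Entry times, visits to a line, and the number of vertices seen -/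

section Stages

variable {n m : ℕ}

open Classical in
/-- The time at which the walk enters its `j`-th vertex of `L`; `0` if this does not happen before
it has seen `k` vertices. -/
noncomputable def entryTime (L : Finset (Vertex n)) (i : ZMod m) (v : Vertex n) (k j : ℕ)
    (ω : Edge n × ZMod m → Bool) : ℕ :=
  if h : ∃ s, j ≤ (visited ω i v (s + 1) ∩ L).card ∧ (visited ω i v s).card < k then
    Nat.find h else 0

variable {L : Finset (Vertex n)} {i : ZMod m} {v : Vertex n} {k j : ℕ}
  {ω ω' : Edge n × ZMod m → Bool}

lemma entryTime_spec (h : ω ∈ LineEvent L i v k j) :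
    j ≤ (visited ω i v (entryTime L i v k j ω + 1) ∩ L).card ∧
      (visited ω i v (entryTime L i v k j ω)).card < k := by
  classical
  have h' : ∃ s, j ≤ (visited ω i v (s + 1) ∩ L).card ∧ (visited ω i v s).card < k := h
  rw [entryTime, dif_pos h']
  exact Nat.find_spec h'

lemma entryTime_le {s : ℕ} (h : j ≤ (visited ω i v (s + 1) ∩ L).card)
    (h' : (visited ω i v s).card < k) : entryTime L i v k j ω ≤ s := by
  classical
  have h'' : ∃ s, j ≤ (visited ω i v (s + 1) ∩ L).card ∧ (visited ω i v s).card < k :=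
    ⟨s, h, h'⟩
  rw [entryTime, dif_pos h'']
  exact Nat.find_min' h'' ⟨h, h'⟩

lemma card_visited_entryTime_inter_lt (h : ω ∈ LineEvent L i v k j) (hj : 1 ≤ j) :
    (visited ω i v (entryTime L i v k j ω) ∩ L).card < j := by
  cases hs : entryTime L i v k j ω with
  | zero => rw [visited_zero]; simp; omega
  | succ s =>
    by_contra hle
    have := entryTime_le (not_lt.1 hle)
      ((Finset.card_le_card (visited_mono (Nat.le_succ s))).trans_lt (hs ▸ (entryTime_spec h).2))
    omega

/-- At its `j`-th entry time the walk is at a new vertex of `L`. -/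
lemma exists_walk_entryTime (h : ω ∈ LineEvent L i v k j) (hj : 1 ≤ j) :
    ∃ a, walk ω i v (entryTime L i v k j ω) = some a ∧ a ∈ L ∧
      a ∉ visited ω i v (entryTime L i v k j ω) ∧
      (visited ω i v (entryTime L i v k j ω + 1) ∩ L).card = j := by
  have h1 := card_visited_entryTime_inter_lt h hj
  have h2 := (entryTime_spec h).1
  cases hw : walk ω i v (entryTime L i v k j ω) with
  | none => rw [visited_succ_of_none hw] at h2; omega
  | some a =>
    rw [visited_succ hw] at h2 ⊢
    by_cases haL : a ∈ L
    · by_cases hav : a ∈ visited ω i v (entryTime L i v k j ω)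
      · rw [Finset.insert_eq_of_mem hav] at h2; omega
      · refine ⟨a, rfl, haL, hav, le_antisymm ?_ h2⟩
        rw [Finset.insert_inter_of_mem haL]
        exact (Finset.card_insert_le _ _).trans h1
    · rw [Finset.insert_inter_of_notMem haL] at h2; omega

lemma entryTime_congr (h : ω ∈ LineEvent L i v k j) (hj : 1 ≤ j)
    (hω' : ∀ b ∈ revealed ω i v (entryTime L i v k j ω), ω' b = ω b) :
    ω' ∈ LineEvent L i v k j ∧ entryTime L i v k j ω' = entryTime L i v k j ω ∧
      ∀ r ≤ entryTime L i v k j ω, walk ω' i v r = walk ω i v r := by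
  obtain ⟨a, ha, -⟩ := exists_walk_entryTime h hj
  have hw := walk_congr hω' ha
  have hvis : ∀ r ≤ entryTime L i v k j ω + 1, visited ω' i v r = visited ω i v r := fun r hr =>
    visited_congr fun q hq => hw q (by omega)
  have hs := entryTime_spec h
  rw [← hvis _ le_rfl, ← hvis _ (Nat.le_succ _)] at hs
  have hle := entryTime_le hs.1 hs.2
  have hmem : ω' ∈ LineEvent L i v k j := ⟨_, hs⟩
  refine ⟨hmem, le_antisymm hle ?_, hw⟩
  have hs' := entryTime_spec hmem
  rw [hvis _ (by omega), hvis _ (by omega)] at hs'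
  exact entryTime_le hs'.1 hs'.2

lemma lineEvent_succ_subset : LineEvent L i v k (j + 1) ⊆ LineEvent L i v k j :=
  fun _ ⟨s, h, h'⟩ => ⟨s, by omega, h'⟩

variable [NeZero m] {p : ℝ}

/-- The Markov property at the `j`-th entry time. -/
lemma bernE_resample_entry (h0 : 0 ≤ p) (h1 : p ≤ 1) (hj : 1 ≤ j)
    (f g : (Edge n × ZMod m → Bool) → ℝ)
    (h : ∀ ω ∈ LineEvent L i v k j, bernE p (fun ω₁ =>
      g (splice (revealed ω i v (entryTime L i v k j ω)) ω ω₁)) ≤ f ω) :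
    bernE p ((LineEvent L i v k j).indicator g) ≤ bernE p ((LineEvent L i v k j).indicator f) := by
  refine bernE_resample h0 h1 _ (fun ω => revealed ω i v (entryTime L i v k j ω)) ?_ f g h
  intro ω hω ω' hω'
  obtain ⟨h1, h2, h3⟩ := entryTime_congr hω hj hω'
  refine ⟨h1, ?_⟩
  simp only [h2]
  exact revealed_congr h3

/-- After each entry into a row there is a chance to escape from it for good. -/
lemma bernP_lineEvent_succ_le (hn : 2 ≤ n) (h0 : 0 ≤ p) (h1 : p ≤ 1) (hj : 1 ≤ j) (b : Fin n)
    (i i₀ : ZMod m) (v₀ u₀ : Vertex n) (hkn : (k : ℝ) ≤ n / 2) :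
    bernP p (LineEvent (rowFinset b) i v₀ k (j + 1))
      ≤ (1 - escapeProb n m p * max 0 (bernP p (HitEvent i₀ u₀ k) - freshError n k p))
        * bernP p (LineEvent (rowFinset b) i v₀ k j) := by
  set q := 1 - escapeProb n m p * max 0 (bernP p (HitEvent i₀ u₀ k) - freshError n k p) with hq
  have := bernE_resample_entry (L := rowFinset b) (i := i) (v := v₀) (k := k) h0 h1 hj
    (fun _ => q) ((LineEvent (rowFinset b) i v₀ k (j + 1)).indicator 1) fun ω hω => by
      obtain ⟨a, ha, haL, hav, hc⟩ := exists_walk_entryTime hω hj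
      have h2 := bernP_escape_ge hn h0 h1 (i₀ := i₀) (u₀ := u₀) (b := b) ha hav
        (by simpa [rowFinset] using haL) hc.le (entryTime_spec hω).2 hkn
      have h3 := bernP_compl p {ω₁ | splice (revealed ω i v₀
        (entryTime (rowFinset b) i v₀ k j ω)) ω ω₁ ∈ LineEvent (rowFinset b) i v₀ k (j + 1)}
      have h4 : bernP p {ω₁ | splice (revealed ω i v₀ (entryTime (rowFinset b) i v₀ k j ω)) ω ω₁
          ∈ LineEvent (rowFinset b) i v₀ k (j + 1)} ≤ q := by
        rw [hq]
        have e : {ω₁ | splice (revealed ω i v₀ (entryTime (rowFinset b) i v₀ k j ω)) ω ω₁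
          ∈ LineEvent (rowFinset b) i v₀ k (j + 1)}ᶜ = {ω₁ | splice (revealed ω i v₀
          (entryTime (rowFinset b) i v₀ k j ω)) ω ω₁
          ∉ LineEvent (rowFinset b) i v₀ k (j + 1)} := rfl
        rw [e] at h3
        linarith
      exact h4
  have e1 : (LineEvent (rowFinset b) i v₀ k j).indicator
      ((LineEvent (rowFinset b) i v₀ k (j + 1)).indicator (1 : (Edge n × ZMod m → Bool) → ℝ))
      = (LineEvent (rowFinset b) i v₀ k (j + 1)).indicator 1 := by
    rw [Set.indicator_indicator, Set.inter_eq_self_of_subset_right lineEvent_succ_subset]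
  rw [e1] at this
  refine this.trans (le_of_eq ?_)
  rw [bernP, mul_comm, ← bernE_mul_const]
  congr 1
  ext ω
  by_cases h : ω ∈ LineEvent (rowFinset b) i v₀ k j <;> simp [h]

/-- The discrete tail bound for the number of visits to a row. -/
theorem bernP_lineEvent_row_le (hn : 2 ≤ n) (h0 : 0 ≤ p) (h1 : p ≤ 1) (b : Fin n)
    (i i₀ : ZMod m) (v₀ u₀ : Vertex n) (hkn : (k : ℝ) ≤ n / 2) (M : ℕ) :
    bernP p (LineEvent (rowFinset b) i v₀ k M)
      ≤ max 0 (1 - escapeProb n m p *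
        max 0 (bernP p (HitEvent i₀ u₀ k) - freshError n k p)) ^ (M - 1) := by
  set q := 1 - escapeProb n m p * max 0 (bernP p (HitEvent i₀ u₀ k) - freshError n k p) with hq
  induction M with
  | zero => simpa using bernP_le_one h0 h1 _
  | succ M ih =>
    rcases Nat.eq_zero_or_pos M with rfl | hM
    · simpa using bernP_le_one h0 h1 _
    · refine (bernP_lineEvent_succ_le hn h0 h1 hM b i i₀ v₀ u₀ hkn).trans ?_
      rw [← hq]
      calc q * bernP p (LineEvent (rowFinset b) i v₀ k M)
          ≤ max 0 q * bernP p (LineEvent (rowFinset b) i v₀ k M) :=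
            mul_le_mul_of_nonneg_right (le_max_right _ _) (bernP_nonneg h0 h1 _)
        _ ≤ max 0 q * max 0 q ^ (M - 1) := mul_le_mul_of_nonneg_left ih (le_max_left _ _)
        _ = max 0 q ^ (M + 1 - 1) := by
            rw [← pow_succ', Nat.sub_add_cancel hM, Nat.add_sub_cancel]

theorem bernP_lineEvent_col_le (hn : 2 ≤ n) (h0 : 0 ≤ p) (h1 : p ≤ 1) (b : Fin n)
    (i i₀ : ZMod m) (v₀ u₀ : Vertex n) (hkn : (k : ℝ) ≤ n / 2) (M : ℕ) :
    bernP p (LineEvent (colFinset b) i v₀ k M)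
      ≤ max 0 (1 - escapeProb n m p *
        max 0 (bernP p (HitEvent i₀ u₀ k) - freshError n k p)) ^ (M - 1) := by
  have h := bernP_lineEvent_map (swapAut (n := n)) (0 : ZMod m) p i (v₀.2, v₀.1) k M
    (L := rowFinset b) (L' := colFinset b) (by simp [rowFinset, colFinset])
  rw [add_zero] at h
  have e : swapAut (v₀.2, v₀.1) = v₀ := rfl
  rw [e] at h
  rw [h]
  exact bernP_lineEvent_row_le hn h0 h1 b i i₀ _ u₀ hkn M

end Stages

section Speed

variable {n m : ℕ}

lemma card_visited_lt (ω : Edge n × ZMod m → Bool) (i : ZMod m) (v : Vertex n) (s : ℕ) :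
    (visited ω i v s).card < n ^ 2 + 1 := by
  have := Finset.card_le_univ (visited ω i v s)
  simp only [Fintype.card_prod, Fintype.card_fin] at this
  rw [sq]; omega

variable [NeZero m] {p : ℝ}

lemma card_singleBar (v : Vertex n) :
    (barFinset v v : Finset (Edge n × ZMod m)).card = 2 * (n - 1) * m := by
  rw [barFinset, Finset.card_product, Finset.card_univ, ZMod.card, Finset.union_self,
    card_incident]

/-- If the bar of the new vertex `v` carries no bridge but the one crossed last, then the walk
needs a full period to see another vertex. -/
lemma visited_subset_of_isolated {ω ω₁ : Edge n × ZMod m → Bool} {i : ZMod m} {v₀ v : Vertex n}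
    {s : ℕ} (hs : walk ω i v₀ s = some v) (hv : v ∉ visited ω i v₀ s)
    (hω₁ : ∀ b ∈ barFinset v v, ω₁ b = false) {r : ℕ} (hr : r < s + m) :
    visited (splice (revealed ω i v₀ s) ω ω₁) i v₀ (r + 1) ⊆ visited ω i v₀ (s + 1) := by
  set ω' := splice (revealed ω i v₀ s) ω ω₁ with hω'
  have hw := walk_congr (ω' := ω') (fun b hb => splice_of_mem hb) hs
  have hwait := walk_wait (ω := ω') (i := i) (v := v₀) (s := s) (a := v) (D := m - 1)
    ((hw s le_rfl).trans hs) fun d hd c hop => by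
      obtain ⟨e, he, ho⟩ := op_of_op_splice hs hv (fun _ h => by
        have h2 : ((d + 1 : ℕ) : ZMod m) = 0 := by
          have : i + s + ((d + 1 : ℕ) : ZMod m) = i + s + 0 := by
            rw [add_zero]
            refine Eq.trans ?_ h
            push_cast; ring
          exact add_left_cancel this
        rw [ZMod.natCast_eq_zero_iff] at h2
        exact absurd (Nat.le_of_dvd (Nat.succ_pos d) h2) (by omega)) hop
      rw [hω₁ _ (by simp [barFinset, he])] at ho
      exact absurd ho (by simp)
  intro a ha
  obtain ⟨q, hq, ha⟩ := mem_visited.1 ha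
  rcases lt_or_ge q s with h | h
  · exact mem_visited.2 ⟨q, by omega, (hw q h.le) ▸ ha⟩
  · have := hwait (q - s) (by omega)
    rw [Nat.add_sub_cancel' h, ha, Option.some_inj] at this
    exact mem_visited.2 ⟨s, by omega, this ▸ hs⟩

/-- The walk sees its `j`-th vertex. There are `n ^ 2` vertices, so that the bound `n ^ 2 + 1` on
the number of vertices seen is no restriction. -/
abbrev SeenEvent (i : ZMod m) (v : Vertex n) (j : ℕ) : Set (Edge n × ZMod m → Bool) :=
  LineEvent Finset.univ i v (n ^ 2 + 1) j

/-- The time at which the walk sees its `j`-th vertex. -/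
noncomputable abbrev seenTime (i : ZMod m) (v : Vertex n) (j : ℕ) (ω : Edge n × ZMod m → Bool) :
    ℕ := entryTime Finset.univ i v (n ^ 2 + 1) j ω

/-- The bar of a new vertex is empty with probability `y = (1 - p) ^ (2 (n - 1) m)`, and then a full
period passes before the next vertex is seen. -/
lemma bernE_seen_succ_le (h0 : 0 ≤ p) (h1 : p ≤ 1) (i : ZMod m) (v : Vertex n) {j : ℕ}
    (hj : 1 ≤ j) {l : ℝ} (hl : 0 ≤ l) :
    bernE p ((SeenEvent i v (j + 1)).indicator
        fun ω => Real.exp (-(l * (seenTime i v (j + 1) ω / m))))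
      ≤ bernE p ((SeenEvent i v j).indicator fun ω => Real.exp (-(l * (seenTime i v j ω / m))))
        * (1 - (1 - p) ^ (2 * (n - 1) * m) * (1 - Real.exp (-l))) := by
  set y := (1 - p) ^ (2 * (n - 1) * m) with hy
  set g : (Edge n × ZMod m → Bool) → ℝ := (SeenEvent i v (j + 1)).indicator
        fun ω => Real.exp (-(l * (seenTime i v (j + 1) ω / m))) with hg
  have hm : (0 : ℝ) < m := by exact_mod_cast Nat.pos_of_ne_zero (NeZero.ne m)
  have key := bernE_resample_entry (L := Finset.univ) (i := i) (v := v) (k := n ^ 2 + 1) h0 h1 hj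
    (fun ω => Real.exp (-(l * (seenTime i v j ω / m))) * (1 - y * (1 - Real.exp (-l)))) g
    fun ω hω => by
      obtain ⟨a, ha, -, hav, hc⟩ := exists_walk_entryTime hω hj
      set s := seenTime i v j ω with hs
      set A : Set (Edge n × ZMod m → Bool) := {ω₁ | ∀ b ∈ barFinset a a, ω₁ b = false} with hA
      have hAp : bernP p A = y := by
        rw [hA, bernP_cylinder p (barFinset a a) (fun _ => false)]
        simp [card_singleBar, hy]
      have hpt : ∀ ω₁, g (splice (revealed ω i v s) ω ω₁) ≤
          Real.exp (-(l * (s / m))) - A.indicator 1 ω₁ *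
            (Real.exp (-(l * (s / m))) * (1 - Real.exp (-l))) := by
        intro ω₁
        set ω' := splice (revealed ω i v s) ω ω₁ with hω'
        have hw := walk_congr (ω' := ω') (fun b hb => splice_of_mem hb) ha
        have hl1 : Real.exp (-l) ≤ 1 := Real.exp_le_one_iff.2 (by linarith)
        by_cases hmem : ω' ∈ SeenEvent i v (j + 1)
        · rw [hg, Set.indicator_of_mem hmem]
          have hsp : j + 1 ≤ (visited ω' i v (seenTime i v (j + 1) ω' + 1)).card := by
            simpa only [Finset.inter_univ] using (entryTime_spec hmem).1
          have hc' : (visited ω i v (s + 1)).card = j := by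
            simpa only [Finset.inter_univ] using hc
          by_cases hωA : ω₁ ∈ A
          · rw [Set.indicator_of_mem hωA, Pi.one_apply, one_mul]
            have hge : s + m ≤ seenTime i v (j + 1) ω' := by
              by_contra hlt
              have : (visited ω' i v (seenTime i v (j + 1) ω' + 1)).card
                  ≤ (visited ω i v (s + 1)).card := Finset.card_le_card
                (visited_subset_of_isolated ha hav hωA (not_le.1 hlt))
              omega
            have hge' : (s : ℝ) + m ≤ seenTime i v (j + 1) ω' := by exact_mod_cast hge
            have : Real.exp (-(l * (s / m))) - Real.exp (-(l * (s / m))) * (1 - Real.exp (-l))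
                = Real.exp (-(l * (s / m)) + -l) := by
              rw [Real.exp_add]; ring
            rw [this]
            refine Real.exp_le_exp.2 ?_
            have h3 : (s : ℝ) / m + 1 ≤ seenTime i v (j + 1) ω' / m := by
              rw [div_add_one hm.ne']
              gcongr
            nlinarith
          · rw [Set.indicator_of_notMem hωA, zero_mul, sub_zero]
            have hge : s ≤ seenTime i v (j + 1) ω' := by
              by_contra hlt
              have h4 : visited ω' i v (seenTime i v (j + 1) ω' + 1)
                  = visited ω i v (seenTime i v (j + 1) ω' + 1) :=
                visited_congr fun r hr => hw r (by omega)
              rw [h4] at hsp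
              have := Finset.card_le_card (visited_mono (ω := ω) (i := i) (v := v)
                (show seenTime i v (j + 1) ω' + 1 ≤ s + 1 by omega))
              omega
            have hge' : (s : ℝ) ≤ seenTime i v (j + 1) ω' := by exact_mod_cast hge
            refine Real.exp_le_exp.2 ?_
            have h3 : (s : ℝ) / m ≤ seenTime i v (j + 1) ω' / m := by gcongr
            nlinarith
        · rw [hg, Set.indicator_of_notMem hmem, sub_nonneg]
          have h5 : A.indicator (1 : (Edge n × ZMod m → Bool) → ℝ) ω₁ ≤ 1 :=
            Set.indicator_le_self' (by simp) ω₁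
          have h6 : Real.exp (-(l * (s / m))) * (1 - Real.exp (-l)) ≤ Real.exp (-(l * (s / m))) :=
            mul_le_of_le_one_right (Real.exp_pos _).le (by linarith [Real.exp_pos (-l)])
          have h7 : 0 ≤ Real.exp (-(l * (s / m))) * (1 - Real.exp (-l)) :=
            mul_nonneg (Real.exp_pos _).le (by linarith)
          calc _ ≤ 1 * (Real.exp (-(l * (s / m))) * (1 - Real.exp (-l))) :=
                mul_le_mul_of_nonneg_right h5 h7
            _ ≤ _ := by rw [one_mul]; exact h6
      refine (bernE_mono h0 h1 hpt).trans (le_of_eq ?_)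
      rw [bernE_sub, bernE_const, bernE_mul_const]
      change _ - bernP p A * _ = _
      rw [hAp]; ring
  have e1 : (SeenEvent i v j).indicator g = g := by
    rw [hg, Set.indicator_indicator, Set.inter_eq_self_of_subset_right lineEvent_succ_subset]
  rw [e1] at key
  refine key.trans (le_of_eq ?_)
  rw [← bernE_mul_const]
  congr 1
  ext ω
  by_cases h : ω ∈ SeenEvent i v j <;> simp [h]

lemma bernE_seen_le (h0 : 0 ≤ p) (h1 : p ≤ 1) (i : ZMod m) (v : Vertex n) (K : ℕ) {l : ℝ}
    (hl : 0 ≤ l) :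
    bernE p ((SeenEvent i v (K + 1)).indicator
        fun ω => Real.exp (-(l * (seenTime i v (K + 1) ω / m))))
      ≤ (1 - (1 - p) ^ (2 * (n - 1) * m) * (1 - Real.exp (-l))) ^ K := by
  induction K with
  | zero =>
    rw [pow_zero, ← bernE_const (B := Edge n × ZMod m) p 1]
    refine bernE_mono h0 h1 fun ω =>
      Set.indicator_le' (g := fun _ => 1) (fun ω _ => ?_) (fun _ _ => zero_le_one) ω
    refine Real.exp_le_one_iff.2 (neg_nonpos.2 (by positivity))
  | succ K ih =>
    refine (bernE_seen_succ_le h0 h1 i v (Nat.succ_pos K) hl).trans ?_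
    rw [pow_succ]
    refine mul_le_mul_of_nonneg_right ih ?_
    have h3 : (1 - p) ^ (2 * (n - 1) * m) ≤ 1 := pow_le_one₀ (by linarith) (by linarith)
    have h4 : 0 ≤ (1 - p) ^ (2 * (n - 1) * m) := pow_nonneg (by linarith) _
    have h5 : Real.exp (-l) ≤ 1 := Real.exp_le_one_iff.2 (by linarith)
    nlinarith [Real.exp_pos (-l)]

/-- Hoeffding's bound for the Laplace transform of a Bernoulli variable. -/
lemma one_sub_mul_le_exp {y l : ℝ} (hy0 : 0 ≤ y) (hy1 : y ≤ 1) :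
    1 - y * (1 - Real.exp (-l)) ≤ Real.exp (-(l * y) + l ^ 2 / 8) := by
  set μ : Measure Bool := ENNReal.ofReal y • Measure.dirac true
    + ENNReal.ofReal (1 - y) • Measure.dirac false with hμ
  have hprob : IsProbabilityMeasure μ := ⟨by
    simp only [hμ, Measure.coe_add, Measure.coe_smul, Pi.add_apply, Pi.smul_apply, measure_univ,
      smul_eq_mul, mul_one]
    rw [← ENNReal.ofReal_add hy0 (by linarith)]
    simp⟩
  have hint : ∀ f : Bool → ℝ, ∫ x, f x ∂μ = y * f true + (1 - y) * f false := by
    intro f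
    rw [hμ, integral_add_measure
      ((integrable_dirac (by simp)).smul_measure ENNReal.ofReal_ne_top)
      ((integrable_dirac (by simp)).smul_measure ENNReal.ofReal_ne_top), integral_smul_measure,
      integral_smul_measure, integral_dirac, integral_dirac,
      ENNReal.toReal_ofReal hy0, ENNReal.toReal_ofReal (by linarith)]
    simp
  have hsub := hasSubgaussianMGF_of_mem_Icc (μ := μ) (X := fun x : Bool => if x then (1 : ℝ) else 0)
    (a := 0) (b := 1) (measurable_of_finite _).aemeasurable
    (Filter.Eventually.of_forall fun x => by cases x <;> simp)
  have h := hsub.mgf_le (-l)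
  rw [mgf, hint, hint] at h
  have e1 : Real.exp (-l * (1 - y)) = Real.exp (l * y) * Real.exp (-l) := by
    rw [← Real.exp_add]; ring_nf
  have e2 : Real.exp (-l * (0 - y)) = Real.exp (l * y) := by ring_nf
  simp only [if_true, Bool.false_eq_true, if_false, mul_one, mul_zero, add_zero, e1, e2] at h
  have e3 : Real.exp (-(l * y) + l ^ 2 / 8) = Real.exp (-(l * y)) * Real.exp (l ^ 2 / 8) :=
    Real.exp_add _ _
  have e4 : Real.exp (-(l * y)) * Real.exp (l * y) = 1 := by rw [← Real.exp_add]; simp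
  rw [e3]
  have e5 : (((‖(1 : ℝ) - 0‖₊ / 2) ^ 2 : ℝ≥0) : ℝ) * (-l) ^ 2 / 2 = l ^ 2 / 8 := by
    simp; ring
  rw [e5] at h
  calc 1 - y * (1 - Real.exp (-l))
      = Real.exp (-(l * y)) * Real.exp (l * y) * (1 - y * (1 - Real.exp (-l))) := by
        rw [e4, one_mul]
    _ = Real.exp (-(l * y)) *
        (y * (Real.exp (l * y) * Real.exp (-l)) + (1 - y) * Real.exp (l * y)) := by ring
    _ ≤ _ := mul_le_mul_of_nonneg_left h (Real.exp_pos _).le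

/-- The walk is slow: in `k` periods it sees more than `K ≥ 2 k / y` vertices with exponentially
small probability, where `y` is the probability that a bar is empty. -/
theorem bernP_fast_le (h0 : 0 ≤ p) (h1 : p ≤ 1) (i : ZMod m) (v : Vertex n) {k K : ℕ}
    (hK : 2 * (k : ℝ) ≤ (1 - p) ^ (2 * (n - 1) * m) * K) :
    bernP p {ω | K + 1 ≤ (visited ω i v (k * m + 1)).card}
      ≤ Real.exp (-((1 - p) ^ (2 * (n - 1) * m) * k)) := by
  set y := (1 - p) ^ (2 * (n - 1) * m) with hy
  have hy0 : 0 ≤ y := pow_nonneg (by linarith) _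
  have hy1 : y ≤ 1 := pow_le_one₀ (by linarith) (by linarith)
  have hm : (0 : ℝ) < m := by exact_mod_cast Nat.pos_of_ne_zero (NeZero.ne m)
  -- as `2 k ≤ y K`, the exponent `l k + K (l² / 8 - l y)` of the Chernoff bound is at most `-y k`
  -- at `l = 2 y`
  set l := 2 * y with hl
  have hl0 : 0 ≤ l := by positivity
  have hstep : bernP p {ω | K + 1 ≤ (visited ω i v (k * m + 1)).card}
      ≤ bernE p ((SeenEvent i v (K + 1)).indicator
        fun ω => Real.exp (-(l * (seenTime i v (K + 1) ω / m)))) * Real.exp (l * k) := by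
    rw [← bernE_mul_const]
    refine bernE_mono h0 h1 fun ω => ?_
    by_cases h : K + 1 ≤ (visited ω i v (k * m + 1)).card
    · have h' : K + 1 ≤ (visited ω i v (k * m + 1) ∩ Finset.univ).card := by
        rwa [Finset.inter_univ]
      have hmem : ω ∈ SeenEvent i v (K + 1) := ⟨k * m, h', card_visited_lt _ _ _ _⟩
      have hle : (seenTime i v (K + 1) ω : ℝ) ≤ k * m := by
        exact_mod_cast entryTime_le h' (card_visited_lt ω i v (k * m))
      rw [Set.indicator_of_mem (show ω ∈ {ω | K + 1 ≤ (visited ω i v (k * m + 1)).card} from h),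
        Set.indicator_of_mem hmem, ← Real.exp_add, Pi.one_apply]
      refine Real.one_le_exp ?_
      have : (seenTime i v (K + 1) ω : ℝ) / m ≤ k := (div_le_iff₀ hm).2 hle
      nlinarith
    · rw [Set.indicator_of_notMem (show ω ∉ {ω | K + 1 ≤ (visited ω i v (k * m + 1)).card} from h)]
      exact mul_nonneg (Set.indicator_nonneg (fun _ _ => (Real.exp_pos _).le) _)
        (Real.exp_pos _).le
  refine hstep.trans ?_
  refine (mul_le_mul_of_nonneg_right (bernE_seen_le h0 h1 i v K hl0) (Real.exp_pos _).le).trans ?_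
  have h2 := one_sub_mul_le_exp (l := l) hy0 hy1
  have h3 : 0 ≤ 1 - y * (1 - Real.exp (-l)) := by nlinarith [Real.exp_pos (-l)]
  refine (mul_le_mul_of_nonneg_right (pow_le_pow_left₀ h3 h2 K) (Real.exp_pos _).le).trans ?_
  rw [← Real.exp_nat_mul, ← Real.exp_add]
  refine Real.exp_le_exp.2 ?_
  rw [hl]
  nlinarith

end Speed

/-! ### Discretisation of bridge configurations -/

section Discretisation

variable {n m : ℕ}

/-- The number of the cell `((s-1) t / m, s t / m]` that contains the height `y`. -/
noncomputable def tick (t : ℝ) (m : ℕ) (y : ℝ) : ℕ := ⌈y * m / t⌉₊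

/-- The heights in the cell `i`, the cells being numbered modulo `m`. -/
def slab (t : ℝ) (m : ℕ) (i : ZMod m) : Set ℝ := {y | 0 < y ∧ y ≤ t ∧ (tick t m y : ZMod m) = i}

open Classical in
/-- The discretised configuration: a site is open if its cell contains a bridge. -/
noncomputable def discretise (M : Set (Edge n × ℝ)) (t : ℝ) (m : ℕ) : Edge n × ZMod m → Bool :=
  fun b => decide (∃ y ∈ slab t m b.2, (b.1, y) ∈ M)

/-- No bridge has height `0`, and every cell contains at most one bridge. -/
structure Separated (M : Set (Edge n × ℝ)) (t : ℝ) (m : ℕ) : Prop where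
  zero : ∀ e, (e, (0 : ℝ)) ∉ M
  single : ∀ i, ∀ b ∈ M, ∀ b' ∈ M, b.2 ∈ slab t m i → b'.2 ∈ slab t m i → b = b'

variable {M : Set (Edge n × ℝ)} {t : ℝ} {a b c v : Vertex n} {y y' : ℝ}

lemma tick_zero : tick t m 0 = 0 := by simp [tick]

lemma tick_mono (ht : 0 < t) (h : y ≤ y') : tick t m y ≤ tick t m y' := by
  unfold tick
  gcongr

lemma lt_of_tick_lt (ht : 0 < t) (h : tick t m y < tick t m y') : y < y' :=
  lt_of_not_ge fun h' => absurd (tick_mono ht h') (not_le.2 h)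

lemma tick_le (ht : 0 < t) (h : y ≤ t) : tick t m y ≤ m := by
  have := tick_mono (m := m) ht h
  refine this.trans (le_of_eq ?_)
  rw [tick, mul_div_assoc, mul_div_cancel₀ _ ht.ne', Nat.ceil_natCast]

lemma tick_pos (hm : 0 < m) (ht : 0 < t) (h : 0 < y) : 0 < tick t m y := by
  rw [tick, Nat.ceil_pos]
  have : (0 : ℝ) < m := by exact_mod_cast hm
  positivity

lemma le_tick (y : ℝ) : y * m / t ≤ tick t m y := Nat.le_ceil _

lemma tick_lt (ht : 0 < t) (h : 0 ≤ y) : (tick t m y : ℝ) < y * m / t + 1 :=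
  Nat.ceil_lt_add_one (by positivity)

lemma op_discretise {j : ZMod m} :
    Op (discretise M t m) j a c ↔ ∃ y ∈ slab t m j, IsBridge M t a c y := by
  constructor
  · rintro ⟨e, he, ho⟩
    obtain ⟨y, hy, hM⟩ := by simpa [discretise] using ho
    exact ⟨y, hy, (e, y), ⟨hM, hy.1.le, hy.2.1⟩, he, rfl⟩
  · rintro ⟨y, hy, ⟨e, y⟩, ⟨hM, -⟩, he, rfl⟩
    exact ⟨e, he, by simpa [discretise] using ⟨_, hy, hM⟩⟩

lemma IsBridge.pos (hM : Separated M t m) (h : IsBridge M t a c y) : 0 < y := by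
  obtain ⟨⟨e, y⟩, ⟨h1, h2, -⟩, -, rfl⟩ := h
  rcases h2.lt_or_eq with h2 | h2
  · exact h2
  · simp only at h2
    subst h2
    exact absurd h1 (hM.zero e)

lemma IsBridge.le (h : IsBridge M t a c y) : y ≤ t := by
  obtain ⟨⟨e, y⟩, ⟨-, -, h2⟩, -, rfl⟩ := h
  exact h2

lemma IsBridge.mem_slab (hM : Separated M t m) (h : IsBridge M t a c y) :
    y ∈ slab t m (tick t m y : ZMod m) := ⟨h.pos hM, h.le, rfl⟩

lemma IsBridge.op (hM : Separated M t m) (h : IsBridge M t a c y) :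
    Op (discretise M t m) (tick t m y : ZMod m) a c := op_discretise.2 ⟨y, h.mem_slab hM, h⟩

lemma IsBridge.eq_of_tick {a' c' : Vertex n} (hM : Separated M t m) (h : IsBridge M t a c y)
    (h' : IsBridge M t a' c' y') (ht : (tick t m y' : ZMod m) = tick t m y) :
    s(a', c') = s(a, c) ∧ y' = y := by
  have h1 := h.mem_slab hM
  have h2 := h'.mem_slab hM
  rw [ht] at h2
  obtain ⟨b, hb, hba, rfl⟩ := h
  obtain ⟨b', hb', hba', rfl⟩ := h'
  have := hM.single _ b hb.1 b' hb'.1 h1 h2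
  subst this
  exact ⟨hba'.symm.trans hba, rfl⟩

/-- In a separated configuration the discretised walk crosses every bridge that it meets. -/
lemma IsBridge.stepRel (hM : Separated M t m) (h : IsBridge M t a b y) :
    StepRel (discretise M t m) (tick t m y : ZMod m) a b := by
  refine Or.inr ⟨h.op hM, fun c hc => ?_, fun c hc => ?_⟩
  · obtain ⟨y', hy', h'⟩ := op_discretise.1 hc
    rcases Sym2.eq_iff.1 (h.eq_of_tick hM h' hy'.2.2).1 with ⟨-, h1⟩ | ⟨h1, h2⟩
    · exact h1
    · exact absurd h1 (h.op hM).ne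
  · obtain ⟨y', hy', h'⟩ := op_discretise.1 hc
    rcases Sym2.eq_iff.1 (h.eq_of_tick hM h' hy'.2.2).1 with ⟨h1, -⟩ | ⟨-, h1⟩
    · exact absurd h1.symm (h.op hM).ne
    · exact h1

section Cyclic

/-- The discretised walk at time `s` represents the point `p` of the cyclic random walk: it is on
the bar of `p`, its next cell is the one above `p.2`, and the only bridge of this bar in the cell
of `p.2` is at `p` itself. -/
structure Represents (M : Set (Edge n × ℝ)) (t : ℝ) (i : ZMod m) (v : Vertex n)
    (p : Vertex n × ℝ) (s : ℕ) : Prop where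
  walk_eq : walk (discretise M t m) i v s = some p.1
  cell : i + s = tick t m p.2 + 1
  le : p.2 ≤ t
  clean : ∀ c y, IsBridge M t p.1 c y → (tick t m y : ZMod m) = tick t m p.2 → y = p.2

/-- The time needed to reach a bridge, in terms of the number `d` of cells in between. -/
lemma ahead_eq [NeZero m] (ht : 0 < t) {i : ZMod m} {p : Vertex n × ℝ} {s : ℕ}
    (hp : Represents M t i v p s) (hM : Separated M t m) (h : IsBridge M t p.1 c y) {d : ℕ}
    (hd : d < m) (hdc : i + s + d = tick t m y) :
    ∃ e : ℕ, ahead t p.2 y = y - p.2 + e * t ∧ tick t m y + e * m = tick t m p.2 + 1 + d := by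
  have hm : 0 < m := Nat.pos_of_ne_zero (NeZero.ne m)
  have hT := tick_le (m := m) ht hp.le
  have hT' := tick_le (m := m) ht h.le
  have hpos := tick_pos hm ht (h.pos hM)
  rw [hp.cell] at hdc
  have hdc' : ((tick t m p.2 + 1 + d : ℕ) : ZMod m) = (tick t m y : ℕ) := by
    push_cast; exact hdc
  rw [ZMod.natCast_eq_natCast_iff, Nat.modEq_iff_dvd] at hdc'
  obtain ⟨q, hq⟩ := hdc'
  push_cast at hq
  have hq0 : q = 0 ∨ q = -1 := by
    have h1 : q < 1 := by
      by_contra hc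
      have : (m : ℤ) * 1 ≤ m * q := by gcongr; omega
      omega
    have h2 : -2 < q := by
      by_contra hc
      have : (m : ℤ) * q ≤ m * (-2) := by gcongr; omega
      omega
    omega
  rcases hq0 with rfl | rfl
  · have h1 : tick t m y = tick t m p.2 + 1 + d := by omega
    refine ⟨0, ?_, by omega⟩
    rw [ahead, if_pos (lt_of_tick_lt (m := m) ht (by omega))]
    simp
  · refine ⟨1, ?_, by omega⟩
    have h1 : tick t m y ≤ tick t m p.2 := by omega
    rw [ahead, if_neg]
    · simp
    · rcases h1.lt_or_eq with h2 | h2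
      · exact (lt_of_tick_lt (m := m) ht h2).le.not_gt
      · rw [hp.clean c y h (by rw [h2])]
        exact lt_irrefl _

lemma Represents.next [NeZero m] (ht : 0 < t) (hM : Separated M t m) {i : ZMod m}
    {p q : Vertex n × ℝ} {s : ℕ} (hp : Represents M t i v p s) (hq : IsNextCyclic M t p q) :
    ∃ s', Represents M t i v q s' ∧ s < s' ∧
      ∀ r, s ≤ r → r < s' → walk (discretise M t m) i v r = some p.1 := by
  obtain ⟨hb, hmin⟩ := hq
  set D := ((tick t m q.2 : ZMod m) - (i + s)).val with hD
  have hDm : D < m := ZMod.val_lt _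
  have hDc : i + s + D = tick t m q.2 := by simp [hD]
  have hm : (0 : ℝ) < m := by exact_mod_cast Nat.pos_of_ne_zero (NeZero.ne m)
  have hwait := walk_wait (D := D) hp.walk_eq fun d hd c hop => by
    obtain ⟨y, hy, hby⟩ := op_discretise.1 hop
    obtain ⟨e, he, he'⟩ := ahead_eq ht hp hM hby (hd.trans hDm) hy.2.2.symm
    obtain ⟨e₁, he₁, he₁'⟩ := ahead_eq ht hp hM hb hDm hDc
    have h1 := hmin c y hby
    rw [he, he₁] at h1
    -- a bridge in an earlier cell is reached strictly earlier
    have h2 : (tick t m y : ℝ) + e * m + 1 ≤ tick t m q.2 + e₁ * m := by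
      have : tick t m y + e * m + 1 ≤ tick t m q.2 + e₁ * m := by omega
      exact_mod_cast this
    have h3 := le_tick (t := t) (m := m) y
    have h4 := tick_lt (m := m) ht (hb.pos hM).le
    have h5 : (y + e * t) * (m / t) < (q.2 + e₁ * t) * (m / t) := by
      have e1 : (y + e * t) * (m / t) = y * m / t + e * m := by field_simp
      have e2 : (q.2 + e₁ * t) * (m / t) = q.2 * m / t + e₁ * m := by field_simp
      rw [e1, e2]; linarith
    have := lt_of_mul_lt_mul_right h5 (by positivity)
    linarith
  refine ⟨s + D + 1, ⟨?_, ?_, hb.le, ?_⟩, by omega, ?_⟩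
  · refine walk_succ_of_step (hwait D le_rfl) ?_
    have : i + ((s + D : ℕ) : ZMod m) = tick t m q.2 := by
      push_cast; rw [← add_assoc]; exact hDc
    rw [this]
    exact hb.stepRel hM
  · push_cast
    rw [← hDc]; ring
  · intro c y hby hty
    exact (hb.eq_of_tick hM hby hty).2
  · intro r h1 h2
    have := hwait (r - s) (by omega)
    rwa [Nat.add_sub_cancel' h1] at this

lemma isNextCyclic_crwStep {p : Vertex n × ℝ} (h : ∃ q, IsNextCyclic M t p q) :
    IsNextCyclic M t p (crwStep M t p) := by
  rw [crwStep, dif_pos h]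
  exact h.choose_spec

lemma crwChain_succ (p : Vertex n × ℝ) (j : ℕ) :
    crwChain M t p (j + 1) = crwStep M t (crwChain M t p j) :=
  Function.iterate_succ_apply' _ _ _

/-- The points of arrival of the cyclic random walk are represented by the discretised walk. -/
lemma exists_represents_crwChain [NeZero m] (ht : 0 < t) (hM : Separated M t m) {i : ZMod m}
    {p : Vertex n × ℝ} (hp : Represents M t i v p 0) (j : ℕ) :
    ∃ s, Represents M t i v (crwChain M t p j) s ∧
      ∀ r < s, ∃ l < j, walk (discretise M t m) i v r = some (crwChain M t p l).1 := by
  induction j with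
  | zero => exact ⟨0, hp, fun r hr => absurd hr (Nat.not_lt_zero r)⟩
  | succ j ih =>
    obtain ⟨s, hs, hr⟩ := ih
    by_cases h : ∃ q, IsNextCyclic M t (crwChain M t p j) q
    · obtain ⟨s', hs', -, hr'⟩ := hs.next ht hM (isNextCyclic_crwStep h)
      rw [crwChain_succ]
      refine ⟨s', hs', fun r hrs => ?_⟩
      rcases lt_or_ge r s with h1 | h1
      · obtain ⟨l, hl, h2⟩ := hr r h1
        exact ⟨l, by omega, h2⟩
      · exact ⟨j, Nat.lt_succ_self j, hr' r h1 hrs⟩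
    · rw [crwChain_succ, crwStep, dif_neg h]
      refine ⟨s, hs, fun r hrs => ?_⟩
      obtain ⟨l, hl, h2⟩ := hr r hrs
      exact ⟨l, by omega, h2⟩

lemma exists_crwChain_of_mem_trace {p : Vertex n × ℝ} {s : ℝ≥0∞} (h : a ∈ trace M t p s) :
    ∃ s' : ℝ≥0, (s' : ℝ≥0∞) ≤ s ∧ a = (crwChain M t p (crwJumps M t p s')).1 := by
  obtain ⟨s', hs', z, hz⟩ := h
  exact ⟨s', hs', (congrArg Prod.fst hz).symm⟩

/-- If the cyclic random walk sees `k` vertices, then so does the discretised walk. -/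
lemma discretise_mem_hitEvent [NeZero m] (ht : 0 < t) (hM : Separated M t m) {i : ZMod m}
    {p : Vertex n × ℝ} (hp : Represents M t i v p 0) {k : ℕ} (h : hitTime M t p k < ⊤) :
    discretise M t m ∈ HitEvent i v k := by
  classical
  have hex : ∃ s : ℝ≥0, k ≤ (trace M t p s).ncard := by
    by_contra hne
    push Not at hne
    have : hitTime M t p k = ⊤ := by
      rw [hitTime]
      simp only [iInf_eq_top]
      intro s hs
      exact absurd hs (not_le.2 (hne s))
    rw [this] at h
    exact lt_irrefl _ h
  obtain ⟨s, hs⟩ := hex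
  have hvis : ∀ a ∈ trace M t p s, ∃ q, walk (discretise M t m) i v q = some a := by
    intro a ha
    obtain ⟨s', -, rfl⟩ := exists_crwChain_of_mem_trace ha
    obtain ⟨q, hq, -⟩ := exists_represents_crwChain ht hM hp (crwJumps M t p s')
    exact ⟨q, hq.walk_eq⟩
  choose! q hq using hvis
  set S := (Finset.univ : Finset (Vertex n)).sup q
  refine ⟨S + 1, hs.trans ?_⟩
  rw [← Set.ncard_coe_finset]
  refine Set.ncard_le_ncard (fun a ha => ?_) (Finset.finite_toSet _)
  exact mem_visited.2 ⟨q a, Nat.lt_succ_of_le (Finset.le_sup (Finset.mem_univ a)), hq a ha⟩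

lemma ahead_pos (hy : y ≤ t) (hy' : 0 < y') : 0 < ahead t y y' := by
  unfold ahead
  split_ifs with h <;> linarith

lemma crwClock_lt_succ [NeZero m] (ht : 0 < t) (hM : Separated M t m) {i : ZMod m}
    {p : Vertex n × ℝ} (hp : Represents M t i v p 0) {j : ℕ} (h : crwClock M t p j ≠ ⊤) :
    crwClock M t p j < crwClock M t p (j + 1) := by
  have hw : 0 < crwWait M t (crwChain M t p j) := by
    unfold crwWait
    split_ifs with hq
    · obtain ⟨s, hs, -⟩ := exists_represents_crwChain ht hM hp j
      exact ENNReal.ofReal_pos.2 (ahead_pos hs.le ((isNextCyclic_crwStep hq).1.pos hM))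
    · exact ENNReal.zero_lt_top
  rw [crwClock, crwClock, Finset.sum_range_succ]
  exact ENNReal.lt_add_right h hw.ne'

lemma crwClock_mono {p : Vertex n × ℝ} : Monotone (crwClock M t p) := fun _ _ h =>
  Finset.sum_le_sum_of_subset (Finset.range_subset_range.2 h)

lemma crwJumps_crwClock [NeZero m] (ht : 0 < t) (hM : Separated M t m) {i : ZMod m}
    {p : Vertex n × ℝ} (hp : Represents M t i v p 0) {j : ℕ} (h : crwClock M t p j ≠ ⊤) :
    crwJumps M t p (crwClock M t p j).toNNReal = j := by
  have : {l : ℕ | crwClock M t p l ≤ ((crwClock M t p j).toNNReal : ℝ≥0∞)} = Set.Iic j := by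
    ext l
    rw [Set.mem_ofPred_eq, ENNReal.coe_toNNReal h, Set.mem_Iic]
    refine ⟨fun hl => ?_, fun hl => crwClock_mono hl⟩
    by_contra hlt
    exact absurd ((crwClock_lt_succ ht hM hp h).trans_le (crwClock_mono (not_le.1 hlt)))
      (not_lt.2 hl)
  rw [crwJumps, this, csSup_Iic]

/-- The vertices that the cyclic random walk has visited by the time it sees `k` vertices are
visited by the discretised walk when it has seen fewer than `k` vertices. -/
lemma exists_walk_of_mem_Z [NeZero m] (ht : 0 < t) (hM : Separated M t m) {i : ZMod m}
    {p : Vertex n × ℝ} (hp : Represents M t i v p 0) {k : ℕ} (hk : 1 ≤ k) (ha : a ∈ Z M t p k) :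
    ∃ s, walk (discretise M t m) i v s = some a ∧
      (visited (discretise M t m) i v s).card < k := by
  classical
  obtain ⟨s', hs', rfl⟩ := exists_crwChain_of_mem_trace ha
  set j := crwJumps M t p s' with hj
  obtain ⟨s, hs, hr⟩ := exists_represents_crwChain ht hM hp j
  refine ⟨s, hs.walk_eq, ?_⟩
  by_contra hcard
  rw [not_lt] at hcard
  set A : Set (Vertex n) := {a | ∃ l < j, a = (crwChain M t p l).1} with hA
  have hsub : (visited (discretise M t m) i v s : Set (Vertex n)) ⊆ A := fun a ha => by
    obtain ⟨r, hrs, h1⟩ := mem_visited.1 (Finset.mem_coe.1 ha)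
    obtain ⟨l, hl, h2⟩ := hr r hrs
    rw [h1, Option.some_inj] at h2
    exact ⟨l, hl, h2⟩
  have hAk : k ≤ A.ncard := by
    refine hcard.trans ?_
    rw [← Set.ncard_coe_finset]
    exact Set.ncard_le_ncard hsub (Set.toFinite _)
  rcases Nat.eq_zero_or_pos j with h0 | hpos
  · have : A = ∅ := by
      rw [hA, h0]
      ext a
      simp
    rw [this, Set.ncard_empty] at hAk
    omega
  · -- the `k` vertices have been seen at the time of the jump before the last one
    have hmem : crwClock M t p j ≤ s' := by
      -- the number of jumps is positive, hence not the value `0` of an unbounded supremum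
      have hne : (sSup {l : ℕ | crwClock M t p l ≤ s'}) ≠ 0 := by
        change j ≠ 0
        omega
      have hbdd : BddAbove {l : ℕ | crwClock M t p l ≤ s'} := by
        by_contra hb
        exact hne (Nat.sSup_of_not_bddAbove hb)
      have hnonempty : {l : ℕ | crwClock M t p l ≤ s'}.Nonempty := by
        refine ⟨0, ?_⟩
        simp [crwClock]
      exact Nat.sSup_mem hnonempty hbdd
    have hfin : ∀ l ≤ j, crwClock M t p l ≠ ⊤ := fun l hl =>
      (((crwClock_mono hl).trans hmem).trans_lt ENNReal.coe_lt_top).ne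
    obtain ⟨j', hj'⟩ := Nat.exists_eq_succ_of_ne_zero hpos.ne'
    have hAtr : A ⊆ trace M t p (crwClock M t p j').toNNReal := by
      rintro a ⟨l, hl, rfl⟩
      refine ⟨(crwClock M t p l).toNNReal, ?_, (crw M t p (crwClock M t p l).toNNReal).2,
        Prod.ext ?_ rfl⟩
      · rw [ENNReal.coe_toNNReal (hfin l hl.le), ENNReal.coe_toNNReal (hfin j' (by omega))]
        exact crwClock_mono (by omega)
      · change (crwChain M t p (crwJumps M t p _)).1 = _
        rw [crwJumps_crwClock ht hM hp (hfin l hl.le)]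
    have hle : hitTime M t p k ≤ ((crwClock M t p j').toNNReal : ℝ≥0∞) :=
      iInf₂_le (crwClock M t p j').toNNReal (hAk.trans (Set.ncard_le_ncard hAtr (Set.toFinite _)))
    rw [ENNReal.coe_toNNReal (hfin j' (by omega))] at hle
    have h1 := crwClock_lt_succ ht hM hp (hfin j' (by omega))
    rw [← Nat.succ_eq_add_one, ← hj'] at h1
    exact absurd (hs'.trans hle) (not_le.2 (h1.trans_le hmem))

/-- The number of vertices of `L` seen by the cyclic random walk is carried over to the
discretised walk. -/
lemma discretise_mem_lineEvent [NeZero m] (ht : 0 < t) (hM : Separated M t m) {i : ZMod m}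
    {p : Vertex n × ℝ} (hp : Represents M t i v p 0) {k : ℕ} (hk : 1 ≤ k) {J : ℕ} (hJ : 1 ≤ J)
    {L : Finset (Vertex n)} (h : J ≤ (Z M t p k ∩ L).ncard) :
    discretise M t m ∈ LineEvent L i v k J := by
  classical
  have hex : ∀ a ∈ Z M t p k ∩ L, ∃ s, walk (discretise M t m) i v s = some a ∧
      (visited (discretise M t m) i v s).card < k := fun a ha =>
    exists_walk_of_mem_Z ht hM hp hk ha.1
  choose! q hq hqk using hex
  have hfin : (Z M t p k ∩ L).Finite := Set.toFinite _
  have hne : (Z M t p k ∩ (L : Set (Vertex n))).Nonempty := by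
    rw [← Set.ncard_pos hfin]; omega
  obtain ⟨a₀, ha₀, hmax⟩ := hfin.exists_maximalFor q _ hne
  have hmax' : ∀ a ∈ Z M t p k ∩ L, q a ≤ q a₀ := fun a ha => by
    rcases le_total (q a) (q a₀) with h | h
    · exact h
    · exact hmax ha h
  refine ⟨q a₀, h.trans ?_, hqk a₀ ha₀⟩
  rw [← Set.ncard_coe_finset]
  refine Set.ncard_le_ncard (fun a ha => ?_) (Finset.finite_toSet _)
  rw [Finset.mem_coe, Finset.mem_inter]
  exact ⟨mem_visited.2 ⟨q a, Nat.lt_succ_of_le (hmax' a ha), hq a ha⟩, ha.2⟩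

/-- The starting point is represented if its cell contains no bridge. -/
lemma represents_start (hM : Separated M t m) {z : ℝ} (hz : z ∈ Set.Icc 0 t)
    (hclean : ∀ b ∈ M, b.2 ∉ slab t m (tick t m z : ZMod m)) :
    Represents M t ((tick t m z : ZMod m) + 1) v (v, z) 0 where
  walk_eq := rfl
  cell := by simp
  le := hz.2
  clean c y hb hy := by
    have := hb.mem_slab hM
    rw [hy] at this
    obtain ⟨b, hb, -, rfl⟩ := hb
    exact absurd this (hclean b hb.1)

end Cyclic

section Upwards

lemma finite_bridges (ht : 0 < t) (hM : Separated M t m) : (bridges M t).Finite := by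
  refine Set.Finite.of_finite_image (f := fun b => tick t m b.2)
    ((Set.finite_Iic m).subset ?_) ?_
  · rintro _ ⟨b, hb, rfl⟩
    exact tick_le ht hb.2.2
  · intro b hb b' hb' h
    have hpos : ∀ b ∈ bridges M t, 0 < b.2 := fun b hb => by
      rcases hb.2.1.lt_or_eq with h | h
      · exact h
      · have := hb.1
        rw [show b = (b.1, (0 : ℝ)) from Prod.ext rfl h.symm] at this
        exact absurd this (hM.zero _)
    refine hM.single (tick t m b.2 : ZMod m) b hb.1 b' hb'.1 ⟨hpos b hb, hb.2.2, rfl⟩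
      ⟨hpos b' hb', hb'.2.2, ?_⟩
    simp only at h
    rw [h]

lemma tick_lt_of_lt [NeZero m] (ht : 0 < t) (hM : Separated M t m) {p : Vertex n × ℝ}
    (hp : p.2 = 0 ∨ ∃ c, IsBridge M t p.1 c p.2) (hb : IsBridge M t a c y) (h : p.2 < y) :
    tick t m p.2 < tick t m y := by
  rcases (tick_mono (m := m) ht h.le).lt_or_eq with h1 | h1
  · exact h1
  · exfalso
    rcases hp with hp | ⟨c', hp⟩
    · rw [hp, tick_zero] at h1
      exact absurd (tick_pos (Nat.pos_of_ne_zero (NeZero.ne m)) ht (hb.pos hM)) (by omega)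
    · exact h.ne' (hp.eq_of_tick hM hb (by rw [h1])).2

lemma natCast_tick_inj [NeZero m] {d : ℕ} (hd : 0 < d) (hdm : d ≤ m) (ht : 0 < t)
    (hy : 0 < y) (hyt : y ≤ t) (h : (tick t m y : ZMod m) = d) : tick t m y = d := by
  have h1 := tick_pos (Nat.pos_of_ne_zero (NeZero.ne m)) ht hy
  have h2 := tick_le (m := m) ht hyt
  rw [ZMod.natCast_eq_natCast_iff, Nat.modEq_iff_dvd] at h
  have h3 := Int.eq_zero_of_abs_lt_dvd h (by rw [abs_lt]; constructor <;> omega)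
  omega

/-- Following bars and bridges upwards up to height `t` takes the discretised walk `m` ticks. -/
lemma walk_sigma [NeZero m] (ht : 0 < t) (hM : Separated M t m) (v : Vertex n) :
    walk (discretise M t m) 1 v m = some (sigma M t v) := by
  classical
  set u : ℕ → Vertex n × ℝ := fun j => (upStep M t)^[j] (v, 0) with hu
  have husucc : ∀ j, u (j + 1) = upStep M t (u j) := fun j => Function.iterate_succ_apply' _ _ _
  have hnext : ∀ p, (∃ q, IsNextUp M t p q) → IsNextUp M t p (upStep M t p) := fun p h => by
    rw [upStep, dif_pos h]; exact h.choose_spec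
  have hwait : ∀ (p : Vertex n × ℝ) (D : ℕ),
      walk (discretise M t m) 1 v (tick t m p.2) = some p.1 → tick t m p.2 + D ≤ m →
      (∀ c y, IsBridge M t p.1 c y → tick t m p.2 < tick t m y →
        tick t m p.2 + D < tick t m y) →
      walk (discretise M t m) 1 v (tick t m p.2 + D) = some p.1 := by
    intro p D hp hD h
    refine walk_wait hp (D := D) (fun d hd c hop => ?_) D le_rfl
    obtain ⟨y, hy, hb⟩ := op_discretise.1 hop
    have h1 : tick t m y = 1 + tick t m p.2 + d := by
      refine natCast_tick_inj (by omega) (by omega) ht hy.1 hy.2.1 ?_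
      rw [hy.2.2]; push_cast; ring
    have := h c y hb (by omega)
    omega
  have hinv : ∀ j, walk (discretise M t m) 1 v (tick t m (u j).2) = some (u j).1 ∧
      ((u j).2 = 0 ∨ ∃ c, IsBridge M t (u j).1 c (u j).2) ∧ (u j).2 ≤ t := by
    intro j
    induction j with
    | zero => exact ⟨by simp [hu, tick_zero, walk], Or.inl rfl, ht.le⟩
    | succ j ih =>
      obtain ⟨h1, h2, h3⟩ := ih
      rw [husucc]
      by_cases h : ∃ q, IsNextUp M t (u j) q
      · obtain ⟨hb, hlt, hmin⟩ := hnext _ h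
        set q := upStep M t (u j)
        have htick := tick_lt_of_lt ht hM h2 hb hlt
        refine ⟨?_, Or.inr ⟨(u j).1, ?_⟩, hb.le⟩
        · have hw := hwait (u j) (tick t m q.2 - tick t m (u j).2 - 1) h1
            (by have := tick_le (m := m) ht hb.le; omega)
            (fun c y hby hy => by
              have := tick_mono (m := m) ht (hmin c y hby (lt_of_tick_lt ht hy))
              omega)
          have := walk_succ_of_step hw (b := q.1) (by
            have e : (1 : ZMod m) + ((tick t m (u j).2 + (tick t m q.2 - tick t m (u j).2 - 1) : ℕ)
                : ZMod m) = (tick t m q.2 : ZMod m) := by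
              rw [← Nat.cast_one, ← Nat.cast_add]
              congr 1
              omega
            rw [e]
            exact hb.stepRel hM)
          rw [← this]
          congr 1
          omega
        · obtain ⟨b, hb1, hb2, hb3⟩ := hb
          exact ⟨b, hb1, by rw [hb2, Sym2.eq_swap], hb3⟩
      · rw [upStep, dif_neg h]
        exact ⟨h1, h2, h3⟩
  have hfin := finite_bridges ht hM
  -- each step uses up one of the bridges above
  have hcount : ∀ j, (¬ ∃ q, IsNextUp M t (u j) q) ∨
      {b ∈ bridges M t | (u j).2 < b.2}.ncard + j ≤ (bridges M t).ncard := by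
    intro j
    induction j with
    | zero => exact Or.inr (Set.ncard_le_ncard (fun b hb => hb.1) hfin)
    | succ j ih =>
      by_cases h : ∃ q, IsNextUp M t (u j) q
      · right
        have ih' := ih.resolve_left (not_not.2 h)
        obtain ⟨⟨b, hb1, hb2, hb3⟩, hlt, -⟩ := hnext _ h
        rw [husucc]
        have : {b ∈ bridges M t | (upStep M t (u j)).2 < b.2}.ncard
            < {b ∈ bridges M t | (u j).2 < b.2}.ncard := by
          refine Set.ncard_lt_ncard ⟨fun b hb => ⟨hb.1, hlt.trans hb.2⟩, fun hsub => ?_⟩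
            (hfin.subset fun b hb => hb.1)
          have := hsub (show b ∈ {b ∈ bridges M t | (u j).2 < b.2} from ⟨hb1, hb3 ▸ hlt⟩)
          exact absurd this.2 (by rw [hb3]; exact lt_irrefl _)
        omega
      · left
        rw [husucc, upStep, dif_neg h]
        exact h
  set N := (bridges M t).ncard with hN
  have hend : ¬ ∃ q, IsNextUp M t (u N) q := by
    rcases hcount N with h | h
    · exact h
    · rintro ⟨q, ⟨b, hb1, -, hb3⟩, hlt, -⟩
      have h0 : {b ∈ bridges M t | (u N).2 < b.2}.ncard = 0 := by omega
      rw [Set.ncard_eq_zero (hfin.subset fun b hb => hb.1)] at h0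
      have : b ∈ {b ∈ bridges M t | (u N).2 < b.2} := ⟨hb1, hb3 ▸ hlt⟩
      rw [h0] at this
      exact this
  obtain ⟨h1, -, h3⟩ := hinv N
  have hle := tick_le (m := m) ht h3
  have hno : ∀ c y, IsBridge M t (u N).1 c y → ¬ (u N).2 < y := by
    intro c y hb hlt
    -- among the finitely many bridges above there is a lowest one
    have hfin' : {b ∈ bridges M t | (u N).1 ∈ b.1.1 ∧ (u N).2 < b.2}.Finite :=
      hfin.subset fun b hb => hb.1
    obtain ⟨b₀, hb₀, he₀, hy₀⟩ := hb
    obtain ⟨b, hb, hmin⟩ := hfin'.exists_minimalFor (fun b => b.2) _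
      ⟨b₀, hb₀, by rw [he₀]; simp, hy₀ ▸ hlt⟩
    obtain ⟨w, hw⟩ := Sym2.mem_iff_exists.1 hb.2.1
    refine hend ⟨(w, b.2), ⟨b, hb.1, hw, rfl⟩, hb.2.2, fun w' y' hb' hy' => ?_⟩
    obtain ⟨b', hb1, hb2, rfl⟩ := hb'
    rcases le_total b.2 b'.2 with h | h
    · exact h
    · exact hmin ⟨hb1, by rw [hb2]; simp, hy'⟩ h
  have := hwait (u N) (m - tick t m (u N).2) h1 (by omega) fun c y hb hlt =>
    absurd (lt_of_tick_lt ht hlt) (hno c y hb)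
  rw [Nat.add_sub_cancel' hle] at this
  exact this

lemma walk_iterate_sigma [NeZero m] (ht : 0 < t) (hM : Separated M t m) (v : Vertex n) (l : ℕ) :
    walk (discretise M t m) 1 v (l * m) = some ((sigma M t)^[l] v) := by
  induction l with
  | zero => simp [walk]
  | succ l ih =>
    rw [Nat.succ_mul, walk_add ih, Function.iterate_succ_apply', ← walk_sigma ht hM]
    congr 1
    simp

end Upwards

end Discretisation

/-! ### Poisson counts and the law of the discretised configuration -/

section Poisson

variable {Ω S : Type*} [MeasurableSpace Ω] [MeasurableSpace S] {P : Measure Ω}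
  {Λ : Measure S} {N : Ω → Set S}

lemma IsPoissonPointProcess.real_count (hN : IsPoissonPointProcess P Λ N) {B : Set S}
    (hB : MeasurableSet B) {r : ℝ} (hΛ : Λ B = ENNReal.ofReal r) (A : Set ℕ∞) :
    P.real {ω | (N ω ∩ B).encard ∈ A}
      = (poissonMeasure r.toNNReal).real ((fun j : ℕ => (j : ℕ∞)) ⁻¹' A) := by
  have h := hN.law_count B hB (by rw [hΛ]; exact ENNReal.ofReal_ne_top)
  have hr' : (Λ B).toNNReal = r.toNNReal := by
    rw [hΛ]
    exact ENNReal.toNNReal_coe _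
  rw [hr'] at h
  have e1 := Measure.map_apply (μ := P) (hN.measurable_count B hB)
    (MeasurableSet.of_discrete (s := A))
  rw [h, Measure.map_apply (measurable_of_countable _) MeasurableSet.of_discrete] at e1
  rw [measureReal_def, measureReal_def, e1]
  rfl

lemma IsPoissonPointProcess.real_count_zero (hN : IsPoissonPointProcess P Λ N) {B : Set S}
    (hB : MeasurableSet B) {r : ℝ} (hr : 0 ≤ r) (hΛ : Λ B = ENNReal.ofReal r) :
    P.real {ω | (N ω ∩ B).encard ∈ ({0} : Set ℕ∞)} = Real.exp (-r) := by
  rw [hN.real_count hB hΛ]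
  have : (fun j : ℕ => (j : ℕ∞)) ⁻¹' {0} = {0} := by ext j; simp
  rw [this, poissonMeasure_real_singleton]
  simp [hr]

lemma IsPoissonPointProcess.real_count_ne_zero (hN : IsPoissonPointProcess P Λ N) {B : Set S}
    (hB : MeasurableSet B) {r : ℝ} (hr : 0 ≤ r) (hΛ : Λ B = ENNReal.ofReal r) :
    P.real {ω | (N ω ∩ B).encard ∈ ({0}ᶜ : Set ℕ∞)} = 1 - Real.exp (-r) := by
  rw [hN.real_count hB hΛ]
  have : (fun j : ℕ => (j : ℕ∞)) ⁻¹' {0}ᶜ = {0}ᶜ := by ext j; simp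
  rw [this, probReal_compl_eq_one_sub (by measurability), poissonMeasure_real_singleton]
  simp [hr]

/-- Two points in a set of intensity `r` have probability at most `r²`. -/
lemma IsPoissonPointProcess.real_two_le_count (hN : IsPoissonPointProcess P Λ N) {B : Set S}
    (hB : MeasurableSet B) {r : ℝ} (hr : 0 ≤ r) (hΛ : Λ B = ENNReal.ofReal r) :
    P.real {ω | 2 ≤ (N ω ∩ B).encard} ≤ r ^ 2 := by
  have h := hN.real_count hB hΛ {j | 2 ≤ j}
  change P.real {ω | 2 ≤ (N ω ∩ B).encard} = _ at h
  rw [h]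
  have : (fun j : ℕ => (j : ℕ∞)) ⁻¹' {j | 2 ≤ j} = ({0} ∪ {1})ᶜ := by
    ext j
    simp only [Set.mem_preimage, Set.mem_ofPred_eq, Set.mem_compl_iff, Set.mem_union,
      Set.mem_singleton_iff]
    rw [show (2 : ℕ∞) = ((2 : ℕ) : ℕ∞) from rfl, Nat.cast_le]
    omega
  rw [this, probReal_compl_eq_one_sub (by measurability), measureReal_union (by simp) (by simp),
    poissonMeasure_real_singleton, poissonMeasure_real_singleton]
  simp only [Real.coe_toNNReal r hr, pow_zero, Nat.factorial, pow_one]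
  have h1 : 1 - r ≤ Real.exp (-r) := by linarith [Real.add_one_le_exp (-r)]
  norm_num
  nlinarith

end Poisson

section Transfer

variable {n m : ℕ} {t : ℝ}

lemma card_edge_pos (hn : 2 ≤ n) : 0 < Nat.card (Edge n) := by
  rw [Nat.card_eq_fintype_card, card_edge]
  have : 0 < n - 1 := by omega
  positivity

lemma bridgeIntensity_Ioc (hn : 2 ≤ n) {x l : ℝ} (hx : 0 ≤ x) :
    bridgeIntensity n (Set.univ ×ˢ Set.Ioc x (x + l)) = ENNReal.ofReal l := by
  have hsub : Set.Ioc x (x + l) ⊆ Set.Ici 0 := fun y hy => hx.trans hy.1.le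
  rw [bridgeIntensity, Measure.prod_prod, Measure.smul_apply, smul_eq_mul, Measure.count_univ,
    Measure.restrict_apply measurableSet_Ioc,
    Set.inter_eq_self_of_subset_left hsub, Real.volume_Ioc,
    ENat.card_eq_coe_natCard, add_sub_cancel_left]
  rw [ENat.toENNReal_coe, ENNReal.inv_mul_cancel, one_mul]
  · exact_mod_cast (card_edge_pos hn).ne'
  · exact ENNReal.natCast_ne_top _

lemma bridgeIntensity_singleton (hn : 2 ≤ n) (e : Edge n) {x l : ℝ} (hx : 0 ≤ x) :
    bridgeIntensity n ({e} ×ˢ Set.Ioc x (x + l))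
      = ENNReal.ofReal (l / ((n : ℝ) ^ 2 * ((n : ℝ) - 1))) := by
  have hsub : Set.Ioc x (x + l) ⊆ Set.Ici 0 := fun y hy => hx.trans hy.1.le
  rw [bridgeIntensity, Measure.prod_prod, Measure.smul_apply, smul_eq_mul, Measure.count_singleton,
    Measure.restrict_apply measurableSet_Ioc,
    Set.inter_eq_self_of_subset_left hsub, Real.volume_Ioc,
    add_sub_cancel_left, mul_one, div_eq_inv_mul, ENNReal.ofReal_mul (by
      have : (2 : ℝ) ≤ n := by exact_mod_cast hn
      have : (0 : ℝ) ≤ n - 1 := by linarith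
      positivity)]
  congr 1
  have hc : (Nat.card (Edge n) : ℝ) = (n : ℝ) ^ 2 * ((n : ℝ) - 1) := by
    rw [Nat.card_eq_fintype_card, card_edge]
    push_cast [Nat.cast_sub (show 1 ≤ n by omega)]
    ring
  rw [← hc, ENNReal.ofReal_inv_of_pos (by exact_mod_cast card_edge_pos hn), ENNReal.ofReal_natCast]

lemma bridgeIntensity_zero : bridgeIntensity n (Set.univ ×ˢ {0}) = ENNReal.ofReal 0 := by
  rw [bridgeIntensity, Measure.prod_prod, Measure.restrict_apply (measurableSet_singleton 0),
    measure_mono_null Set.inter_subset_left Real.volume_singleton]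
  simp

/-- The probability that a given edge carries a bridge in a given cell. -/
noncomputable def siteProb (n : ℕ) (t : ℝ) (m : ℕ) : ℝ :=
  1 - Real.exp (-(t / m / ((n : ℝ) ^ 2 * ((n : ℝ) - 1))))

lemma siteProb_nonneg (hn : 2 ≤ n) (ht : 0 < t) : 0 ≤ siteProb n t m := by
  rw [siteProb, sub_nonneg, Real.exp_le_one_iff, neg_nonpos]
  have : (2 : ℝ) ≤ n := by exact_mod_cast hn
  have : (0 : ℝ) ≤ n - 1 := by linarith
  positivity

lemma siteProb_le_one : siteProb n t m ≤ 1 := by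
  rw [siteProb]
  linarith [Real.exp_pos (-(t / m / ((n : ℝ) ^ 2 * ((n : ℝ) - 1))))]

lemma discretise_eq_true_iff {M : Set (Edge n × ℝ)} {b : Edge n × ZMod m} :
    discretise M t m b = true ↔ (M ∩ {b.1} ×ˢ slab t m b.2).encard ∈ ({0}ᶜ : Set ℕ∞) := by
  rw [Set.mem_compl_singleton_iff, Set.encard_ne_zero]
  simp only [discretise, decide_eq_true_eq]
  constructor
  · rintro ⟨y, hy, h⟩
    exact ⟨(b.1, y), h, rfl, hy⟩
  · rintro ⟨⟨e, y⟩, h, he, hy⟩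
    rw [Set.mem_singleton_iff] at he
    exact ⟨y, hy, by simpa [← he] using h⟩

variable {Ω : Type*} [MeasurableSpace Ω] {P : Measure Ω} {N : Ω → Set (Edge n × ℝ)}

/-- A window of length `l` contains two bridges with probability at most `l²`. -/
lemma real_two_le_window (hn : 2 ≤ n) (hN : IsPoissonPointProcess P (bridgeIntensity n) N)
    {x l : ℝ} (hx : 0 ≤ x) (hl : 0 ≤ l) :
    P.real {ω | 2 ≤ (N ω ∩ Set.univ ×ˢ Set.Ioc x (x + l)).encard} ≤ l ^ 2 :=
  hN.real_two_le_count (MeasurableSet.univ.prod measurableSet_Ioc) hl (bridgeIntensity_Ioc hn hx)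

variable [NeZero m]

/-- The cells are half-open intervals of length `t / m`. -/
lemma exists_slab_eq_Ioc (ht : 0 < t) (i : ZMod m) :
    ∃ x : ℝ, 0 ≤ x ∧ slab t m i = Set.Ioc x (x + t / m) := by
  have hm : 0 < m := Nat.pos_of_ne_zero (NeZero.ne m)
  have hm' : (0 : ℝ) < m := by exact_mod_cast hm
  obtain ⟨d, hd, hdm, rfl⟩ : ∃ d : ℕ, 0 < d ∧ d ≤ m ∧ (d : ZMod m) = i := by
    rcases Nat.eq_zero_or_pos i.val with h | h
    · exact ⟨m, hm, le_rfl, by rw [ZMod.natCast_self]; exact ((ZMod.val_eq_zero i).1 h).symm⟩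
    · exact ⟨i.val, h, (ZMod.val_lt i).le, by simp⟩
  have hd' : (1 : ℝ) ≤ d := by exact_mod_cast hd
  have hdm' : (d : ℝ) ≤ m := by exact_mod_cast hdm
  refine ⟨((d : ℝ) - 1) * t / m, by
    have : 0 ≤ (d : ℝ) - 1 := by linarith
    positivity, ?_⟩
  ext y
  have key : ∀ y : ℝ, tick t m y = d ↔
      ((d : ℝ) - 1) * t / m < y ∧ y ≤ ((d : ℝ) - 1) * t / m + t / m := by
    intro y
    rw [tick, Nat.ceil_eq_iff hd.ne', Nat.cast_sub hd, Nat.cast_one]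
    have e : ((d : ℝ) - 1) * t / m + t / m = d * t / m := by ring
    rw [e, lt_div_iff₀ ht, div_le_iff₀ ht, div_lt_iff₀ hm', le_div_iff₀ hm']
  rw [Set.mem_Ioc, ← key]
  constructor
  · rintro ⟨h1, h2, h3⟩
    exact natCast_tick_inj hd hdm ht h1 h2 h3
  · intro h
    have h' := (key y).1 h
    refine ⟨?_, ?_, by rw [h]⟩
    · refine lt_of_le_of_lt ?_ h'.1
      have : 0 ≤ (d : ℝ) - 1 := by linarith
      positivity
    · refine h'.2.trans ?_
      rw [← add_div, div_le_iff₀ hm']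
      nlinarith

lemma measurableSet_slab (ht : 0 < t) (i : ZMod m) : MeasurableSet (slab t m i) := by
  obtain ⟨x, -, h⟩ := exists_slab_eq_Ioc ht i
  rw [h]
  exact measurableSet_Ioc

/-- The sites of the discretised configuration are independently open with probability
`siteProb`. -/
lemma real_discretise_eq (hn : 2 ≤ n) (ht : 0 < t)
    (hN : IsPoissonPointProcess P (bridgeIntensity n) N) (ξ : Edge n × ZMod m → Bool) :
    P.real {ω | discretise (N ω) t m = ξ} = bernWeight (siteProb n t m) ξ := by
  classical
  set B : Edge n × ZMod m → Set (Edge n × ℝ) := fun b => {b.1} ×ˢ slab t m b.2 with hB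
  set φ := Fintype.equivFin (Edge n × ZMod m) with hφ
  set A : Edge n × ZMod m → Set ℕ∞ := fun b => if ξ b then {0}ᶜ else {0} with hA
  have hBm : ∀ b, MeasurableSet (B b) := fun b =>
    (measurableSet_singleton b.1).prod (measurableSet_slab ht b.2)
  have hind := hN.indep_count _ (fun j => B (φ.symm j)) (fun j => hBm _) (by
    intro i j hij
    rw [Set.disjoint_left]
    rintro ⟨e, y⟩ h h'
    refine hij (φ.symm.injective (Prod.ext ?_ ?_))
    · exact h.1.symm.trans h'.1
    · exact h.2.2.2.symm.trans h'.2.2.2)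
  have h := hind.measure_inter_preimage_eq_mul Finset.univ (sets := fun j => A (φ.symm j))
    (fun _ _ => MeasurableSet.of_discrete)
  have hset : {ω | discretise (N ω) t m = ξ} =
      ⋂ j ∈ Finset.univ, (fun ω => (N ω ∩ B (φ.symm j)).encard) ⁻¹' A (φ.symm j) := by
    ext ω
    simp only [Set.mem_ofPred_eq, Finset.mem_univ, Set.iInter_true, Set.mem_iInter,
      Set.mem_preimage]
    rw [funext_iff, φ.symm.forall_congr_left]
    refine forall_congr' fun j => ?_
    simp only [Equiv.symm_symm, Equiv.symm_apply_apply]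
    rw [Bool.eq_iff_iff, discretise_eq_true_iff]
    by_cases hj : ξ j = true
    · simp [hA, hj, hB]
    · simp [hA, hj, hB]
  have hlen : 0 ≤ t / m / ((n : ℝ) ^ 2 * ((n : ℝ) - 1)) := by
    have : (2 : ℝ) ≤ n := by exact_mod_cast hn
    have : (0 : ℝ) ≤ n - 1 := by linarith
    positivity
  have hΛ : ∀ b, bridgeIntensity n (B b)
      = ENNReal.ofReal (t / m / ((n : ℝ) ^ 2 * ((n : ℝ) - 1))) := fun b => by
    obtain ⟨x, hx, hs⟩ := exists_slab_eq_Ioc (m := m) ht b.2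
    simp only [hB, hs]
    exact bridgeIntensity_singleton hn b.1 hx
  have hterm : ∀ b, P.real ((fun ω => (N ω ∩ B b).encard) ⁻¹' A b)
      = if ξ b then siteProb n t m else 1 - siteProb n t m := by
    intro b
    by_cases hb : ξ b = true
    · simp only [hA, hb, if_true]
      exact hN.real_count_ne_zero (hBm b) hlen (hΛ b)
    · simp only [hA, hb, Bool.false_eq_true, if_false]
      refine (hN.real_count_zero (hBm b) hlen (hΛ b)).trans ?_
      rw [siteProb]; ring
  rw [measureReal_def, hset, h, ENNReal.toReal_prod, bernWeight,
    ← Equiv.prod_comp φ.symm]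
  exact Finset.prod_congr rfl fun j _ => hterm _

lemma real_discretise_mem_le [IsProbabilityMeasure P] (hn : 2 ≤ n) (ht : 0 < t)
    (hN : IsPoissonPointProcess P (bridgeIntensity n) N) (D : Set (Edge n × ZMod m → Bool)) :
    P.real {ω | discretise (N ω) t m ∈ D} ≤ bernP (siteProb n t m) D := by
  classical
  have hset : {ω | discretise (N ω) t m ∈ D}
      = ⋃ ξ ∈ Finset.univ.filter (· ∈ D), {ω | discretise (N ω) t m = ξ} := by
    ext ω; simp
  rw [hset]
  refine (measureReal_biUnion_finset_le _ _).trans (le_of_eq ?_)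
  rw [bernP, bernE, Finset.sum_filter]
  refine Finset.sum_congr rfl fun ξ _ => ?_
  by_cases h : ξ ∈ D
  · rw [if_pos h, Set.indicator_of_mem h, real_discretise_eq hn ht hN, Pi.one_apply, mul_one]
  · rw [if_neg h, Set.indicator_of_notMem h, mul_zero]

/-- An event that forces the discretised configuration into `D`, apart from exceptional
configurations, has at most the probability of `D` up to an error which vanishes as the cells
shrink. -/
lemma real_le_bernP_add [IsProbabilityMeasure P] (hn : 2 ≤ n) (ht : 0 < t)
    (hN : IsPoissonPointProcess P (bridgeIntensity n) N) (z : ℝ) (E : Set Ω)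
    (D : Set (Edge n × ZMod m → Bool))
    (h : ∀ ω ∈ E, Separated (N ω) t m → (∀ b ∈ N ω, b.2 ∉ slab t m (tick t m z : ZMod m)) →
      discretise (N ω) t m ∈ D) :
    P.real E ≤ bernP (siteProb n t m) D + (t ^ 2 / m + t / m) := by
  classical
  have hm' : (0 : ℝ) < m := by exact_mod_cast Nat.pos_of_ne_zero (NeZero.ne m)
  have hsub : E ⊆ {ω | discretise (N ω) t m ∈ D} ∪
      ((⋃ i ∈ (Finset.univ : Finset (ZMod m)), {ω | 2 ≤ (N ω ∩ Set.univ ×ˢ slab t m i).encard}) ∪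
      ({ω | (N ω ∩ Set.univ ×ˢ slab t m (tick t m z : ZMod m)).encard ∈ ({0}ᶜ : Set ℕ∞)} ∪
        {ω | (N ω ∩ Set.univ ×ˢ {0}).encard ∈ ({0}ᶜ : Set ℕ∞)})) := by
    intro ω hω
    by_contra hne
    simp only [Set.mem_union, not_or, Set.mem_iUnion, not_exists, Set.mem_ofPred_eq,
      Set.mem_compl_iff, Set.mem_singleton_iff, not_not, Finset.mem_univ, true_implies] at hne
    obtain ⟨h1, h2, h3, h4⟩ := hne
    rw [Set.encard_eq_zero, Set.eq_empty_iff_forall_notMem] at h3 h4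
    refine h1 (h ω hω ⟨fun e he => h4 (e, 0) ⟨he, trivial, rfl⟩, fun i b hb b' hb' hs hs' => ?_⟩
      fun b hb hs => h3 b ⟨hb, trivial, hs⟩)
    by_contra hbb
    refine h2 i ?_
    rw [← Set.encard_pair hbb]
    refine Set.encard_le_encard ?_
    rintro x (rfl | rfl)
    · exact ⟨hb, trivial, hs⟩
    · exact ⟨hb', trivial, hs'⟩
  have e1 : P.real (⋃ i ∈ (Finset.univ : Finset (ZMod m)),
      {ω | 2 ≤ (N ω ∩ Set.univ ×ˢ slab t m i).encard}) ≤ t ^ 2 / m := by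
    refine (measureReal_biUnion_finset_le _ _).trans ?_
    refine (Finset.sum_le_card_nsmul _ _ ((t / m) ^ 2) fun i _ => ?_).trans (le_of_eq ?_)
    · obtain ⟨x, hx, hs⟩ := exists_slab_eq_Ioc ht i
      rw [hs]
      exact real_two_le_window hn hN hx (by positivity)
    · rw [Finset.card_univ, ZMod.card, nsmul_eq_mul]
      field_simp
  have e2 : P.real {ω | (N ω ∩ Set.univ ×ˢ slab t m (tick t m z : ZMod m)).encard
      ∈ ({0}ᶜ : Set ℕ∞)} ≤ t / m := by
    obtain ⟨x, hx, hs⟩ := exists_slab_eq_Ioc ht (tick t m z : ZMod m)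
    rw [hs, hN.real_count_ne_zero (MeasurableSet.univ.prod measurableSet_Ioc)
      (by positivity : 0 ≤ t / m) (bridgeIntensity_Ioc hn hx)]
    linarith [Real.add_one_le_exp (-(t / m))]
  have e3 : P.real {ω | (N ω ∩ Set.univ ×ˢ {0}).encard ∈ ({0}ᶜ : Set ℕ∞)} = 0 := by
    rw [hN.real_count_ne_zero (MeasurableSet.univ.prod (measurableSet_singleton 0)) le_rfl
      bridgeIntensity_zero]
    simp
  have e0 := real_discretise_mem_le hn ht hN D
  refine (measureReal_mono hsub).trans ((measureReal_union_le _ _).trans ?_)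
  refine add_le_add e0 ((measureReal_union_le _ _).trans (add_le_add e1 ?_))
  refine (measureReal_union_le _ _).trans ?_
  rw [e3, add_zero]
  exact e2

end Transfer

/-! ### Passage to small cells -/

section Limit

open Topology

variable {n : ℕ} {t : ℝ}

lemma one_sub_siteProb_pow (hn : 2 ≤ n) {m : ℕ} (hm : 0 < m) (l : ℕ) :
    (1 - siteProb n t m) ^ (l * (n - 1) * m) = Real.exp (-(l * t / (n : ℝ) ^ 2)) := by
  rw [siteProb, sub_sub_cancel, ← Real.exp_nat_mul]
  congr 1
  have hn' : (2 : ℝ) ≤ n := by exact_mod_cast hn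
  have h1 : (n : ℝ) - 1 ≠ 0 := by linarith
  have h2 : (n : ℝ) ≠ 0 := by linarith
  have h3 : (m : ℝ) ≠ 0 := by exact_mod_cast hm.ne'
  push_cast [Nat.cast_sub (show 1 ≤ n by omega)]
  field_simp

/-- The limit of the escape probability as the cells shrink. -/
noncomputable def escapeLimit (n : ℕ) (t : ℝ) : ℝ :=
  t ^ 2 / (4 * (n : ℝ) ^ 2 * ((n : ℝ) - 1) ^ 2) * Real.exp (-4 * t / (n : ℝ) ^ 2)

lemma escapeLimit_nonneg : 0 ≤ escapeLimit n t := by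
  unfold escapeLimit; positivity

lemma escapeLimit_le_one (hn : 2 ≤ n) (ht : 0 < t) : escapeLimit n t ≤ 1 := by
  have hn' : (2 : ℝ) ≤ n := by exact_mod_cast hn
  set u := t / (n : ℝ) ^ 2 with hu
  have hu0 : 0 ≤ u := by positivity
  have h1 : t ^ 2 / (4 * (n : ℝ) ^ 2 * ((n : ℝ) - 1) ^ 2) ≤ u ^ 2 := by
    rw [hu, div_pow]
    refine div_le_div_of_nonneg_left (by positivity) (by positivity) ?_
    have : (n : ℝ) ^ 2 ≤ 4 * ((n : ℝ) - 1) ^ 2 := by nlinarith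
    nlinarith [sq_nonneg (n : ℝ)]
  have h2 : u ≤ Real.exp u := by linarith [Real.add_one_le_exp u]
  have h3 : u ^ 2 ≤ Real.exp u ^ 2 := pow_le_pow_left₀ hu0 h2 2
  have h4 : Real.exp (-4 * t / (n : ℝ) ^ 2) ≤ Real.exp (-(2 * u)) := by
    refine Real.exp_le_exp.2 ?_
    rw [show -4 * t / (n : ℝ) ^ 2 = -(4 * u) by rw [hu]; ring]
    linarith
  have h5 : Real.exp u ^ 2 = Real.exp (2 * u) := by
    rw [← Real.exp_nat_mul]; norm_num
  calc escapeLimit n t ≤ Real.exp (2 * u) * Real.exp (-(2 * u)) := by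
        unfold escapeLimit
        exact mul_le_mul (h1.trans (h3.trans h5.le)) h4 (Real.exp_pos _).le (Real.exp_pos _).le
    _ = 1 := by rw [← Real.exp_add]; simp

lemma tendsto_mul_siteProb (n : ℕ) (t : ℝ) :
    Tendsto (fun j : ℕ => (j : ℝ) * siteProb n t (j + 1)) atTop
      (𝓝 (t / ((n : ℝ) ^ 2 * ((n : ℝ) - 1)))) := by
  set x := t / ((n : ℝ) ^ 2 * ((n : ℝ) - 1)) with hx
  -- the difference quotients of the exponential function at `0`
  have hder : HasDerivAt (fun y : ℝ => 1 - Real.exp (-(x * y))) x 0 := by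
    have h1 : HasDerivAt (fun y : ℝ => -(x * y)) (-(x * 1)) 0 :=
      ((hasDerivAt_id (0 : ℝ)).const_mul x).neg
    have := (h1.exp).const_sub 1
    simpa using this
  have hsl := hder.tendsto_slope_zero
  have hinv : Tendsto (fun j : ℕ => (1 : ℝ) / ((j : ℝ) + 1)) atTop (𝓝[≠] 0) :=
    tendsto_nhdsWithin_iff.2 ⟨tendsto_one_div_add_atTop_nhds_zero_nat,
      Eventually.of_forall fun j => by
        have : (0 : ℝ) < 1 / ((j : ℝ) + 1) := by positivity
        exact this.ne'⟩
  have h2 := hsl.comp hinv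
  have h3 : Tendsto (fun j : ℕ => (j : ℝ) / ((j : ℝ) + 1)) atTop (𝓝 1) :=
    tendsto_natCast_div_add_atTop 1
  have h4 := h3.mul h2
  rw [one_mul] at h4
  refine h4.congr fun j => ?_
  have hj : (j : ℝ) + 1 ≠ 0 := by positivity
  simp only [Function.comp_apply, smul_eq_mul, zero_add, mul_zero, neg_zero, Real.exp_zero,
    sub_self, sub_zero, siteProb]
  have e : x * (1 / ((j : ℝ) + 1)) = t / ((j + 1 : ℕ) : ℝ) / ((n : ℝ) ^ 2 * ((n : ℝ) - 1)) := by
    rw [hx]; push_cast; ring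
  rw [e]
  field_simp

lemma tendsto_siteProb (n : ℕ) (t : ℝ) :
    Tendsto (fun j : ℕ => siteProb n t (j + 1)) atTop (𝓝 0) := by
  have h1 : Tendsto (fun j : ℕ => t * (1 / ((j : ℝ) + 1))) atTop (𝓝 (t * 0)) :=
    tendsto_one_div_add_atTop_nhds_zero_nat.const_mul t
  have h2 : Tendsto (fun j : ℕ => 1 - Real.exp (-(t * (1 / ((j : ℝ) + 1)) /
      ((n : ℝ) ^ 2 * ((n : ℝ) - 1))))) atTop
      (𝓝 (1 - Real.exp (-(t * 0 / ((n : ℝ) ^ 2 * ((n : ℝ) - 1)))))) :=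
    ((h1.div_const _).neg.rexp).const_sub 1
  simp only [mul_zero, zero_div, neg_zero, Real.exp_zero, sub_self] at h2
  refine h2.congr fun j => ?_
  rw [siteProb]
  push_cast
  rw [mul_one_div]

lemma tendsto_escapeProb (hn : 2 ≤ n) (t : ℝ) :
    Tendsto (fun j : ℕ => escapeProb n (j + 1) (siteProb n t (j + 1))) atTop
      (𝓝 (escapeLimit n t)) := by
  have h := (((tendsto_mul_siteProb n t).pow 2).const_mul (((n : ℝ) / 2) ^ 2)).mul_const
    (Real.exp (-(4 * t / (n : ℝ) ^ 2)))
  have hn' : (2 : ℝ) ≤ n := by exact_mod_cast hn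
  have h1 : (n : ℝ) - 1 ≠ 0 := by linarith
  have h2 : (n : ℝ) ≠ 0 := by linarith
  have e : ((n : ℝ) / 2) ^ 2 * (t / ((n : ℝ) ^ 2 * ((n : ℝ) - 1))) ^ 2
      * Real.exp (-(4 * t / (n : ℝ) ^ 2)) = escapeLimit n t := by
    rw [escapeLimit, show -4 * t / (n : ℝ) ^ 2 = -(4 * t / (n : ℝ) ^ 2) by ring]
    congr 1
    field_simp
    ring
  rw [e] at h
  refine h.congr fun j => ?_
  rw [escapeProb, one_sub_siteProb_pow hn (Nat.succ_pos j) 4]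
  push_cast
  ring

/-- A bound for the probability that two bridges share a cell or that the cell of the starting point
contains a bridge, when the height `t` is divided into `m` cells. -/
noncomputable def cellError (t : ℝ) (m : ℕ) : ℝ := t ^ 2 / m + t / m

lemma tendsto_cellError (t : ℝ) : Tendsto (fun j : ℕ => cellError t (j + 1)) atTop (𝓝 0) := by
  have h : Tendsto (fun j : ℕ => (t ^ 2 + t) * (1 / ((j : ℝ) + 1))) atTop
      (𝓝 ((t ^ 2 + t) * 0)) := tendsto_one_div_add_atTop_nhds_zero_nat.const_mul _
  rw [mul_zero] at h
  refine h.congr fun j => ?_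
  rw [cellError]
  push_cast
  ring

/-- The tail bound before the passage to the limit, where `h` is the probability that the cyclic
random walk sees `k` vertices. -/
noncomputable def discreteTail (n k : ℕ) (t h : ℝ) (M m : ℕ) : ℝ :=
  max 0 (1 - escapeProb n m (siteProb n t m) *
    max 0 (h - cellError t m - freshError n k (siteProb n t m))) ^ (M - 1)

lemma tendsto_discreteTail (hn : 2 ≤ n) (k : ℕ) (t h : ℝ) (M : ℕ) :
    Tendsto (fun j : ℕ => discreteTail n k t h M (j + 1)) atTop
      (𝓝 (max 0 (1 - escapeLimit n t * max 0 (h - freshError n k 0)) ^ (M - 1))) := by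
  unfold discreteTail
  have h1 : Tendsto (fun j : ℕ => freshError n k (siteProb n t (j + 1))) atTop
      (𝓝 (freshError n k 0)) := by
    unfold freshError
    exact ((tendsto_siteProb n t).const_mul _).const_add _
  have h2 := (tendsto_const_nhds (x := h) (f := atTop)).sub (tendsto_cellError t)
  rw [sub_zero] at h2
  exact (((tendsto_const_nhds (x := (0 : ℝ))).max
    (((tendsto_escapeProb hn t).mul ((tendsto_const_nhds (x := (0 : ℝ))).max
      (h2.sub h1))).const_sub 1))).pow _

lemma freshError_zero_le (hn : 2 ≤ n) (ht : 0 < t) {k : ℕ} (hkn : (k : ℝ) ≤ n / 2) :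
    freshError n k 0 ≤ 10 * k / n * Real.exp (2 * t / (n : ℝ) ^ 2) := by
  have hn' : (2 : ℝ) ≤ n := by exact_mod_cast hn
  have hk0 : (0 : ℝ) ≤ k := Nat.cast_nonneg k
  have h1 : (1 : ℝ) / (n - 1) ≤ 2 / n := by
    rw [div_le_div_iff₀ (by linarith) (by linarith)]; linarith
  have h0 : (0 : ℝ) ≤ 1 / (n - 1) := by
    have : (0 : ℝ) ≤ n - 1 := by linarith
    positivity
  have h2 : (k : ℝ) / (n - 1) ≤ k * (2 / n) := by
    rw [div_eq_mul_one_div]; gcongr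
  have h3 : (k : ℝ) * (k / ((n : ℝ) - 1) ^ 2) ≤ 2 * k / n := by
    have e : (k : ℝ) / ((n : ℝ) - 1) ^ 2 = k * (1 / ((n : ℝ) - 1)) ^ 2 := by
      rw [div_eq_mul_one_div, div_pow, one_pow]
    rw [e]
    have h4 : (1 / ((n : ℝ) - 1)) ^ 2 ≤ (2 / n) ^ 2 := pow_le_pow_left₀ h0 h1 2
    calc (k : ℝ) * (k * (1 / ((n : ℝ) - 1)) ^ 2) ≤ k * (((n : ℝ) / 2) * (2 / (n : ℝ)) ^ 2) := by
          gcongr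
      _ = 2 * (k : ℝ) / n := by field_simp
  have h5 : freshError n k 0 ≤ 10 * k / n := by
    unfold freshError
    have e1 : (k : ℝ) * (2 / n) = 2 * k / n := by ring
    have e2 : 10 * (k : ℝ) / n = 5 * (2 * k / n) := by ring
    have e3 : 0 ≤ 2 * (k : ℝ) / n := by positivity
    rw [e1] at h2
    rw [e2]
    linarith
  refine h5.trans (le_mul_of_one_le_right (by positivity) ?_)
  exact Real.one_le_exp (by positivity)

/-- The base of the tail bound is nonnegative, even where the bound for the escape is vacuous. -/
lemma tailBase_nonneg (hn : 2 ≤ n) (ht : 0 < t) {h : ℝ} (hh : h ≤ 1) (k : ℕ) :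
    0 ≤ 1 - escapeLimit n t * (h - 10 * k / n * Real.exp (2 * t / (n : ℝ) ^ 2)) := by
  have h1 : 0 ≤ 10 * (k : ℝ) / n * Real.exp (2 * t / (n : ℝ) ^ 2) := by positivity
  have := mul_le_mul_of_nonneg_left
    (show h - 10 * k / n * Real.exp (2 * t / (n : ℝ) ^ 2) ≤ 1 by linarith)
    (escapeLimit_nonneg (n := n) (t := t))
  linarith [escapeLimit_le_one hn ht]

/-- The limit of `discreteTail` is at most the bound of the theorem; as its base is at most `1`, the
exponent `M - 1` may be lowered to `M / 2`. -/
lemma limitTail_le (hn : 2 ≤ n) (ht : 0 < t) {h : ℝ} (hh : h ≤ 1) {k : ℕ}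
    (hkn : (k : ℝ) ≤ n / 2) {M : ℕ} (hM : 1 ≤ M) :
    max 0 (1 - escapeLimit n t * max 0 (h - freshError n k 0)) ^ (M - 1)
      ≤ (1 - escapeLimit n t * (h - 10 * k / n * Real.exp (2 * t / (n : ℝ) ^ 2))) ^ (M / 2) := by
  have h0 := escapeLimit_nonneg (n := n) (t := t)
  have hle : max 0 (1 - escapeLimit n t * max 0 (h - freshError n k 0))
      ≤ 1 - escapeLimit n t * (h - 10 * k / n * Real.exp (2 * t / (n : ℝ) ^ 2)) := by
    refine max_le (tailBase_nonneg hn ht hh k) ?_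
    have : h - 10 * k / n * Real.exp (2 * t / (n : ℝ) ^ 2) ≤ max 0 (h - freshError n k 0) :=
      le_max_of_le_right (by linarith [freshError_zero_le hn ht hkn])
    linarith [mul_le_mul_of_nonneg_left this h0]
  have h1 : max 0 (1 - escapeLimit n t * max 0 (h - freshError n k 0)) ≤ 1 := by
    refine max_le zero_le_one ?_
    linarith [mul_nonneg h0 (le_max_left 0 (h - freshError n k 0))]
  exact (pow_le_pow_of_le_one (le_max_left _ _) h1 (by omega)).trans
    (pow_le_pow_left₀ (le_max_left _ _) hle _)

end Limit

section Tails

variable {Ω : Type*} [MeasurableSpace Ω] {P : Measure Ω} [IsProbabilityMeasure P]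
  {n : ℕ} {N : Ω → Set (Edge n × ℝ)} {t : ℝ}

lemma ncard_Z_zero_le {M : Set (Edge n × ℝ)} {p : Vertex n × ℝ} (A : Set (Vertex n)) :
    (Z M t p 0 ∩ A).ncard ≤ 1 := by
  have h0 : hitTime M t p 0 = 0 := by
    refine le_antisymm ?_ zero_le
    exact iInf₂_le (0 : ℝ≥0) (Nat.zero_le _)
  have hsub : Z M t p 0 ∩ A ⊆ {(crw M t p 0).1} := by
    rintro a ⟨⟨s, hs, z, hz⟩, -⟩
    rw [h0] at hs
    have : s = 0 := by simpa using hs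
    rw [this] at hz
    rw [Set.mem_singleton_iff, hz]
  exact (Set.ncard_le_ncard hsub (Set.finite_singleton _)).trans (Set.ncard_singleton _).le

lemma coe_rowFinset (b : Fin n) : (rowFinset b : Set (Vertex n)) = row b := by
  ext a; simp [rowFinset, row]

lemma coe_colFinset (b : Fin n) : (colFinset b : Set (Vertex n)) = column b := by
  ext a; simp [colFinset, column]

lemma real_hitTime_le (hn : 2 ≤ n) (hN : IsPoissonPointProcess P (bridgeIntensity n) N)
    (ht : 0 < t) (v : Vertex n) {z : ℝ} (hz : z ∈ Set.Icc 0 t) (k m : ℕ) [NeZero m] :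
    P.real {ω | hitTime (N ω) t (v, z) k < ⊤} - cellError t m
      ≤ bernP (siteProb n t m) (HitEvent ((tick t m z : ZMod m) + 1) v k) := by
  have := real_le_bernP_add hn ht hN z {ω | hitTime (N ω) t (v, z) k < ⊤}
    (HitEvent ((tick t m z : ZMod m) + 1) v k) fun ω hω hM hc =>
      discretise_mem_hitEvent ht hM (represents_start hM hz hc) hω
  unfold cellError
  linarith

lemma max_pow_le_discreteTail {m : ℕ} [NeZero m] (hn : 2 ≤ n) (ht : 0 < t) {h x : ℝ} {k : ℕ}
    (hx : h - cellError t m ≤ x) (M : ℕ) :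
    max 0 (1 - escapeProb n m (siteProb n t m) *
      max 0 (x - freshError n k (siteProb n t m))) ^ (M - 1) ≤ discreteTail n k t h M m := by
  have h0 : 0 ≤ escapeProb n m (siteProb n t m) := by
    have := siteProb_nonneg (m := m) hn ht
    have : 0 ≤ 1 - siteProb n t m := by linarith [siteProb_le_one (n := n) (t := t) (m := m)]
    unfold escapeProb
    positivity
  unfold discreteTail
  gcongr

/-- The tail of the number of vertices that the cyclic random walk visits in a row. -/
theorem real_le_ncard_Z_inter_row (hn : 2 ≤ n)
    (hN : IsPoissonPointProcess P (bridgeIntensity n) N) (ht : 0 < t) (v : Vertex n) {z : ℝ}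
    (hz : z ∈ Set.Icc 0 t) {k : ℕ} (M : ℕ) (hkn : (k : ℝ) ≤ n / 2) (b : Fin n) :
    P.real {ω | M ≤ (Z (N ω) t (v, z) k ∩ row b).ncard}
      ≤ (1 - escapeLimit n t * (P.real {ω | hitTime (N ω) t (v, z) k < ⊤}
          - 10 * k / n * Real.exp (2 * t / (n : ℝ) ^ 2))) ^ (M / 2) := by
  set h := P.real {ω | hitTime (N ω) t (v, z) k < ⊤} with hh
  have hh1 : h ≤ 1 := measureReal_le_one
  rcases Nat.lt_or_ge M 2 with hM | hM
  · rw [Nat.div_eq_of_lt hM, pow_zero]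
    exact measureReal_le_one
  rcases Nat.eq_zero_or_pos k with hk | hk
  · have : {ω | M ≤ (Z (N ω) t (v, z) k ∩ row b).ncard} = ∅ := by
      ext ω
      simp only [Set.mem_ofPred_eq, Set.mem_empty_iff_false, iff_false, not_le]
      rw [hk]
      exact (ncard_Z_zero_le _).trans_lt hM
    rw [this, measureReal_empty]
    exact pow_nonneg (tailBase_nonneg hn ht hh1 k) _
  refine le_trans ?_ (limitTail_le hn ht hh1 hkn (by omega))
  have hlim := (tendsto_discreteTail hn k t h M).add (tendsto_cellError t)
  rw [add_zero] at hlim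
  refine ge_of_tendsto' hlim fun j => ?_
  refine (real_le_bernP_add (m := j + 1) hn ht hN z _
    (LineEvent (rowFinset b) ((tick t (j + 1) z : ZMod (j + 1)) + 1) v k M)
    fun ω hω hM' hc => ?_).trans ?_
  · refine discretise_mem_lineEvent ht hM' (represents_start hM' hz hc) hk (by omega) ?_
    rw [coe_rowFinset]
    exact hω
  · refine add_le_add ?_ le_rfl
    refine (bernP_lineEvent_row_le hn (siteProb_nonneg hn ht) siteProb_le_one b _
      ((tick t (j + 1) z : ZMod (j + 1)) + 1) v v hkn M).trans ?_
    exact max_pow_le_discreteTail hn ht (real_hitTime_le hn hN ht v hz k (j + 1)) M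

lemma orb_subset_visited {M : Set (Edge n × ℝ)} {m : ℕ} [NeZero m] (ht : 0 < t)
    (hM : Separated M t m) (v : Vertex n) (k : ℕ) :
    orb M t k v ⊆ visited (discretise M t m) 1 v (k * m + 1) := by
  rintro a ⟨l, hl, rfl⟩
  exact mem_visited.2 ⟨l * m, Nat.lt_succ_of_le (Nat.mul_le_mul_right m hl),
    walk_iterate_sigma ht hM v l⟩

/-- If the walk sees at most `K` vertices up to time `s`, then it sees all of them by the time it
has seen `K` vertices. -/
lemma mem_lineEvent_of_card_visited_le {m : ℕ} {ω : Edge n × ZMod m → Bool} {i : ZMod m}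
    {v : Vertex n} {s K J : ℕ} {L : Finset (Vertex n)} (hK : (visited ω i v (s + 1)).card ≤ K)
    (hJ : J ≤ (visited ω i v (s + 1) ∩ L).card) : ω ∈ LineEvent L i v K J := by
  classical
  have hex : ∃ r, visited ω i v (s + 1) ⊆ visited ω i v (r + 1) := ⟨s, subset_rfl⟩
  set r := Nat.find hex with hr
  have hrs : r ≤ s := Nat.find_min' hex subset_rfl
  have hspec := Nat.find_spec hex
  refine ⟨r, hJ.trans (Finset.card_le_card (Finset.inter_subset_inter_right hspec)), ?_⟩
  refine lt_of_lt_of_le (Finset.card_lt_card ?_) hK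
  rw [Finset.ssubset_iff_subset_ne]
  refine ⟨visited_mono (by omega), fun heq => ?_⟩
  cases hr0 : r with
  | zero =>
    rw [hr0, visited_zero] at heq
    have : v ∈ visited ω i v (s + 1) := mem_visited.2 ⟨0, Nat.succ_pos s, rfl⟩
    rw [← heq] at this
    simp at this
  | succ r' =>
    refine Nat.find_min hex (m := r') (by omega) ?_
    rw [← heq, hr0]

lemma le_iota_iff {A : Set (Vertex n)} {M : ℕ} (hM : 1 ≤ M) :
    M ≤ iota A ↔ ∃ b, M ≤ (row b ∩ A).ncard ∨ M ≤ (column b ∩ A).ncard := by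
  have hM' : ⊥ < M := hM
  rw [iota, le_max_iff, Finset.le_sup_iff hM', Finset.le_sup_iff hM']
  simp [exists_or]

lemma iota_le_ncard (A : Set (Vertex n)) : iota A ≤ A.ncard := by
  rw [iota]
  refine max_le (Finset.sup_le fun b _ => ?_) (Finset.sup_le fun b _ => ?_) <;>
  exact Set.ncard_le_ncard Set.inter_subset_right (Set.toFinite _)

lemma ncard_orb_le (M : Set (Edge n × ℝ)) (k : ℕ) (v : Vertex n) :
    (orb M t k v).ncard ≤ k + 1 := by
  have : orb M t k v ⊆ ((Finset.range (k + 1)).image fun l => (sigma M t)^[l] v :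
      Finset (Vertex n)) := by
    rintro a ⟨l, hl, rfl⟩
    simp only [Finset.coe_image, Finset.coe_range]
    exact ⟨l, Nat.lt_succ_of_le hl, rfl⟩
  refine (Set.ncard_le_ncard this (Finset.finite_toSet _)).trans ?_
  rw [Set.ncard_coe_finset]
  exact Finset.card_image_le.trans (by simp)

/-- The tail of the isoperimetric constant of the cycles at a given time. Either the walk sees more
than `K` vertices in `k` periods, or some vertex and some line exhibit a walk with `M` vertices in
this line among its first `K`. -/
theorem real_exists_le_iota_orb (hn : 2 ≤ n)
    (hN : IsPoissonPointProcess P (bridgeIntensity n) N) (ht : 0 < t) (k M : ℕ) {K : ℕ}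
    (hK : K = ⌈2 * Real.exp (2 * t / (n : ℝ) ^ 2) * k⌉₊) (hKn : (K : ℝ) ≤ n / 2) :
    P.real {ω | ∃ v : Vertex n, M ≤ iota (orb (N ω) t k v)}
      ≤ (n : ℝ) ^ 4 * (1 - escapeLimit n t *
          (P.real {ω | hitTime (N ω) t (origin n hn, 0) K < ⊤}
            - 10 * K / n * Real.exp (2 * t / (n : ℝ) ^ 2))) ^ (M / 2)
        + (n : ℝ) ^ 2 * Real.exp (-(Real.exp (-2 * t / (n : ℝ) ^ 2) * k)) := by
  set h := P.real {ω | hitTime (N ω) t (origin n hn, 0) K < ⊤} with hh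
  have hh1 : h ≤ 1 := measureReal_le_one
  have hn' : (2 : ℝ) ≤ n := by exact_mod_cast hn
  have hbase := tailBase_nonneg hn ht hh1 K
  rcases Nat.lt_or_ge M 2 with hM | hM
  · rw [Nat.div_eq_of_lt hM, pow_zero, mul_one]
    have h1 : (1 : ℝ) ≤ (n : ℝ) ^ 4 := one_le_pow₀ (by linarith)
    have h2 : 0 ≤ (n : ℝ) ^ 2 * Real.exp (-(Real.exp (-2 * t / (n : ℝ) ^ 2) * k)) := by positivity
    exact measureReal_le_one.trans (by linarith)
  rcases Nat.eq_zero_or_pos k with hk | hk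
  · have : {ω | ∃ v : Vertex n, M ≤ iota (orb (N ω) t k v)} = ∅ := by
      ext ω
      simp only [Set.mem_ofPred_eq, Set.mem_empty_iff_false, iff_false, not_exists, not_le]
      intro v
      have := (iota_le_ncard (orb (N ω) t k v)).trans (ncard_orb_le (N ω) k v)
      omega
    rw [this, measureReal_empty]
    positivity
  refine le_trans ?_ (add_le_add (mul_le_mul_of_nonneg_left
    (limitTail_le hn ht hh1 hKn (show 1 ≤ M by omega)) (by positivity)) le_rfl)
  have hlim := (((tendsto_discreteTail hn K t h M).const_mul ((n : ℝ) ^ 4)).add_const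
    ((n : ℝ) ^ 2 * Real.exp (-(Real.exp (-2 * t / (n : ℝ) ^ 2) * k)))).add (tendsto_cellError t)
  rw [add_zero] at hlim
  refine ge_of_tendsto' hlim fun j => ?_
  set m := j + 1 with hm
  set p := siteProb n t m with hp
  have hp0 : 0 ≤ p := siteProb_nonneg hn ht
  have hp1 : p ≤ 1 := siteProb_le_one
  set D : Set (Edge n × ZMod m → Bool) :=
    (⋃ v ∈ (Finset.univ : Finset (Vertex n)), {ω | K + 1 ≤ (visited ω 1 v (k * m + 1)).card}) ∪
    ((⋃ q ∈ (Finset.univ : Finset (Vertex n × Fin n)), LineEvent (rowFinset q.2) 1 q.1 K M) ∪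
    (⋃ q ∈ (Finset.univ : Finset (Vertex n × Fin n)), LineEvent (colFinset q.2) 1 q.1 K M)) with hD
  refine (real_le_bernP_add (m := m) hn ht hN 0 _ D fun ω hω hM' hc => ?_).trans ?_
  · obtain ⟨v, hv⟩ := hω
    by_cases hcard : K + 1 ≤ (visited (discretise (N ω) t m) 1 v (k * m + 1)).card
    · exact Or.inl (Set.mem_biUnion (Finset.mem_univ v) hcard)
    · right
      have hcard' : (visited (discretise (N ω) t m) 1 v (k * m + 1)).card ≤ K := by omega
      have hsub := orb_subset_visited ht hM' v k
      obtain ⟨b, hb | hb⟩ := (le_iota_iff (by omega)).1 hv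
      · left
        refine Set.mem_biUnion (Finset.mem_univ (v, b)) (mem_lineEvent_of_card_visited_le hcard' ?_)
        refine hb.trans ?_
        rw [← Set.ncard_coe_finset, Finset.coe_inter, coe_rowFinset, Set.inter_comm]
        exact Set.ncard_le_ncard (Set.inter_subset_inter_left _ hsub) (Set.toFinite _)
      · right
        refine Set.mem_biUnion (Finset.mem_univ (v, b)) (mem_lineEvent_of_card_visited_le hcard' ?_)
        refine hb.trans ?_
        rw [← Set.ncard_coe_finset, Finset.coe_inter, coe_colFinset, Set.inter_comm]
        exact Set.ncard_le_ncard (Set.inter_subset_inter_left _ hsub) (Set.toFinite _)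
  · refine add_le_add ?_ le_rfl
    have hq : (1 - p) ^ (2 * (n - 1) * m) = Real.exp (-2 * t / (n : ℝ) ^ 2) := by
      rw [hp, one_sub_siteProb_pow hn (Nat.succ_pos j) 2]
      congr 1
      push_cast
      ring
    have hKq : 2 * (k : ℝ) ≤ (1 - p) ^ (2 * (n - 1) * m) * K := by
      rw [hq]
      have h1 : 2 * Real.exp (2 * t / (n : ℝ) ^ 2) * k ≤ K := by rw [hK]; exact Nat.le_ceil _
      have h2 : Real.exp (-2 * t / (n : ℝ) ^ 2) * Real.exp (2 * t / (n : ℝ) ^ 2) = 1 := by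
        rw [← Real.exp_add]
        ring_nf
        exact Real.exp_zero
      calc 2 * (k : ℝ) = Real.exp (-2 * t / (n : ℝ) ^ 2) *
            (2 * Real.exp (2 * t / (n : ℝ) ^ 2) * k) := by
            rw [show Real.exp (-2 * t / (n : ℝ) ^ 2) * (2 * Real.exp (2 * t / (n : ℝ) ^ 2) * k)
              = 2 * k * (Real.exp (-2 * t / (n : ℝ) ^ 2) * Real.exp (2 * t / (n : ℝ) ^ 2)) by ring,
              h2, mul_one]
        _ ≤ _ := by gcongr
    have h0t : (0 : ℝ) ∈ Set.Icc 0 t := ⟨le_rfl, ht.le⟩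
    have hx := real_hitTime_le hn hN ht (origin n hn) h0t K m
    have hcv : Fintype.card (Vertex n × Fin n) = n ^ 3 := by
      simp only [Fintype.card_prod, Fintype.card_fin]; ring
    have e1 : bernP p (⋃ v ∈ (Finset.univ : Finset (Vertex n)),
        {ω : Edge n × ZMod m → Bool | K + 1 ≤ (visited ω 1 v (k * m + 1)).card})
        ≤ (n : ℝ) ^ 2 * Real.exp (-(Real.exp (-2 * t / (n : ℝ) ^ 2) * k)) := by
      refine (bernP_biUnion_le hp0 hp1 _ _).trans ?_
      refine (Finset.sum_le_card_nsmul _ _ _ fun v _ => bernP_fast_le hp0 hp1 1 v hKq).trans ?_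
      rw [hq, Finset.card_univ, Fintype.card_prod, Fintype.card_fin, nsmul_eq_mul]
      push_cast
      rw [sq]
    have e2 : bernP p (⋃ q ∈ (Finset.univ : Finset (Vertex n × Fin n)),
        LineEvent (m := m) (rowFinset q.2) 1 q.1 K M) ≤ (n : ℝ) ^ 3 * discreteTail n K t h M m := by
      refine (bernP_biUnion_le hp0 hp1 _ _).trans ?_
      refine (Finset.sum_le_card_nsmul _ _ _ fun q _ =>
        (bernP_lineEvent_row_le hn hp0 hp1 q.2 1 _ q.1 (origin n hn) hKn M).trans
          (max_pow_le_discreteTail hn ht hx M)).trans ?_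
      rw [Finset.card_univ, hcv, nsmul_eq_mul]
      push_cast
      rfl
    have e3 : bernP p (⋃ q ∈ (Finset.univ : Finset (Vertex n × Fin n)),
        LineEvent (m := m) (colFinset q.2) 1 q.1 K M) ≤ (n : ℝ) ^ 3 * discreteTail n K t h M m := by
      refine (bernP_biUnion_le hp0 hp1 _ _).trans ?_
      refine (Finset.sum_le_card_nsmul _ _ _ fun q _ =>
        (bernP_lineEvent_col_le hn hp0 hp1 q.2 1 _ q.1 (origin n hn) hKn M).trans
          (max_pow_le_discreteTail hn ht hx M)).trans ?_
      rw [Finset.card_univ, hcv, nsmul_eq_mul]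
      push_cast
      rfl
    have h4 : (n : ℝ) ^ 3 * discreteTail n K t h M m + (n : ℝ) ^ 3 * discreteTail n K t h M m
        ≤ (n : ℝ) ^ 4 * discreteTail n K t h M m := by
      have h5 : 0 ≤ discreteTail n K t h M m := pow_nonneg (le_max_left _ _) _
      have h6 : (n : ℝ) ^ 4 * discreteTail n K t h M m
          = (n : ℝ) * ((n : ℝ) ^ 3 * discreteTail n K t h M m) := by ring
      rw [h6]
      nlinarith [mul_nonneg (pow_nonneg (show (0 : ℝ) ≤ n by linarith) 3) h5]
    have u1 := bernP_union_le hp0 hp1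
      (⋃ v ∈ (Finset.univ : Finset (Vertex n)),
        {ω : Edge n × ZMod m → Bool | K + 1 ≤ (visited ω 1 v (k * m + 1)).card})
      ((⋃ q ∈ (Finset.univ : Finset (Vertex n × Fin n)), LineEvent (rowFinset q.2) 1 q.1 K M) ∪
       (⋃ q ∈ (Finset.univ : Finset (Vertex n × Fin n)), LineEvent (colFinset q.2) 1 q.1 K M))
    have u2 := bernP_union_le hp0 hp1
      (⋃ q ∈ (Finset.univ : Finset (Vertex n × Fin n)),
        LineEvent (m := m) (rowFinset q.2) 1 q.1 K M)
      (⋃ q ∈ (Finset.univ : Finset (Vertex n × Fin n)), LineEvent (colFinset q.2) 1 q.1 K M)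
    linarith

end Tails

/-! ### Fixed heights and windows of heights -/

section Window

variable {n : ℕ} {Ω : Type*} [MeasurableSpace Ω] {P : Measure Ω} [IsProbabilityMeasure P]
  {N : Ω → Set (Edge n × ℝ)} {t : ℝ}

/-- The interchange process depends on the height only through the bridges below it. -/
lemma orb_congr {M : Set (Edge n × ℝ)} {s s' : ℝ} (h : bridges M s = bridges M s') (k : ℕ)
    (v : Vertex n) : orb M s k v = orb M s' k v := by
  have h1 : IsBridge M s = IsBridge M s' := by
    ext a b y
    unfold IsBridge
    rw [h]
  have h2 : IsNextUp M s = IsNextUp M s' := by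
    ext a b
    unfold IsNextUp
    rw [h1]
  have h3 : upStep M s = upStep M s' := by
    ext1 a
    unfold upStep
    revert h2
    generalize IsNextUp M s = Q
    rintro rfl
    rfl
  have h4 : sigma M s = sigma M s' := by
    ext1 a
    unfold sigma
    rw [h3, h]
  unfold orb
  rw [h4]

lemma hitTime_mono (M : Set (Edge n × ℝ)) (s : ℝ) (p : Vertex n × ℝ) {K k : ℕ} (h : K ≤ k) :
    hitTime M s p K ≤ hitTime M s p k := by
  unfold hitTime
  exact iInf_mono fun r => iInf_mono' fun hr => ⟨h.trans hr, le_rfl⟩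

lemma iota_mono {A B : Set (Vertex n)} (h : A ⊆ B) : iota A ≤ iota B := by
  unfold iota
  refine max_le_max (Finset.sup_mono_fun fun b _ => ?_) (Finset.sup_mono_fun fun b _ => ?_) <;>
  exact Set.ncard_le_ncard (Set.inter_subset_inter_right _ h) (Set.toFinite _)

lemma iota_union_le (A B : Set (Vertex n)) : iota (A ∪ B) ≤ iota A + iota B := by
  have hl : ∀ b, (row b ∩ A).ncard ≤ iota A ∧ (column b ∩ A).ncard ≤ iota A := fun b =>
    ⟨le_max_of_le_left (Finset.le_sup (f := fun i => (row i ∩ A).ncard) (Finset.mem_univ b)),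
      le_max_of_le_right (Finset.le_sup (f := fun i => (column i ∩ A).ncard) (Finset.mem_univ b))⟩
  have hr : ∀ b, (row b ∩ B).ncard ≤ iota B ∧ (column b ∩ B).ncard ≤ iota B := fun b =>
    ⟨le_max_of_le_left (Finset.le_sup (f := fun i => (row i ∩ B).ncard) (Finset.mem_univ b)),
      le_max_of_le_right (Finset.le_sup (f := fun i => (column i ∩ B).ncard) (Finset.mem_univ b))⟩
  rw [iota]
  refine max_le (Finset.sup_le fun b _ => ?_) (Finset.sup_le fun b _ => ?_) <;>
  · rw [Set.inter_union_distrib_left]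
    refine (Set.ncard_union_le _ _).trans (add_le_add ?_ ?_)
    · first | exact (hl b).1 | exact (hl b).2
    · first | exact (hr b).1 | exact (hr b).2

/-- Cutting an orbit segment into `A` shorter ones. -/
lemma iota_orb_block_le (M : Set (Edge n × ℝ)) (s : ℝ) (k' : ℕ) {I : ℕ}
    (hI : ∀ w : Vertex n, iota (orb M s k' w) ≤ I) (A : ℕ) :
    ∀ (k : ℕ) (v : Vertex n), k + 1 ≤ A * (k' + 1) → iota (orb M s k v) ≤ A * I := by
  induction A with
  | zero => intro k v h; omega
  | succ A ih =>
    intro k v h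
    rcases Nat.lt_or_ge k' k with hk | hk
    · have hsub : orb M s k v ⊆
          orb M s k' v ∪ orb M s (k - (k' + 1)) ((sigma M s)^[k' + 1] v) := by
        rintro w ⟨l, hl, rfl⟩
        rcases Nat.lt_or_ge k' l with hl' | hl'
        · right
          refine ⟨l - (k' + 1), by omega, ?_⟩
          rw [← Function.iterate_add_apply]
          congr 1
          omega
        · exact Or.inl ⟨l, hl', rfl⟩
      have h1 := ih (k - (k' + 1)) ((sigma M s)^[k' + 1] v) (by
        have : (A + 1) * (k' + 1) = A * (k' + 1) + (k' + 1) := by ring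
        omega)
      calc iota (orb M s k v) ≤ _ := iota_mono hsub
        _ ≤ _ := iota_union_le _ _
        _ ≤ I + A * I := add_le_add (hI v) h1
        _ = (A + 1) * I := by ring
    · have hsub : orb M s k v ⊆ orb M s k' v := by
        rintro w ⟨l, hl, rfl⟩
        exact ⟨l, hl.trans hk, rfl⟩
      calc iota (orb M s k v) ≤ I := (iota_mono hsub).trans (hI v)
        _ ≤ (A + 1) * I := Nat.le_mul_of_pos_left _ (Nat.succ_pos A)

/-- If at most one bridge lies in a height window, the process at any height of the window is
the process at one of its two ends. -/
lemma bridges_eq_or_eq {M : Set (Edge n × ℝ)} {x l s : ℝ} (hs : x < s)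
    (hs' : s ≤ x + l) (h : ¬ 2 ≤ (M ∩ Set.univ ×ˢ Set.Ioc x (x + l)).encard) :
    bridges M s = bridges M x ∨ bridges M s = bridges M (x + l) := by
  have hone : (M ∩ Set.univ ×ˢ Set.Ioc x (x + l)).encard ≤ 1 := by
    by_contra hc
    push Not at hc
    exact h (by simpa [one_add_one_eq_two] using Order.add_one_le_of_lt hc)
  rw [Set.encard_le_one_iff] at hone
  by_cases hb : ∃ b ∈ M, x < b.2 ∧ b.2 ≤ s
  · obtain ⟨b, hbM, hb1, hb2⟩ := hb
    right
    ext a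
    refine ⟨fun ha => ⟨ha.1, ha.2.1, ha.2.2.trans hs'⟩, fun ha => ⟨ha.1, ha.2.1, ?_⟩⟩
    by_contra hc
    push Not at hc
    have := hone a b ⟨ha.1, Set.mem_univ _, hs.trans hc, ha.2.2⟩
      ⟨hbM, Set.mem_univ _, hb1, hb2.trans hs'⟩
    rw [this] at hc
    exact absurd hb2 (not_le.2 hc)
  · left
    push Not at hb
    ext a
    refine ⟨fun ha => ⟨ha.1, ha.2.1, ?_⟩, fun ha => ⟨ha.1, ha.2.1, ha.2.2.trans hs.le⟩⟩
    by_contra hc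
    push Not at hc
    exact absurd ha.2.2 (not_le.2 (hb a ha.1 hc))

/-- A bound at every fixed height of a window becomes a bound on the whole window, at the cost of
a grid of `L + 1` heights and of the chance that two bridges share a cell of the grid. -/
lemma real_exists_mem_window_le (hn : 2 ≤ n)
    (hN : IsPoissonPointProcess P (bridgeIntensity n) N) {a D q : ℝ} (ha : 0 ≤ a) (hD : 0 ≤ D)
    {L : ℕ} (hL : 0 < L) (E : Set (Edge n × ℝ) → ℝ → Prop)
    (hE : ∀ M s s', bridges M s = bridges M s' → E M s → E M s')
    (hq : ∀ s ∈ Set.Icc a (a + D), P.real {ω | E (N ω) s} ≤ q) :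
    P.real {ω | ∃ s ∈ Set.Icc a (a + D), E (N ω) s} ≤ (L + 1) * q + D ^ 2 / L := by
  have hL' : (0 : ℝ) < L := by exact_mod_cast hL
  set l := D / L with hl
  have hl0 : 0 ≤ l := by positivity
  have hLl : (L : ℝ) * l = D := by rw [hl]; field_simp
  set g : ℕ → ℝ := fun i => a + i * l with hg
  have hg0 : ∀ i, a ≤ g i := fun i =>
    le_add_of_nonneg_right (mul_nonneg (Nat.cast_nonneg i) hl0)
  have hgs : ∀ i, g (i + 1) = g i + l := fun i => by simp only [hg]; push_cast; ring
  have hgm : ∀ i, i ≤ L → g i ≤ a + D := fun i hi => by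
    have : (i : ℝ) ≤ L := by exact_mod_cast hi
    simp only [hg]
    nlinarith
  have hsub : {ω | ∃ s ∈ Set.Icc a (a + D), E (N ω) s} ⊆
      (⋃ i ∈ Finset.range (L + 1), {ω | E (N ω) (g i)}) ∪
      (⋃ i ∈ Finset.range L, {ω | 2 ≤ (N ω ∩ Set.univ ×ˢ Set.Ioc (g i) (g i + l)).encard}) := by
    rintro ω ⟨s, hs, hEs⟩
    have hex : ∃ j, s ≤ g j := ⟨L, by simp only [hg]; rw [hLl]; exact hs.2⟩
    classical
    have hjL : Nat.find hex ≤ L := Nat.find_min' hex (by simp only [hg]; rw [hLl]; exact hs.2)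
    have hj := Nat.find_spec hex
    have hmin := fun i => Nat.find_min (H := hex) (m := i)
    generalize Nat.find hex = j at hjL hj hmin
    rcases j with _ | i
    · left
      refine Set.mem_biUnion (x := 0) (by simp) ?_
      have : s = g 0 := le_antisymm hj (by simpa [hg] using hs.1)
      exact this ▸ hEs
    · have hlt : g i < s := not_le.1 (hmin i (Nat.lt_succ_self i))
      rw [hgs] at hj
      by_cases h2 : 2 ≤ (N ω ∩ Set.univ ×ˢ Set.Ioc (g i) (g i + l)).encard
      · exact Or.inr (Set.mem_biUnion (x := i) (by simp; omega) h2)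
      · left
        rcases bridges_eq_or_eq hlt hj h2 with h | h
        · exact Set.mem_biUnion (x := i) (by simp; omega) (hE _ _ _ h hEs)
        · refine Set.mem_biUnion (x := i + 1) (by simp; omega) ?_
          have := hE _ _ _ h hEs
          rw [← hgs] at this
          exact this
  refine (measureReal_mono hsub).trans ((measureReal_union_le _ _).trans (add_le_add ?_ ?_))
  · refine (measureReal_biUnion_finset_le _ _).trans ?_
    refine (Finset.sum_le_card_nsmul _ _ q fun i hi =>
      hq _ ⟨hg0 i, hgm i (by simpa [Nat.lt_succ_iff] using hi)⟩).trans ?_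
    simp
  · refine (measureReal_biUnion_finset_le _ _).trans ?_
    refine (Finset.sum_le_card_nsmul _ _ (l ^ 2) fun i _ =>
      real_two_le_window hn hN (ha.trans (hg0 i)) hl0).trans ?_
    rw [Finset.card_range, nsmul_eq_mul, hl, div_pow]
    apply le_of_eq
    field_simp

end Window

/-! ### Heights of order `n ^ 2` and walks of length `n / log n` -/

section Uniform

universe u

lemma escapeLimit_ge {n : ℕ} (hn : 2 ≤ n) {c s : ℝ} (hc : 0 < c)
    (hs : s ∈ Set.Icc (c⁻¹ / 2 * (n : ℝ) ^ 2) (c * (n : ℝ) ^ 2)) :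
    (c⁻¹ / 2) ^ 2 / 4 * Real.exp (-4 * c) ≤ escapeLimit n s := by
  have hn' : (2 : ℝ) ≤ n := by exact_mod_cast hn
  have hn1 : (0 : ℝ) < (n : ℝ) - 1 := by linarith
  unfold escapeLimit
  refine mul_le_mul ?_ ?_ (by positivity) (by positivity)
  · rw [div_le_div_iff₀ (by norm_num) (by positivity)]
    have h1 : (c⁻¹ / 2 * (n : ℝ) ^ 2) ^ 2 ≤ s ^ 2 := pow_le_pow_left₀ (by positivity) hs.1 2
    have h2 : ((n : ℝ) - 1) ^ 2 ≤ (n : ℝ) ^ 2 := pow_le_pow_left₀ hn1.le (by linarith) 2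
    calc (c⁻¹ / 2) ^ 2 * (4 * (n : ℝ) ^ 2 * ((n : ℝ) - 1) ^ 2)
        ≤ (c⁻¹ / 2) ^ 2 * (4 * (n : ℝ) ^ 2 * (n : ℝ) ^ 2) := by gcongr
      _ = (c⁻¹ / 2 * (n : ℝ) ^ 2) ^ 2 * 4 := by ring
      _ ≤ s ^ 2 * 4 := by gcongr
  · rw [Real.exp_le_exp, le_div_iff₀ (by positivity)]
    linarith [hs.2]

/-- At a height of order `n ^ 2` at which long cyclic walks have probability at least `ε`, a
segment of length at most `n / log n` of a cycle meets no line in `log ^ 2 n` vertices. The segment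
is cut into boundedly many shorter ones, so that the lengthening by `2 * exp (2 * s / n ^ 2)` in
the bound for one segment brings it back to at most the length for which `ε` is available. -/
lemma exists_bound_log_sq_le_iota_orb {c ε : ℝ} (hc : 0 < c) (hε : 0 < ε) :
    ∃ κ C B : ℝ, 0 < κ ∧ 0 < C ∧ ∀ (n : ℕ) (hn : 2 ≤ n) {Ω : Type u} [MeasurableSpace Ω]
      (P : Measure Ω) [IsProbabilityMeasure P] (N : Ω → Set (Edge n × ℝ)),
      IsPoissonPointProcess P (bridgeIntensity n) N → B ≤ Real.log n →
      ∀ s ∈ Set.Icc (c⁻¹ / 2 * (n : ℝ) ^ 2) (c * (n : ℝ) ^ 2), ∀ k : ℕ,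
      (k : ℝ) ≤ n / Real.log n →
      ε ≤ P.real {ω | hitTime (N ω) s (origin n hn, 0) k < ⊤} →
      P.real {ω | ∃ v : Vertex n, Real.log n ^ 2 ≤ (iota (orb (N ω) s k v) : ℝ)}
        ≤ C * ((n : ℝ) ^ 4 * Real.exp (-κ * Real.log n ^ 2)) := by
  set A : ℕ := ⌈2 * Real.exp (2 * c)⌉₊ with hA
  set α : ℝ := (c⁻¹ / 2) ^ 2 / 4 * Real.exp (-4 * c) with hα
  set β : ℝ := α * (ε / 2) with hβ
  have hAe : 2 * Real.exp (2 * c) ≤ A := Nat.le_ceil _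
  have hA0 : (0 : ℝ) < A := lt_of_lt_of_le (by positivity) hAe
  have hA0' : 0 < A := by exact_mod_cast hA0
  have hα0 : 0 < α := by positivity
  have hβ0 : 0 < β := by positivity
  set κ : ℝ := min (β / (2 * A)) (Real.exp (-2 * c) / A) with hκ
  refine ⟨κ, Real.exp (β / 2) + Real.exp 1, max 2 (20 * Real.exp (2 * c) / ε),
    by positivity, by positivity, ?_⟩
  intro n hn Ω _ P _ N hN hB s hs k hk hprob
  set x := Real.log n with hx
  have hx2 : 2 ≤ x := (le_max_left _ _).trans hB
  have hxε : 20 * Real.exp (2 * c) / ε ≤ x := (le_max_right _ _).trans hB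
  have hx0 : 0 < x := by linarith
  have hn' : (2 : ℝ) ≤ n := by exact_mod_cast hn
  have hn2 : (0 : ℝ) < (n : ℝ) ^ 2 := by positivity
  have hs0 : 0 < s := lt_of_lt_of_le (by positivity) hs.1
  have hsn : s / (n : ℝ) ^ 2 ≤ c := by rw [div_le_iff₀ hn2]; exact hs.2
  have hexp : Real.exp (2 * s / (n : ℝ) ^ 2) ≤ Real.exp (2 * c) := by
    rw [Real.exp_le_exp, mul_div_assoc]; linarith
  set k' := k / A with hk'
  set M := ⌈x ^ 2 / A⌉₊ with hM
  have hM0 : 0 < M := Nat.ceil_pos.2 (by positivity)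
  set K := ⌈2 * Real.exp (2 * s / (n : ℝ) ^ 2) * k'⌉₊ with hK
  have hKk : K ≤ k := by
    have h1 : K ≤ A * k' := by
      refine Nat.ceil_le.2 ?_
      push_cast
      gcongr
      linarith
    exact h1.trans (Nat.mul_div_le k A)
  have hKn : (K : ℝ) ≤ n / x := le_trans (by exact_mod_cast hKk) hk
  have hKn2 : (K : ℝ) ≤ n / 2 := hKn.trans (by gcongr)
  have hincl : {ω | ∃ v : Vertex n, x ^ 2 ≤ (iota (orb (N ω) s k v) : ℝ)} ⊆
      {ω | ∃ v : Vertex n, M ≤ iota (orb (N ω) s k' v)} := by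
    rintro ω ⟨v, hv⟩
    by_contra hcon
    simp only [Set.mem_ofPred_eq, not_exists, not_le] at hcon
    have h1 := iota_orb_block_le (N ω) s k' (I := M - 1)
      (fun w => Nat.le_sub_one_of_lt (hcon w)) A k v
      (Nat.lt_mul_div_succ k hA0')
    have h2 : ((M - 1 : ℕ) : ℝ) < x ^ 2 / A := Nat.lt_ceil.1 (Nat.sub_lt hM0 one_pos)
    have h3 : (iota (orb (N ω) s k v) : ℝ) ≤ A * (M - 1 : ℕ) := by exact_mod_cast h1
    rw [lt_div_iff₀ hA0] at h2
    linarith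
  refine (measureReal_mono hincl).trans ?_
  -- a segment with fewer vertices than `M` needs no estimate
  rcases Nat.lt_or_ge (k' + 1) M with hMk | hMk
  · have : {ω | ∃ v : Vertex n, M ≤ iota (orb (N ω) s k' v)} = ∅ := by
      ext ω
      simp only [Set.mem_ofPred_eq, Set.mem_empty_iff_false, iff_false, not_exists, not_le]
      exact fun v => ((iota_le_ncard _).trans (ncard_orb_le _ _ _)).trans_lt hMk
    rw [this, measureReal_empty]
    positivity
  have hMx : x ^ 2 / A ≤ M := Nat.le_ceil _
  have hkx : x ^ 2 / A - 1 ≤ k' := by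
    have : (M : ℝ) ≤ k' + 1 := by exact_mod_cast hMk
    linarith
  refine (real_exists_le_iota_orb hn hN hs0 k' M hK hKn2).trans ?_
  set h := P.real {ω | hitTime (N ω) s (origin n hn, 0) K < ⊤} with hh
  have hhε : ε ≤ h := hprob.trans
    (measureReal_mono fun ω hω => lt_of_le_of_lt (hitTime_mono _ _ _ hKk) hω)
  have herr : 10 * (K : ℝ) / n * Real.exp (2 * s / (n : ℝ) ^ 2) ≤ ε / 2 := by
    have h1 : 10 * (K : ℝ) / n ≤ 10 / x := by
      rw [le_div_iff₀ hx0] at hKn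
      rw [div_le_div_iff₀ (by linarith) hx0]
      linarith
    calc 10 * (K : ℝ) / n * Real.exp (2 * s / (n : ℝ) ^ 2) ≤ 10 / x * Real.exp (2 * c) := by
          gcongr
      _ ≤ ε / 2 := by
          rw [div_le_iff₀ hε] at hxε
          rw [div_mul_eq_mul_div, div_le_iff₀ hx0]
          linarith
  have hbase : 1 - escapeLimit n s * (h - 10 * K / n * Real.exp (2 * s / (n : ℝ) ^ 2))
      ≤ Real.exp (-β) := by
    have h1 : β ≤ escapeLimit n s * (h - 10 * K / n * Real.exp (2 * s / (n : ℝ) ^ 2)) :=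
      mul_le_mul (escapeLimit_ge hn hc hs) (by linarith) (by positivity) escapeLimit_nonneg
    linarith [Real.add_one_le_exp (-β)]
  have hpow : (1 - escapeLimit n s * (h - 10 * K / n * Real.exp (2 * s / (n : ℝ) ^ 2))) ^ (M / 2)
      ≤ Real.exp (β / 2) * Real.exp (-κ * x ^ 2) := by
    refine (pow_le_pow_left₀ (tailBase_nonneg hn hs0 measureReal_le_one K) hbase _).trans ?_
    rw [← Real.exp_nat_mul, ← Real.exp_add, Real.exp_le_exp]
    have h1 : (M : ℝ) ≤ 2 * (M / 2 : ℕ) + 1 := by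
      exact_mod_cast (show M ≤ 2 * (M / 2) + 1 by omega)
    have h2 : κ * x ^ 2 ≤ β / (2 * A) * x ^ 2 := by gcongr; exact min_le_left _ _
    have h3 : β / (2 * A) * x ^ 2 = β / 2 * (x ^ 2 / A) := by field_simp
    have h4 : β / 2 * (x ^ 2 / A) ≤ β / 2 * (2 * (M / 2 : ℕ) + 1) := by
      gcongr
      exact hMx.trans h1
    linarith
  have hsecond : Real.exp (-(Real.exp (-2 * s / (n : ℝ) ^ 2) * k'))
      ≤ Real.exp 1 * Real.exp (-κ * x ^ 2) := by
    rw [← Real.exp_add, Real.exp_le_exp]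
    have h0 : Real.exp (-2 * c) ≤ Real.exp (-2 * s / (n : ℝ) ^ 2) := by
      rw [Real.exp_le_exp, mul_div_assoc]; linarith
    have h1 : Real.exp (-2 * c) * k' ≤ Real.exp (-2 * s / (n : ℝ) ^ 2) * k' := by gcongr
    have h2 : Real.exp (-2 * c) * (x ^ 2 / A - 1) ≤ Real.exp (-2 * c) * k' := by gcongr
    have h3 : κ * x ^ 2 ≤ Real.exp (-2 * c) / A * x ^ 2 := by gcongr; exact min_le_right _ _
    have h4 : Real.exp (-2 * c) / A * x ^ 2 = Real.exp (-2 * c) * (x ^ 2 / A) := by field_simp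
    have h5 : Real.exp (-2 * c) ≤ 1 := Real.exp_le_one_iff.2 (by linarith)
    linarith
  have hn24 : (n : ℝ) ^ 2 ≤ (n : ℝ) ^ 4 := pow_le_pow_right₀ (by linarith) (by norm_num)
  calc _ ≤ (n : ℝ) ^ 4 * (Real.exp (β / 2) * Real.exp (-κ * x ^ 2))
        + (n : ℝ) ^ 4 * (Real.exp 1 * Real.exp (-κ * x ^ 2)) := by gcongr
    _ = _ := by ring

/-- A polynomial factor in `n` is absorbed by half of a rate in `log ^ 2 n`. -/
lemma pow_four_mul_exp_le {n : ℕ} (hn : 2 ≤ n) {κ : ℝ} (hκ : 0 < κ) :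
    (n : ℝ) ^ 4 * Real.exp (-(κ / 2) * Real.log n ^ 2)
      ≤ Real.exp (16 / κ) * Real.exp (-(κ / 4) * Real.log n ^ 2) := by
  have hn0 : (0 : ℝ) < n := by exact_mod_cast (by omega : 0 < n)
  set x := Real.log n with hx
  have h1 : (n : ℝ) ^ 4 = Real.exp (4 * x) := by
    rw [hx, mul_comm, Real.exp_mul, Real.exp_log hn0]
    norm_cast
  rw [h1, ← Real.exp_add, ← Real.exp_add, Real.exp_le_exp]
  have h2 : 16 / κ - 4 * x + κ / 4 * x ^ 2 = (κ * x - 8) ^ 2 / (4 * κ) := by field_simp; ring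
  have h3 : 0 ≤ (κ * x - 8) ^ 2 / (4 * κ) := by positivity
  linarith

/-- The isoperimetric constant of the cycles, uniformly over a window of heights. -/
theorem exists_window_bound {Ω : ℕ → Type u} [∀ n, MeasurableSpace (Ω n)]
    (P : ∀ n, Measure (Ω n)) [∀ n, IsProbabilityMeasure (P n)]
    (N : ∀ n, Ω n → Set (Edge n × ℝ))
    (hN : ∀ n : ℕ, 2 ≤ n → IsPoissonPointProcess (P n) (bridgeIntensity n) (N n))
    {c : ℝ} {t Δ : ℕ → ℝ} {k : ℕ → ℕ} (hc : 0 < c)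
    (ht : ∀ n : ℕ, 2 ≤ n → t n ∈ Set.Icc (c⁻¹ * (n : ℝ) ^ 2) (c * (n : ℝ) ^ 2))
    (hΔ : ∀ n : ℕ, 2 ≤ n → 0 ≤ Δ n ∧ Δ n ≤ n / Real.log n)
    (hk : ∀ n : ℕ, 2 ≤ n → (k n : ℝ) ≤ n / Real.log n)
    (hlim : 0 < liminf (fun n : ℕ => ⨅ (hn : 2 ≤ n), ⨅ s ∈ Set.Icc (t n - Δ n) (t n),
      P n {ω | hitTime (N n ω) s (origin n hn, 0) (k n) < ⊤}) atTop) :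
    ∃ κ C : ℝ, 0 < κ ∧ 0 < C ∧ ∀ n : ℕ, 2 ≤ n →
      (P n).real {ω | ∃ s ∈ Set.Icc (t n - Δ n) (t n), ∃ v : Vertex n,
          Real.log n ^ 2 ≤ (iota (orb (N n ω) s (k n) v) : ℝ)}
        ≤ C * Real.exp (-κ * Real.log n ^ 2) := by
  obtain ⟨ε, hε0, hεlim⟩ := ENNReal.lt_iff_exists_nnreal_btwn.1 hlim
  have hε : (0 : ℝ) < ε := by exact_mod_cast hε0
  obtain ⟨κ, C, B, hκ, hC, hbound⟩ := exists_bound_log_sq_le_iota_orb.{u} hc hε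
  have hlog : Tendsto (fun n : ℕ => Real.log n) atTop atTop :=
    Real.tendsto_log_atTop.comp tendsto_natCast_atTop_atTop
  obtain ⟨n₁, hn₁⟩ := eventually_atTop.1 ((eventually_lt_of_lt_liminf hεlim).and
    (hlog.eventually_ge_atTop (max 1 (max (2 * c) B))))
  have hlarge : ∀ n : ℕ, 2 ≤ n → n₁ ≤ n →
      (P n).real {ω | ∃ s ∈ Set.Icc (t n - Δ n) (t n), ∃ v : Vertex n,
          Real.log n ^ 2 ≤ (iota (orb (N n ω) s (k n) v) : ℝ)}
        ≤ (3 * C + 1) * Real.exp (16 / κ) * Real.exp (-(κ / 4) * Real.log n ^ 2) := by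
    intro n hn hn1
    obtain ⟨hinf, hlogn⟩ := hn₁ n hn1
    have hn' : (2 : ℝ) ≤ n := by exact_mod_cast hn
    set x := Real.log n with hx
    have hx1 : 1 ≤ x := (le_max_left _ _).trans hlogn
    have hxc : 2 * c ≤ x := ((le_max_left _ _).trans (le_max_right _ _)).trans hlogn
    have hxB : B ≤ x := ((le_max_right _ _).trans (le_max_right _ _)).trans hlogn
    have hxn : x ≤ n := (Real.log_le_sub_one_of_pos (by linarith)).trans (by linarith)
    have hΔn : Δ n ≤ n := (hΔ n hn).2.trans (div_le_self (by linarith) hx1)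
    have hΔ0 := (hΔ n hn).1
    have hca : c⁻¹ / 2 * (n : ℝ) ^ 2 ≤ t n - Δ n := by
      have h1 : (n : ℝ) ≤ c⁻¹ / 2 * (n : ℝ) ^ 2 := by
        have h2 : 1 ≤ c⁻¹ / 2 * (n : ℝ) := by
          rw [div_mul_eq_mul_div, inv_mul_eq_div, div_div, le_div_iff₀ (by positivity)]
          linarith
        nlinarith
      linarith [(ht n hn).1]
    have hprob : ∀ s ∈ Set.Icc (t n - Δ n) (t n),
        (ε : ℝ) ≤ (P n).real {ω | hitTime (N n ω) s (origin n hn, 0) (k n) < ⊤} := by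
      intro s hs
      have h1 := hinf.le.trans ((iInf_le _ hn).trans (iInf₂_le s hs))
      rw [measureReal_def]
      exact ENNReal.toReal_mono (measure_ne_top _ _) h1
    set q := C * ((n : ℝ) ^ 4 * Real.exp (-κ * x ^ 2)) with hq
    set y := Real.exp (κ / 2 * x ^ 2) with hy
    have hy1 : 1 ≤ y := Real.one_le_exp (by positivity)
    have hgrid := real_exists_mem_window_le hn (hN n hn) (a := t n - Δ n) (D := Δ n) (q := q)
      (le_trans (by positivity) hca) hΔ0 (L := ⌈y⌉₊) (Nat.ceil_pos.2 (by positivity))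
      (fun M s => ∃ v : Vertex n, x ^ 2 ≤ (iota (orb M s (k n) v) : ℝ))
      (fun M s s' h => by simp only [orb_congr h]; exact id)
      (fun s hs => by
        rw [sub_add_cancel] at hs
        exact hbound n hn (P n) (N n) (hN n hn) hxB s
          ⟨hca.trans hs.1, hs.2.trans (ht n hn).2⟩ (k n) (hk n hn) (hprob s hs))
    rw [sub_add_cancel] at hgrid
    refine hgrid.trans ?_
    have hL1 : (⌈y⌉₊ : ℝ) + 1 ≤ 3 * y := by
      have := Nat.ceil_lt_add_one (show 0 ≤ y by positivity)
      linarith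
    have hyinv : y * Real.exp (-κ * x ^ 2) = Real.exp (-(κ / 2) * x ^ 2) := by
      rw [hy, ← Real.exp_add]; ring_nf
    have hyinv' : y⁻¹ = Real.exp (-(κ / 2) * x ^ 2) := by
      rw [hy, ← Real.exp_neg]; ring_nf
    have h1 : ((⌈y⌉₊ : ℝ) + 1) * q ≤ 3 * C * ((n : ℝ) ^ 4 * Real.exp (-(κ / 2) * x ^ 2)) := by
      calc ((⌈y⌉₊ : ℝ) + 1) * q ≤ 3 * y * q := by gcongr
        _ = 3 * C * ((n : ℝ) ^ 4 * (y * Real.exp (-κ * x ^ 2))) := by rw [hq]; ring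
        _ = _ := by rw [hyinv]
    have h2 : Δ n ^ 2 / (⌈y⌉₊ : ℝ) ≤ (n : ℝ) ^ 4 * Real.exp (-(κ / 2) * x ^ 2) := by
      have h3 : Δ n ^ 2 ≤ (n : ℝ) ^ 4 :=
        (pow_le_pow_left₀ hΔ0 hΔn 2).trans (pow_le_pow_right₀ (by linarith) (by norm_num))
      rw [← hyinv', ← div_eq_mul_inv]
      exact div_le_div₀ (by positivity) h3 (by positivity) (Nat.le_ceil _)
    calc _ ≤ (3 * C + 1) * ((n : ℝ) ^ 4 * Real.exp (-(κ / 2) * x ^ 2)) := by linarith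
      _ ≤ (3 * C + 1) * (Real.exp (16 / κ) * Real.exp (-(κ / 4) * x ^ 2)) := by
          exact mul_le_mul_of_nonneg_left (pow_four_mul_exp_le hn hκ) (by positivity)
      _ = _ := by ring
  -- the finitely many small `n` only affect the constant
  refine ⟨κ / 4, (3 * C + 1) * Real.exp (16 / κ) + Real.exp (κ / 4 * Real.log n₁ ^ 2),
    by positivity, by positivity, fun n hn => ?_⟩
  rw [add_mul]
  rcases Nat.lt_or_ge n n₁ with h | h
  · have h1 : Real.log n ^ 2 ≤ Real.log n₁ ^ 2 := by
      have hn0 : (1 : ℝ) ≤ n := by exact_mod_cast (by omega : 1 ≤ n)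
      refine pow_le_pow_left₀ (Real.log_nonneg hn0) (Real.log_le_log (by linarith) ?_) 2
      exact_mod_cast h.le
    have h2 : 1 ≤ Real.exp (κ / 4 * Real.log n₁ ^ 2) * Real.exp (-(κ / 4) * Real.log n ^ 2) := by
      rw [← Real.exp_add]
      refine Real.one_le_exp ?_
      have := mul_le_mul_of_nonneg_left h1 (show 0 ≤ κ / 4 by positivity)
      linarith
    refine measureReal_le_one.trans (h2.trans (le_add_of_nonneg_left (by positivity)))
  · exact (hlarge n hn h).trans (le_add_of_nonneg_right (by positivity))

end Uniform
end Interchange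

theorem mainTheorem2
    {Ω : ℕ → Type*} [∀ n, MeasurableSpace (Ω n)] (P : ∀ n, Measure (Ω n))
    [∀ n, IsProbabilityMeasure (P n)]
    (N : ∀ n, Ω n → Set (Interchange.Edge n × ℝ))
    (hN : ∀ n : ℕ, 2 ≤ n →
      Interchange.IsPoissonPointProcess (P n) (Interchange.bridgeIntensity n) (N n)) :
    -- the tail of `|Z_k ∩ L_0|`
    (∀ (n : ℕ) (hn : 2 ≤ n) (t : ℝ), 0 < t →
      ∀ (v : Interchange.Vertex n) (z : ℝ), z ∈ Set.Icc 0 t →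
      ∀ k M : ℕ, (k : ℝ) ≤ n / 2 →
        (P n).real {ω | M ≤ (Interchange.Z (N n ω) t (v, z) k
            ∩ Interchange.row (⟨0, by omega⟩ : Fin n)).ncard}
          ≤ (1 - t ^ 2 / (4 * (n : ℝ) ^ 2 * ((n : ℝ) - 1) ^ 2) * Real.exp (-4 * t / (n : ℝ) ^ 2)
              * ((P n).real {ω | Interchange.hitTime (N n ω) t (v, z) k < ⊤}
                - 10 * k / n * Real.exp (2 * t / (n : ℝ) ^ 2))) ^ (M / 2)) ∧
    -- isoperimetry of cycles at a given time
    (∀ (n : ℕ) (hn : 2 ≤ n) (t : ℝ), 0 < t → ∀ k M K : ℕ,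
      K = ⌈2 * Real.exp (2 * t / (n : ℝ) ^ 2) * k⌉₊ → (K : ℝ) ≤ n / 2 →
        (P n).real {ω | ∃ v : Interchange.Vertex n,
            M ≤ Interchange.iota (Interchange.orb (N n ω) t k v)}
          ≤ (n : ℝ) ^ 4 *
              (1 - t ^ 2 / (4 * (n : ℝ) ^ 2 * ((n : ℝ) - 1) ^ 2) * Real.exp (-4 * t / (n : ℝ) ^ 2)
                * ((P n).real {ω |
                      Interchange.hitTime (N n ω) t (Interchange.origin n hn, 0) K < ⊤}
                  - 10 * K / n * Real.exp (2 * t / (n : ℝ) ^ 2))) ^ (M / 2)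
            + (n : ℝ) ^ 2 * Real.exp (-(Real.exp (-2 * t / (n : ℝ) ^ 2) * k))) ∧
    -- isoperimetry of cycles uniformly over a window of times
    (∀ (c : ℝ) (t Δ : ℕ → ℝ) (k : ℕ → ℕ), 0 < c →
      (∀ n : ℕ, 2 ≤ n → t n ∈ Set.Icc (c⁻¹ * (n : ℝ) ^ 2) (c * (n : ℝ) ^ 2)) →
      (∀ n : ℕ, 2 ≤ n → 0 ≤ Δ n ∧ Δ n ≤ n / Real.log n) →
      (∀ n : ℕ, 2 ≤ n → (k n : ℝ) ≤ n / Real.log n) →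
      0 < liminf (fun n : ℕ => ⨅ (hn : 2 ≤ n), ⨅ s ∈ Set.Icc (t n - Δ n) (t n),
          P n {ω | Interchange.hitTime (N n ω) s (Interchange.origin n hn, 0) (k n) < ⊤}) atTop →
      ∃ κ C : ℝ, 0 < κ ∧ 0 < C ∧ ∀ n : ℕ, 2 ≤ n →
        (P n).real {ω | ∃ s ∈ Set.Icc (t n - Δ n) (t n), ∃ v : Interchange.Vertex n,
            Real.log n ^ 2 ≤ (Interchange.iota (Interchange.orb (N n ω) s (k n) v) : ℝ)}
          ≤ C * Real.exp (-κ * Real.log n ^ 2)) := by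
  refine ⟨fun n hn t ht v z hz k M hkn => ?_, fun n hn t ht k M K hK hKn => ?_,
    fun c t Δ k hc ht hΔ hk hlim => ?_⟩
  · exact Interchange.real_le_ncard_Z_inter_row hn (hN n hn) ht v hz M hkn ⟨0, by omega⟩
  · exact Interchange.real_exists_le_iota_orb hn (hN n hn) ht k M hK hKn
  · exact Interchange.exists_window_bound P N hN hc ht hΔ hk hlim
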